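/- Let $(Q,D,L)$ be a nonholonomic $G$-Chaplygin system: $Q$ is a smooth $n$-dimensional manifold with a Riemannian metric $\langle\langle\cdot,\cdot\rangle\rangle$ (the kinetic energy), $U\in C^\infty(Q)$ is the potential energy, $D\subset TQ$ is a smooth subbundle of rank $r$ with $2\le r<n$, and a Lie group $G$ acts smoothly, freely and properly on $Q$ by isometries, preserving $U$ and $D$, with $T_qQ=D_q\oplus(\mathfrak g\cdot q)$ for all $q\in Q$. Let $\pi:Q\to S=Q/G$ be the projection onto the shape space, $\mathcal P:TQ\to D$ the orthogonal projector, $\mathrm{hor}_q=(T_q\pi|_{D_q})^{-1}:T_{\pi(q)}S\to D_q$ the horizontal lift, and let $\tau_S:T^*S\to S$ be the cotangent bundle with its canonical symplectic form $\Omega_{can}$ (locally $\sum_i ds^i\wedge dp_i$) and the Liouville volume form $\nu=\Omega_{can}^r$. The gyroscopic tensor is $$\mathcal T(Y,Z)(s)=T_q\pi\big(\mathcal P[\mathrm{hor}\,Y,\mathrm{hor}\,Z](q)\big)-[Y,Z](s),\qquad \pi(q)=s,\quad Y,Z\in\mathfrak X(S),$$ and $\Theta$ is the 1-form on $S$ given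 by $\Theta(Y)=\sum_{j=1}^r\langle X^j,\mathcal T(X_j,Y)\rangle$, where $\{X_j\}$ is a local basis of vector fields on $S$ with dual basis $\{X^j\}$. On the dual bundle $D^*$ consider the nonholonomic bracket $\{\varphi,\psi\}_{D^*}=\{\varphi\circ i_D^*,\psi\circ i_D^*\}_{T^*Q}\circ\mathcal P^*$, where $i_D^*:T^*Q\to D^*$ is the restriction of covectors and $\mathcal P^*:D^*\to T^*Q$ is dual to $\mathcal P$, and the constrained Hamiltonian $h_c=h\circ\mathcal P^*$ with $h(\alpha)=\frac12\|\alpha\|^2+U(q)$ for $\alpha\in T_q^*Q$, where $\|\cdot\|$ is the norm on $T_q^*Q$ induced by the metric and $\{\cdot,\cdot\}_{T^*Q}$ is the canonical Poisson bracket. The dynamics is $X_{nh}[\varphi]=\{\varphi,h_c\}_{D^*}$. Identify $D^*/G$ with $T^*S$ by sending the class of $b\in D^*_q$ to the covector $u\mapsto b(\mathrm{hor}_q u)$ at $\pi(q)$. Then there is exactly one smooth vector field $\overline X_{nh}$ on $T^*S$ (the reduced dynamics) that is related to $X_{nh}$ by the projection $D^*\to D^*/G\cong T^*S$, and the following hold.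 (i) For every $\sigma\in C^\infty(S)$, the reduced dynamics preserves the basic volume form $\mu=\exp(\sigma\circ\tau_S)\,\nu$, i.e. $\mathcal L_{\overline X_{nh}}\mu=0$, if and only if $\Theta=d\sigma$. (ii) If $U=0$, then the reduced dynamics preserves some smooth volume form on $T^*S$ if and only if it preserves a basic one, i.e. one of the form $\exp(\sigma\circ\tau_S)\,\nu$ with $\sigma\in C^\infty(S)$. More precisely, if it preserves $\exp(\overline\sigma)\,\nu$ with $\overline\sigma\in C^\infty(T^*S)$, then it also preserves $\exp(\overline\sigma\circ 0\circ\tau_S)\,\nu$, where $0:S\to T^*S$ is the zero section. -/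

import Mathlib

open Bundle Set Filter Topology
open scoped Manifold ContDiff

/-! ### Differential forms on manifolds without boundary -/

section Forms

variable {F : Type*} [NormedAddCommGroup F] [NormedSpace ℝ F]
  {H : Type*} [TopologicalSpace H] {J : ModelWithCorners ℝ F H}
  {N : Type*} [TopologicalSpace N] [ChartedSpace H N]

/-- The coordinate expression, in the preferred chart around `x₀`, of a 1-form `θ`. -/
noncomputable def oneFormInChart (J : ModelWithCorners ℝ F H)
    (θ : ∀ x : N, TangentSpace J x →L[ℝ] ℝ) (x₀ : N) (y : F) : F →L[ℝ] ℝ :=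
  (θ ((extChartAt J x₀).symm y)).comp
    (mfderiv 𝓘(ℝ, F) J (extChartAt J x₀).symm y :
      F →L[ℝ] TangentSpace J ((extChartAt J x₀).symm y))

/-- The differential of the preferred chart at `x`, at the point `x` itself. -/
noncomputable def chartDifferential (J : ModelWithCorners ℝ F H) (x : N) :
    TangentSpace J x →L[ℝ] F :=
  mfderiv J 𝓘(ℝ, F) (extChartAt J x) x

/-- The exterior derivative of a 1-form `θ`: in coordinates,
`dθ(v, w) = D(θ(w))[v] - D(θ(v))[w]` for constant `v`, `w`. -/
noncomputable def extDerivOneForm (J : ModelWithCorners ℝ F H)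
    (θ : ∀ x : N, TangentSpace J x →L[ℝ] ℝ) (x : N) :
    LinearMap.BilinForm ℝ (TangentSpace J x) :=
  LinearMap.mk₂ ℝ
    (fun V W =>
      fderiv ℝ (oneFormInChart J θ x) (extChartAt J x x)
          (chartDifferential J x V) (chartDifferential J x W)
        - fderiv ℝ (oneFormInChart J θ x) (extChartAt J x x)
          (chartDifferential J x W) (chartDifferential J x V))
    (fun _ _ _ => by simp only [map_add, add_apply]; ring)
    (fun _ _ _ => by simp only [map_smul, smul_apply, smul_eq_mul]; ring)
    (fun _ _ _ => by simp only [map_add, add_apply]; ring)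
    (fun _ _ _ => by simp only [map_smul, smul_apply, smul_eq_mul]; ring)

/-- The coordinate expression, in the preferred chart around `x₀`, of a differential form `μ`
whose arguments are indexed by `ι`. -/
noncomputable def formInChart {ι : Type*} (μ : ∀ x : N, TangentSpace J x [⋀^ι]→ₗ[ℝ] ℝ)
    (x₀ : N) (y : F) : F [⋀^ι]→ₗ[ℝ] ℝ :=
  (μ ((extChartAt J x₀).symm y)).compLinearMap
    (mfderiv 𝓘(ℝ, F) J (extChartAt J x₀).symm y :
      F →L[ℝ] TangentSpace J ((extChartAt J x₀).symm y)).toLinearMap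

/-- The coordinate expression, in the preferred chart around `x₀`, of a vector field `X`. -/
noncomputable def vectorFieldInChart (X : ∀ x : N, TangentSpace J x) (x₀ : N) (y : F) : F :=
  mfderiv J 𝓘(ℝ, F) (extChartAt J x₀) ((extChartAt J x₀).symm y) (X ((extChartAt J x₀).symm y))

/-- Smoothness of a differential form: its coefficients in every preferred chart are smooth. -/
def IsSmoothForm {ι : Type*} (μ : ∀ x : N, TangentSpace J x [⋀^ι]→ₗ[ℝ] ℝ) : Prop :=
  ∀ (x₀ : N) (v : ι → F), ContDiffOn ℝ ∞ (fun y => formInChart μ x₀ y v) (extChartAt J x₀).target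

/-- A volume form: a smooth, nowhere vanishing form. (It is only used when the number of
arguments `ι` is the dimension of the manifold.) -/
def IsVolumeForm {ι : Type*} (μ : ∀ x : N, TangentSpace J x [⋀^ι]→ₗ[ℝ] ℝ) : Prop :=
  IsSmoothForm μ ∧ ∀ x, μ x ≠ 0

/-- The Lie derivative `(L_X μ)_x (V)`: in coordinates,
`(L_X μ)(v) = D(μ(v))[X] + ∑ i, μ(v₁, …, DX[vᵢ], …)` for constant `v`. -/
noncomputable def lieDerivForm {ι : Type*} [Fintype ι] [DecidableEq ι]
    (X : ∀ x : N, TangentSpace J x) (μ : ∀ x : N, TangentSpace J x [⋀^ι]→ₗ[ℝ] ℝ)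
    (x : N) (V : ι → TangentSpace J x) : ℝ :=
  let v : ι → F := fun i => chartDifferential J x (V i)
  fderiv ℝ (fun y => formInChart μ x y v) (extChartAt J x x)
      (vectorFieldInChart X x (extChartAt J x x))
    + ∑ i, formInChart μ x (extChartAt J x x)
        (Function.update v i (fderiv ℝ (vectorFieldInChart X x) (extChartAt J x x) (v i)))

/-- The vector field `X` preserves the form `μ`, that is `L_X μ = 0`. -/
def PreservesForm {ι : Type*} [Fintype ι] [DecidableEq ι]
    (X : ∀ x : N, TangentSpace J x) (μ : ∀ x : N, TangentSpace J x [⋀^ι]→ₗ[ℝ] ℝ) : Prop :=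
  ∀ x V, lieDerivForm X μ x V = 0

end Forms

section WedgePower

variable {V : Type*} [AddCommGroup V] [Module ℝ V]

/-- The multilinear map `v ↦ ∏ i, η (v (i, 0)) (v (i, 1))` in `2 r` variables. -/
noncomputable def tensorPower (η : LinearMap.BilinForm ℝ V) (r : ℕ) :
    MultilinearMap ℝ (fun _ : Fin r × Fin 2 => V) ℝ :=
  MultilinearMap.mk' (fun v => ∏ i, η (v (i, 0)) (v (i, 1)))
    (by
      rintro v ⟨i, j⟩ x y
      have h : ∀ z : V, ∏ k ∈ Finset.univ.erase i,
          η (Function.update v (i, j) z (k, 0)) (Function.update v (i, j) z (k, 1))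
          = ∏ k ∈ Finset.univ.erase i, η (v (k, 0)) (v (k, 1)) := by
        intro z
        refine Finset.prod_congr rfl fun k hk => ?_
        have hk' : k ≠ i := (Finset.mem_erase.mp hk).1
        simp [Prod.ext_iff, hk']
      simp only [← Finset.mul_prod_erase _ _ (Finset.mem_univ i), h]
      fin_cases j <;> simp [Prod.ext_iff, add_mul])
    (by
      rintro v ⟨i, j⟩ c x
      have h : ∀ z : V, ∏ k ∈ Finset.univ.erase i,
          η (Function.update v (i, j) z (k, 0)) (Function.update v (i, j) z (k, 1))
          = ∏ k ∈ Finset.univ.erase i, η (v (k, 0)) (v (k, 1)) := by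
        intro z
        refine Finset.prod_congr rfl fun k hk => ?_
        have hk' : k ≠ i := (Finset.mem_erase.mp hk).1
        simp [Prod.ext_iff, hk']
      simp only [← Finset.mul_prod_erase _ _ (Finset.mem_univ i), h]
      fin_cases j <;> simp [Prod.ext_iff, mul_assoc])

/-- The exterior power `η^r = η ∧ ⋯ ∧ η` of a 2-form `η`:
`η^r (v) = 2^{-r} ∑_σ sign(σ) ∏ i, η (v (σ (i, 0))) (v (σ (i, 1)))`. Its `2 r` arguments are
indexed by `Fin r × Fin 2`, i.e. taken in the order `(0,0), (0,1), (1,0), (1,1), …`. -/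
noncomputable def wedgePower (η : LinearMap.BilinForm ℝ V) (r : ℕ) :
    V [⋀^Fin r × Fin 2]→ₗ[ℝ] ℝ :=
  ((2 : ℝ) ^ r)⁻¹ • MultilinearMap.alternatization (tensorPower η r)

end WedgePower

/-! ### The cotangent bundle -/

/-- Euclidean space of dimension `n`, the model space of `n`-dimensional manifolds. -/
abbrev Eu (n : ℕ) : Type := EuclideanSpace ℝ (Fin n)

/-- The cotangent bundle `T*M` of an `n`-dimensional manifold. -/
abbrev CotangentBundle (n : ℕ) (M : Type*) [TopologicalSpace M] [ChartedSpace (Eu n) M]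
    [IsManifold (𝓡 n) ∞ M] : Type _ :=
  TotalSpace (Eu n →L[ℝ] ℝ) (fun x : M => TangentSpace (𝓡 n) x →L[ℝ] Trivial M ℝ x)

/-- The model with corners of the cotangent bundle of an `n`-dimensional manifold. -/
noncomputable abbrev cotModel (n : ℕ) :
    ModelWithCorners ℝ (Eu n × (Eu n →L[ℝ] ℝ)) (ModelProd (Eu n) (Eu n →L[ℝ] ℝ)) :=
  (𝓡 n).prod 𝓘(ℝ, Eu n →L[ℝ] ℝ)

instance instFiniteDimensionalTangentEu {n : ℕ} {M : Type*} [TopologicalSpace M]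
    [ChartedSpace (Eu n) M] (x : M) : FiniteDimensional ℝ (TangentSpace (𝓡 n) x) :=
  inferInstanceAs (FiniteDimensional ℝ (Eu n))

instance instT2SpaceTangentEu {n : ℕ} {M : Type*} [TopologicalSpace M]
    [ChartedSpace (Eu n) M] (x : M) : T2Space (TangentSpace (𝓡 n) x) :=
  inferInstanceAs (T2Space (Eu n))

theorem finrank_tangentEu {n : ℕ} {M : Type*} [TopologicalSpace M]
    [ChartedSpace (Eu n) M] (x : M) : Module.finrank ℝ (TangentSpace (𝓡 n) x) = n :=
  (finrank_euclideanSpace_fin : Module.finrank ℝ (Eu n) = n)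

section Cotangent

variable {n : ℕ} {M : Type*} [TopologicalSpace M] [ChartedSpace (Eu n) M] [IsManifold (𝓡 n) ∞ M]

/-- The point `(x, a)` of the cotangent bundle. -/
noncomputable def covector (x : M) (a : TangentSpace (𝓡 n) x →L[ℝ] ℝ) : CotangentBundle n M := ⟨x, a⟩

/-- The Liouville 1-form `λ_α (V) = α (Tτ V)`. -/
noncomputable def liouvilleOneForm (α : CotangentBundle n M) :
    TangentSpace (cotModel n) α →L[ℝ] ℝ :=
  (α.2 : TangentSpace (𝓡 n) α.1 →L[ℝ] ℝ).comp
    (mfderiv (cotModel n) (𝓡 n) (fun β : CotangentBundle n M => β.1) α)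

/-- The canonical symplectic form `Ω_can = -dλ`, locally `∑ dqⁱ ∧ dpᵢ`. -/
noncomputable def canonicalForm (α : CotangentBundle n M) :
    LinearMap.BilinForm ℝ (TangentSpace (cotModel n) α) :=
  -extDerivOneForm (cotModel n) (liouvilleOneForm (n := n) (M := M)) α

/-- The differential of a real function on the cotangent bundle. -/
noncomputable def cotDiff (f : CotangentBundle n M → ℝ) (α : CotangentBundle n M) :
    TangentSpace (cotModel n) α →L[ℝ] ℝ :=
  mfderiv (cotModel n) 𝓘(ℝ, ℝ) f α

/-- The Hamiltonian vector field of `f`: the vector `V` with `Ω_can (V, ·) = df`, which is unique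
because `Ω_can` is non-degenerate. -/
noncomputable def hamiltonianVector (f : CotangentBundle n M → ℝ) (α : CotangentBundle n M) :
    TangentSpace (cotModel n) α :=
  Classical.epsilon fun V => ∀ W, canonicalForm α V W = cotDiff f α W

/-- The canonical Poisson bracket `{f, g} = X_g [f]` on the cotangent bundle, for which
`{qⁱ, pⱼ} = δⁱⱼ`. -/
noncomputable def poissonBracket (f g : CotangentBundle n M → ℝ) (α : CotangentBundle n M) : ℝ :=
  cotDiff f α (hamiltonianVector g α)

/-- The Liouville volume form `ν = Ω_can ^ n` on the cotangent bundle. -/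
noncomputable def liouvilleVolume (α : CotangentBundle n M) :
    TangentSpace (cotModel n) α [⋀^Fin n × Fin 2]→ₗ[ℝ] ℝ :=
  wedgePower (canonicalForm α) n

/-- The volume form `exp (ρ) ν`, for a function `ρ` on the cotangent bundle. -/
noncomputable def expVolume (ρ : CotangentBundle n M → ℝ) (α : CotangentBundle n M) :
    TangentSpace (cotModel n) α [⋀^Fin n × Fin 2]→ₗ[ℝ] ℝ :=
  Real.exp (ρ α) • liouvilleVolume α

/-- The basic volume form `exp (σ ∘ τ) ν`, for a function `σ` on the base. -/
noncomputable def basicVolume (σ : M → ℝ) (α : CotangentBundle n M) :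
    TangentSpace (cotModel n) α [⋀^Fin n × Fin 2]→ₗ[ℝ] ℝ :=
  expVolume (fun β => σ β.1) α

end Cotangent

/-! ### Chaplygin systems -/

/-- A nonholonomic `G`-Chaplygin system with `r` degrees of freedom on the `n`-dimensional manifold
`Q`, with a `k`-dimensional symmetry group `G` and shape space `S = Q/G`. The quotient manifold is
given through its projection `pr`, a surjective submersion whose fibres are the `G`-orbits; this
determines `S` up to a unique diffeomorphism. -/
structure ChaplyginSystem (n r k : ℕ) (Q S G : Type*)
    [TopologicalSpace Q] [ChartedSpace (Eu n) Q] [IsManifold (𝓡 n) ∞ Q]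
    [TopologicalSpace S] [ChartedSpace (Eu r) S] [IsManifold (𝓡 r) ∞ S]
    [TopologicalSpace G] [ChartedSpace (Eu k) G] [Group G] [LieGroup (𝓡 k) ∞ G]
    [MulAction G Q] where
  /-- The kinetic energy metric. -/
  metric : ContMDiffRiemannianMetric (𝓡 n) ∞ (Eu n) (fun q : Q => TangentSpace (𝓡 n) q)
  /-- The potential energy. -/
  U : Q → ℝ
  U_smooth : ContMDiff (𝓡 n) 𝓘(ℝ, ℝ) ∞ U
  /-- The constraint distribution, a smooth subbundle of `TQ` of rank `r`. -/
  D : ∀ q : Q, Submodule ℝ (TangentSpace (𝓡 n) q)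
  D_rank : ∀ q, Module.finrank ℝ (D q) = r
  D_smooth : ∀ q₀ : Q, ∃ O : Set Q, IsOpen O ∧ q₀ ∈ O ∧
    ∃ Z : Fin r → ∀ q : Q, TangentSpace (𝓡 n) q,
      (∀ i, ContMDiffOn (𝓡 n) (𝓡 n).tangent ∞
        (fun q => (⟨q, Z i q⟩ : TangentBundle (𝓡 n) Q)) O) ∧
      ∀ q ∈ O, D q = Submodule.span ℝ (range fun i => Z i q)
  /-- `G` acts smoothly, -/
  action_smooth : ContMDiffSMul (𝓡 k) (𝓡 n) ∞ G Q
  /-- freely, -/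
  action_free : ∀ (g : G) (q : Q), g • q = q → g = 1
  /-- properly, -/
  action_proper : ProperSMul G Q
  /-- by isometries, -/
  metric_invariant : ∀ (g : G) (q : Q) (v w : TangentSpace (𝓡 n) q),
    metric.inner (g • q) (mfderiv (𝓡 n) (𝓡 n) (fun x : Q => g • x) q v)
      (mfderiv (𝓡 n) (𝓡 n) (fun x : Q => g • x) q w) = metric.inner q v w
  /-- preserving the potential -/
  U_invariant : ∀ (g : G) (q : Q), U (g • q) = U q
  /-- and the constraints. -/
  D_invariant : ∀ (g : G) (q : Q),
    (D q).map (mfderiv (𝓡 n) (𝓡 n) (fun x : Q => g • x) q).toLinearMap = D (g • q)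
  /-- The splitting `T_q Q = D_q ⊕ 𝔤 · q`. (Here `𝔤 · q` lies in the tangent space at `1 • q = q`.) -/
  splitting : ∀ q : Q, IsCompl (D q)
    (show Submodule ℝ (TangentSpace (𝓡 n) q) from
      LinearMap.range (mfderiv (𝓡 k) (𝓡 n) (fun g : G => g • q) 1).toLinearMap)
  /-- The projection onto the shape space. -/
  pr : Q → S
  pr_smooth : ContMDiff (𝓡 n) (𝓡 r) ∞ pr
  pr_surjective : Function.Surjective pr
  pr_submersion : ∀ q, Function.Surjective (mfderiv (𝓡 n) (𝓡 r) pr q)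
  pr_fibre : ∀ q q' : Q, pr q = pr q' ↔ ∃ g : G, g • q = q'

namespace ChaplyginSystem

variable {n r k : ℕ} {Q S G : Type*}
  [TopologicalSpace Q] [ChartedSpace (Eu n) Q] [IsManifold (𝓡 n) ∞ Q]
  [TopologicalSpace S] [ChartedSpace (Eu r) S] [IsManifold (𝓡 r) ∞ S]
  [TopologicalSpace G] [ChartedSpace (Eu k) G] [Group G] [LieGroup (𝓡 k) ∞ G]
  [MulAction G Q] (C : ChaplyginSystem n r k Q S G)

/-- The metric at `q` as a bilinear form. -/
noncomputable def bilin (q : Q) : LinearMap.BilinForm ℝ (TangentSpace (𝓡 n) q) :=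
  LinearMap.mk₂ ℝ (fun v w => C.metric.inner q v w)
    (fun _ _ _ => by simp) (fun _ _ _ => by simp) (fun _ _ _ => by simp) (fun _ _ _ => by simp)

theorem bilin_pos (q : Q) (v : TangentSpace (𝓡 n) q) (hv : v ≠ 0) : 0 < C.bilin q v v :=
  C.metric.pos q v hv

theorem bilin_isSymm (q : Q) : (C.bilin q).IsSymm :=
  ⟨fun v w => C.metric.symm q v w⟩

theorem bilin_nondegenerate (q : Q) : (C.bilin q).Nondegenerate := by
  refine (LinearMap.IsRefl.nondegenerate_iff_separatingLeft
    (C.bilin_isSymm q).isRefl).mpr fun v hv => ?_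
  by_contra h
  exact (C.bilin_pos q v h).ne' (hv v)

/-- The orthogonal complement of `D_q`. -/
noncomputable def Dperp (q : Q) : Submodule ℝ (TangentSpace (𝓡 n) q) :=
  (C.bilin q).orthogonal (C.D q)

theorem isCompl_Dperp (q : Q) : IsCompl (C.D q) (C.Dperp q) := by
  refine ((C.bilin q).isCompl_orthogonal_iff_disjoint (C.bilin_isSymm q).isRefl).mpr ?_
  rw [Submodule.disjoint_def]
  intro v hv hv'
  by_contra h
  exact (C.bilin_pos q v h).ne' (hv' v hv)

/-- The orthogonal projector `P : TQ → D`. -/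
noncomputable def proj (q : Q) : TangentSpace (𝓡 n) q →ₗ[ℝ] C.D q :=
  (C.D q).projectionOnto (C.Dperp q) (C.isCompl_Dperp q)

/-- The restriction of `T_q π` to `D_q`. -/
noncomputable def tangentD (q : Q) : C.D q →ₗ[ℝ] TangentSpace (𝓡 r) (C.pr q) :=
  (mfderiv (𝓡 n) (𝓡 r) C.pr q).toLinearMap ∘ₗ (C.D q).subtype

theorem tangentD_bijective (q : Q) : Function.Bijective (C.tangentD q) := by
  have hvert : ∀ ξ : TangentSpace (𝓡 k) (1 : G),
      mfderiv (𝓡 n) (𝓡 r) C.pr ((1 : G) • q)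
        (mfderiv (𝓡 k) (𝓡 n) (fun g : G => g • q) 1 ξ) = 0 := by
    intro ξ
    have hconst : (C.pr ∘ fun g : G => g • q) = fun _ => C.pr q := by
      funext g
      exact ((C.pr_fibre q (g • q)).mpr ⟨g, rfl⟩).symm
    have hpr : MDifferentiableAt (𝓡 n) (𝓡 r) C.pr ((1 : G) • q) :=
      C.pr_smooth.mdifferentiable (by simp) _
    have hact : MDifferentiableAt (𝓡 k) (𝓡 n) (fun g : G => g • q) 1 := by
      have := C.action_smooth
      exact ((contMDiff_smul (I := 𝓡 k) (I' := 𝓡 n) (n := ∞)).comp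
        (contMDiff_id.prodMk (contMDiff_const (c := q)))).mdifferentiable (by simp) 1
    have h := mfderiv_comp (1 : G) hpr hact
    rw [hconst, mfderiv_const] at h
    exact (DFunLike.congr_fun h ξ).symm
  have hsurj : Function.Surjective (C.tangentD q) := by
    intro u
    obtain ⟨v, rfl⟩ := C.pr_submersion q u
    obtain ⟨d, hd, w, ⟨ξ, rfl⟩, rfl⟩ := Submodule.mem_sup.mp
      ((C.splitting q).sup_eq_top ▸ Submodule.mem_top : v ∈ C.D q ⊔ _)
    refine ⟨⟨d, hd⟩, ?_⟩
    have h0 := hvert ξ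
    rw [one_smul] at h0
    rw [map_add]
    refine (add_zero _).symm.trans (congrArg _ h0.symm)
  refine ⟨(LinearMap.injective_iff_surjective_of_finrank_eq_finrank ?_).mpr hsurj, hsurj⟩
  rw [C.D_rank q, finrank_tangentEu]

/-- The horizontal lift `hor_q : T_{π(q)} S → D_q`, the inverse of the restriction of `T_q π`. -/
noncomputable def horLift (q : Q) : TangentSpace (𝓡 r) (C.pr q) ≃ₗ[ℝ] C.D q :=
  (LinearEquiv.ofBijective (C.tangentD q) (C.tangentD_bijective q)).symm

/-- The horizontal lift of a vector field on `S`. -/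
noncomputable def hor (Y : ∀ s : S, TangentSpace (𝓡 r) s) (q : Q) : TangentSpace (𝓡 n) q :=
  C.horLift q (Y (C.pr q))

/-- A point of `Q` over `s`. -/
noncomputable def point (s : S) : Q := Function.surjInv C.pr_surjective s

theorem pr_point (s : S) : C.pr (C.point s) = s := Function.surjInv_eq C.pr_surjective s

/-- `T_q π (P [hor Y, hor Z](q)) - [Y, Z](π q)`. -/
noncomputable def gyroAt (Y Z : ∀ s : S, TangentSpace (𝓡 r) s) (q : Q) :
    TangentSpace (𝓡 r) (C.pr q) :=
  C.tangentD q (C.proj q (VectorField.mlieBracket (𝓡 n) (C.hor Y) (C.hor Z) q))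
    - VectorField.mlieBracket (𝓡 r) Y Z (C.pr q)

/-- The gyroscopic tensor `𝒯(Y, Z)(s) = T_q π (P [hor Y, hor Z](q)) - [Y, Z](s)`, where `q` is any
point over `s`. -/
noncomputable def gyro (Y Z : ∀ s : S, TangentSpace (𝓡 r) s) (s : S) : TangentSpace (𝓡 r) s :=
  C.pr_point s ▸ C.gyroAt Y Z (C.point s)

/-- The value `∑ⱼ ⟨Xʲ, 𝒯(Xⱼ, Y)⟩ (s)` for a local frame `X` with dual frame `Xʲ`. -/
noncomputable def frameTrace {X : Fin r → ∀ s : S, TangentSpace (𝓡 r) s} {O : Set S}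
    (hX : IsLocalFrameOn (𝓡 r) (Eu r) ∞ X O) (Y : ∀ s : S, TangentSpace (𝓡 r) s) (s : S) : ℝ :=
  ∑ j, hX.coeff j s (C.gyro (X j) Y s)

/-- The 1-form `Θ(Y) = ∑ⱼ ⟨Xʲ, 𝒯(Xⱼ, Y)⟩`; at `s` the local frame `X` is the coordinate frame
`∂/∂sʲ` of the preferred chart around `s`. -/
noncomputable def theta (Y : ∀ s : S, TangentSpace (𝓡 r) s) (s : S) : ℝ :=
  C.frameTrace
    ((trivializationAt (Eu r) (TangentSpace (𝓡 r)) s).isLocalFrameOn_localFrame_baseSet (𝓡 r) ∞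
      (EuclideanSpace.basisFun (Fin r) ℝ).toBasis) Y s

/-- `Θ = dσ`, as an equality of 1-forms evaluated on all smooth vector fields `Y` on `S`. -/
def ThetaEqDiff (σ : S → ℝ) : Prop :=
  ∀ Y : ∀ s : S, TangentSpace (𝓡 r) s,
    ContMDiff (𝓡 r) (𝓡 r).tangent ∞ (fun s => (⟨s, Y s⟩ : TangentBundle (𝓡 r) S)) →
    ∀ s : S, C.theta Y s = mfderiv (𝓡 r) 𝓘(ℝ, ℝ) σ s (Y s)

/-! The nonholonomic bracket and the dynamics -/

/-- The dual bundle `D*`, as a set. -/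
def DualBundle : Type _ := Σ q : Q, Module.Dual ℝ (C.D q)

/-- The projection `i_D* : T*Q → D*`, restriction of covectors to `D`. -/
noncomputable def restrictD (α : CotangentBundle n Q) : C.DualBundle :=
  ⟨α.1, (α.2 : TangentSpace (𝓡 n) α.1 →L[ℝ] ℝ).toLinearMap ∘ₗ (C.D α.1).subtype⟩

/-- The inclusion `P* : D* → T*Q`. -/
noncomputable def projDual (b : C.DualBundle) : CotangentBundle n Q :=
  covector b.1 (b.2 ∘ₗ C.proj b.1).toContinuousLinearMap

/-- The nonholonomic bracket `{φ, ψ}_{D*} = {φ ∘ i_D*, ψ ∘ i_D*}_{T*Q} ∘ P*`. -/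
noncomputable def nhBracket (φ ψ : C.DualBundle → ℝ) (b : C.DualBundle) : ℝ :=
  poissonBracket (fun α => φ (C.restrictD α)) (fun α => ψ (C.restrictD α)) (C.projDual b)

/-- The vector metrically dual to a covector. -/
noncomputable def sharp (q : Q) (a : TangentSpace (𝓡 n) q →L[ℝ] ℝ) : TangentSpace (𝓡 n) q :=
  ((C.bilin q).toDual (C.bilin_nondegenerate q)).symm a.toLinearMap

/-- The Hamiltonian `h(α) = ‖α‖² / 2 + U(q)` on `T*Q`, where `‖α‖² = ⟨α, α^♯⟩`. -/
noncomputable def hamiltonian (α : CotangentBundle n Q) : ℝ :=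
  1 / 2 * (α.2 : TangentSpace (𝓡 n) α.1 →L[ℝ] ℝ) (C.sharp α.1 α.2) + C.U α.1

/-- The constrained Hamiltonian `h_c = h ∘ P*` on `D*`. -/
noncomputable def constrainedHamiltonian (b : C.DualBundle) : ℝ :=
  C.hamiltonian (C.projDual b)

/-- The orbit projection `D* → D*/G ≅ T*S`, which sends `b ∈ D*_q` to the covector
`u ↦ b (hor_q u)` at `π(q)`. -/
noncomputable def redProj (b : C.DualBundle) : CotangentBundle r S :=
  covector (C.pr b.1) (b.2 ∘ₗ (C.horLift b.1).toLinearMap).toContinuousLinearMap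

/-- `X` is the reduced vector field on `T*S ≅ D*/G`: it is smooth and related by the orbit
projection to the nonholonomic vector field `X_nh [φ] = {φ, h_c}_{D*}` on `D*`. -/
def IsReducedDynamics (X : ∀ β : CotangentBundle r S, TangentSpace (cotModel r) β) : Prop :=
  ContMDiff (cotModel r) (cotModel r).tangent ∞
    (fun β => (⟨β, X β⟩ : TangentBundle (cotModel r) (CotangentBundle r S))) ∧
  ∀ φ : CotangentBundle r S → ℝ, ContMDiff (cotModel r) 𝓘(ℝ, ℝ) ∞ φ →
    ∀ b : C.DualBundle, cotDiff φ (C.redProj b) (X (C.redProj b))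
      = C.nhBracket (fun b' => φ (C.redProj b')) C.constrainedHamiltonian b

end ChaplyginSystem

/-! ### Charts of manifolds without boundary -/

section Charts

variable {F : Type*} [NormedAddCommGroup F] [NormedSpace ℝ F]
  {H : Type*} [TopologicalSpace H] {J : ModelWithCorners ℝ F H} [J.Boundaryless]
  {N : Type*} [TopologicalSpace N] [ChartedSpace H N]

/-! Everything is computed in cotangent charts (y, ξ). There the Liouville 1-form is ξ dy
(`liouvilleOneForm_inChart`), so ν is a constant non-zero form, and a field X preserves exp(ρ) ν
exactly when dρ(X) + tr DX = 0 (`preservesForm_expVolume_iff`).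

Let M be the inverse of the reduced metric, U the reduced potential and B(w, u) the gyroscopic
tensor; G-invariance makes all three functions of y alone. In coordinates the nonholonomic dynamics
projects to y' = M ξ, ξ' = -(∂h/∂y + ξ ∘ B(·, M ξ)), with h = ξ(M ξ)/2 + U
(`nhBracket_eq_reducedField`). The reason is that a function on T*S, pulled back to T*Q, depends on
(x, ζ) only through (π(x), ζ ∘ A(x)), where A is the horizontal lift. In the canonical bracket the
derivatives of A combine into the Lie bracket of horizontal lifts, and a covector in the image of P*
sees only the D-component of that bracket. Since D* → T*S is onto and smooth functions separate
tangent vectors, the formula determines the reduced field in every chart, which gives existence,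
smoothness and uniqueness.

The Hamiltonian part of this field has no divergence. Differentiating the gyroscopic force along the
fibre gives two terms. One of them is the composition of the antisymmetric form ξ ∘ B with the
symmetric M and has trace zero; the other contributes -tr B(·, M ξ) (`trace_fderiv_gyroField`).
Because Θ(v) = tr B(·, v) (`theta_eq_trace`), the form exp(ρ) ν is invariant if and only if dρ(X) =
Θ(M ξ) at every (y, ξ).

For ρ = σ ∘ τ this reads dσ(M ξ) = Θ(M ξ), and M is onto; this is (i). For (ii), when U = 0 the
field at (y, tη) is t (v, -t f) with v = M η and f independent of t. Dividing the criterion by t and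
letting t → 0 gives dρ(v, 0) = Θ(v) on the zero section, which is the criterion for the restriction
of ρ to the zero section (`preservesForm_zeroSection`). An arbitrary volume form is f ν with f
nowhere zero, and log|f| serves as ρ. -/

theorem extChartAt_target_mem_nhds_of_mem {x₀ : N} {y : F} (hy : y ∈ (extChartAt J x₀).target) :
    (extChartAt J x₀).target ∈ 𝓝 y :=
  (isOpen_extChartAt_target x₀).mem_nhds hy

variable [IsManifold J 1 N]

theorem mdifferentiableAt_extChartAt_symm {x₀ : N} {y : F} (hy : y ∈ (extChartAt J x₀).target) :
    MDifferentiableAt 𝓘(ℝ, F) J (extChartAt J x₀).symm y := by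
  have h := mdifferentiableWithinAt_extChartAt_symm hy
  rwa [J.range_eq_univ, mdifferentiableWithinAt_univ] at h

omit [J.Boundaryless] in
theorem mdifferentiableAt_extChartAt_of_mem {x₀ x : N} (hx : x ∈ (extChartAt J x₀).source) :
    MDifferentiableAt J 𝓘(ℝ, F) (extChartAt J x₀) x :=
  mdifferentiableAt_extChartAt (by rwa [extChartAt_source] at hx)

theorem mfderiv_extChartAt_mfderiv_symm {x₀ : N} {y : F} (hy : y ∈ (extChartAt J x₀).target)
    (v : F) :
    (mfderiv J 𝓘(ℝ, F) (extChartAt J x₀) ((extChartAt J x₀).symm y)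
      ((mfderiv 𝓘(ℝ, F) J (extChartAt J x₀).symm y :
        F →L[ℝ] TangentSpace J ((extChartAt J x₀).symm y)) v) : F) = v := by
  have h := mfderiv_extChartAt_comp_mfderivWithin_extChartAt_symm hy
  rw [J.range_eq_univ, mfderivWithin_univ] at h
  exact DFunLike.congr_fun h v

theorem mfderiv_symm_mfderiv_extChartAt {x₀ x : N} (hx : x ∈ (extChartAt J x₀).source)
    (v : TangentSpace J x) :
    (mfderiv 𝓘(ℝ, F) J (extChartAt J x₀).symm (extChartAt J x₀ x)
      (mfderiv J 𝓘(ℝ, F) (extChartAt J x₀) x v) : F) = (v : F) := by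
  have h := mfderivWithin_extChartAt_symm_comp_mfderiv_extChartAt' (I := J) hx
  rw [J.range_eq_univ, mfderivWithin_univ] at h
  exact DFunLike.congr_fun h v

theorem mfderiv_extChartAt_mfderiv_symm' {x₀ x : N} (hx : x ∈ (extChartAt J x₀).source)
    (v : F) :
    (mfderiv J 𝓘(ℝ, F) (extChartAt J x₀) x
      ((mfderiv 𝓘(ℝ, F) J (extChartAt J x₀).symm (extChartAt J x₀ x) : F →L[ℝ] F) v) : F) = v := by
  have h := mfderiv_extChartAt_comp_mfderivWithin_extChartAt_symm' (I := J) hx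
  rw [J.range_eq_univ, mfderivWithin_univ] at h
  exact DFunLike.congr_fun h v

/-- The differential of a function in a chart. -/
theorem mfderiv_eq_fderiv_extChartAt {E' : Type*} [NormedAddCommGroup E'] [NormedSpace ℝ E']
    {f : N → E'} {x₀ x : N} (hx : x ∈ (extChartAt J x₀).source)
    (hf : MDifferentiableAt J 𝓘(ℝ, E') f x) (v : TangentSpace J x) :
    (mfderiv J 𝓘(ℝ, E') f x v : E') =
      fderiv ℝ (fun y => f ((extChartAt J x₀).symm y)) (extChartAt J x₀ x)
        (mfderiv J 𝓘(ℝ, F) (extChartAt J x₀) x v) := by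
  have hy := (extChartAt J x₀).map_source hx
  have hs := mdifferentiableAt_extChartAt_symm (J := J) hy
  have hxx : (extChartAt J x₀).symm (extChartAt J x₀ x) = x := (extChartAt J x₀).left_inv hx
  have hf' : MDifferentiableAt J 𝓘(ℝ, E') f ((extChartAt J x₀).symm (extChartAt J x₀ x)) := by
    rwa [hxx]
  have h := mfderiv_comp (extChartAt J x₀ x) hf' hs
  have h2 := DFunLike.congr_fun h (mfderiv J 𝓘(ℝ, F) (extChartAt J x₀) x v)
  rw [mfderiv_eq_fderiv] at h2
  refine Eq.trans ?_ h2.symm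
  have h3 := mfderiv_symm_mfderiv_extChartAt hx v
  change _ = mfderiv J 𝓘(ℝ, E') f ((extChartAt J x₀).symm (extChartAt J x₀ x))
    (mfderiv 𝓘(ℝ, F) J (extChartAt J x₀).symm (extChartAt J x₀ x)
      (mfderiv J 𝓘(ℝ, F) (extChartAt J x₀) x v))
  have h4 : ∀ (x' : N) (_ : x' = x) (w : F), w = v →
      (mfderiv J 𝓘(ℝ, E') f x v : E') = mfderiv J 𝓘(ℝ, E') f x' w := by
    rintro _ rfl _ rfl; rfl
  exact h4 _ hxx _ h3

theorem differentiableAt_comp_extChartAt_symm {E' : Type*} [NormedAddCommGroup E']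
    [NormedSpace ℝ E'] {f : N → E'} {x₀ : N} {y : F} (hy : y ∈ (extChartAt J x₀).target)
    (hf : MDifferentiableAt J 𝓘(ℝ, E') f ((extChartAt J x₀).symm y)) :
    DifferentiableAt ℝ (fun y => f ((extChartAt J x₀).symm y)) y :=
  (hf.comp y (mdifferentiableAt_extChartAt_symm hy)).differentiableAt

omit [IsManifold J 1 N] in
/-- The transition map between two charts. -/
theorem contDiffAt_chart_transition [IsManifold J ∞ N] {x₀ x₁ x : N}
    (h₀ : x ∈ (extChartAt J x₀).source) (h₁ : x ∈ (extChartAt J x₁).source) :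
    ContDiffAt ℝ ∞ (fun y => extChartAt J x₁ ((extChartAt J x₀).symm y)) (extChartAt J x₀ x) := by
  have hy := (extChartAt J x₀).map_source h₀
  have hs : ContMDiffAt 𝓘(ℝ, F) J ∞ (extChartAt J x₀).symm (extChartAt J x₀ x) :=
    (contMDiffOn_extChartAt_symm x₀).contMDiffAt (extChartAt_target_mem_nhds_of_mem hy)
  have hxx : (extChartAt J x₀).symm (extChartAt J x₀ x) = x := (extChartAt J x₀).left_inv h₀
  have ht : ContMDiffAt J 𝓘(ℝ, F) ∞ (extChartAt J x₁)
      ((extChartAt J x₀).symm (extChartAt J x₀ x)) := by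
    rw [hxx]
    exact contMDiffAt_extChartAt' (by rwa [extChartAt_source] at h₁)
  exact (ht.comp _ hs).contDiffAt

theorem fderiv_chart_transition {x₀ x₁ : N} {y : F}
    (hy : y ∈ (extChartAt J x₀).target) (h₁ : (extChartAt J x₀).symm y ∈ (extChartAt J x₁).source)
    (v : F) :
    fderiv ℝ (fun y => extChartAt J x₁ ((extChartAt J x₀).symm y)) y v =
      (mfderiv J 𝓘(ℝ, F) (extChartAt J x₁) ((extChartAt J x₀).symm y)
        ((mfderiv 𝓘(ℝ, F) J (extChartAt J x₀).symm y : F →L[ℝ] F) v) : F) := by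
  have h := mfderiv_comp y (mdifferentiableAt_extChartAt_of_mem h₁)
    (mdifferentiableAt_extChartAt_symm (J := J) hy)
  rw [mfderiv_eq_fderiv] at h
  exact DFunLike.congr_fun h v

/-- The differential of the inverse of a chart, expressed with another chart. -/
theorem mfderiv_symm_eq_of_transition {x₀ x₁ : N} {y : F}
    (hy : y ∈ (extChartAt J x₀).target) (h₁ : (extChartAt J x₀).symm y ∈ (extChartAt J x₁).source)
    (v : F) :
    ((mfderiv 𝓘(ℝ, F) J (extChartAt J x₀).symm y : F →L[ℝ] F) v) =
      (mfderiv 𝓘(ℝ, F) J (extChartAt J x₁).symm (extChartAt J x₁ ((extChartAt J x₀).symm y)) :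
        F →L[ℝ] F) (fderiv ℝ (fun y => extChartAt J x₁ ((extChartAt J x₀).symm y)) y v) := by
  rw [fderiv_chart_transition hy h₁]
  exact (mfderiv_symm_mfderiv_extChartAt h₁ _).symm

/-- The differential at `x` of the chart around `x₀`. -/
noncomputable def dChart (J : ModelWithCorners ℝ F H) (x₀ x : N) : TangentSpace J x →L[ℝ] F :=
  mfderiv J 𝓘(ℝ, F) (extChartAt J x₀) x

/-- The inverse of the differential at `x` of the chart around `x₀`. -/
noncomputable def dChartInv (J : ModelWithCorners ℝ F H) (x₀ x : N) : F →L[ℝ] TangentSpace J x :=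
  (mfderiv 𝓘(ℝ, F) J (extChartAt J x₀).symm (extChartAt J x₀ x) : F →L[ℝ] F)

theorem dChart_dChartInv {x₀ x : N} (hx : x ∈ (extChartAt J x₀).source) (v : F) :
    dChart J x₀ x (dChartInv J x₀ x v) = v :=
  mfderiv_extChartAt_mfderiv_symm' hx v

theorem dChartInv_dChart {x₀ x : N} (hx : x ∈ (extChartAt J x₀).source) (v : TangentSpace J x) :
    dChartInv J x₀ x (dChart J x₀ x v) = v :=
  mfderiv_symm_mfderiv_extChartAt hx v

theorem dChart_injective {x₀ x : N} (hx : x ∈ (extChartAt J x₀).source) :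
    Function.Injective (dChart J x₀ x) :=
  fun v w h => by rw [← dChartInv_dChart hx v, h, dChartInv_dChart hx]

theorem dChart_surjective {x₀ x : N} (hx : x ∈ (extChartAt J x₀).source) :
    Function.Surjective (dChart J x₀ x) :=
  fun v => ⟨_, dChart_dChartInv hx v⟩

theorem mfderiv_eq_fderiv_dChart {E' : Type*} [NormedAddCommGroup E'] [NormedSpace ℝ E']
    {f : N → E'} {x₀ x : N} (hx : x ∈ (extChartAt J x₀).source)
    (hf : MDifferentiableAt J 𝓘(ℝ, E') f x) (v : TangentSpace J x) :
    (mfderiv J 𝓘(ℝ, E') f x v : E') =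
      fderiv ℝ (fun y => f ((extChartAt J x₀).symm y)) (extChartAt J x₀ x) (dChart J x₀ x v) :=
  mfderiv_eq_fderiv_extChartAt hx hf v

end Charts

/-! ### The charts of the cotangent bundle -/

section CotangentCharts

variable {n : ℕ} {M : Type*} [TopologicalSpace M] [ChartedSpace (Eu n) M] [IsManifold (𝓡 n) ∞ M]

theorem cot_extChartAt_source (α₀ : CotangentBundle n M) :
    (extChartAt (cotModel n) α₀).source = {β | β.1 ∈ (extChartAt (𝓡 n) α₀.1).source} := by
  rw [extChartAt_source, extChartAt_source]
  ext β
  rw [FiberBundle.chartedSpace_chartAt]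
  simp only [OpenPartialHomeomorph.trans_source, mem_inter_iff, mem_preimage, mem_ofPred_eq,
    OpenPartialHomeomorph.prod_source, OpenPartialHomeomorph.refl_source, mem_prod, mem_univ,
    and_true]
  constructor
  · rintro ⟨h, -⟩
    exact ((Trivialization.mem_source _).1 h).1
  · intro h
    exact ⟨(Trivialization.mem_source _).2 ⟨h, mem_univ _⟩, h⟩

theorem cot_extChartAt_target (α₀ : CotangentBundle n M) :
    (extChartAt (cotModel n) α₀).target = (extChartAt (𝓡 n) α₀.1).target ×ˢ univ := by
  rw [FiberBundle.extChartAt_target]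
  congr 1
  rw [hom_trivializationAt_baseSet]
  refine inter_eq_left.2 fun y hy => ⟨?_, mem_univ _⟩
  have h := (extChartAt (𝓡 n) α₀.1).map_target hy
  rwa [extChartAt_source] at h

/-- The trivialization of the bundle of covectors acts by precomposition with the inverse of the
tangent trivialization, and that inverse is the differential of the inverse chart. The fibre
coordinate therefore consists of the components of the covector in the coordinate frame. -/
theorem cot_extChartAt_apply (α₀ β : CotangentBundle n M)
    (h : β.1 ∈ (extChartAt (𝓡 n) α₀.1).source) :
    extChartAt (cotModel n) α₀ β = (extChartAt (𝓡 n) α₀.1 β.1,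
      (β.2 : Eu n →L[ℝ] ℝ).comp
        (mfderiv 𝓘(ℝ, Eu n) (𝓡 n) (extChartAt (𝓡 n) α₀.1).symm (extChartAt (𝓡 n) α₀.1 β.1))) := by
  rw [extChartAt_source] at h
  rw [FiberBundle.extChartAt]
  have h1 := TangentBundle.symmL_trivializationAt (I := 𝓡 n) h
  rw [(𝓡 n).range_eq_univ, mfderivWithin_univ] at h1
  rw [← h1]
  refine Prod.ext rfl ?_
  change ContinuousLinearMap.inCoordinates (Eu n) (TangentSpace (𝓡 n)) ℝ (Trivial M ℝ) α₀.1 β.1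
    α₀.1 β.1 β.2 = _
  ext v
  simp [ContinuousLinearMap.inCoordinates]
  rfl

/-- The inverse of the chart of the cotangent bundle. -/
theorem cot_extChartAt_symm_apply (α₀ : CotangentBundle n M) {y : Eu n} (ξ : Eu n →L[ℝ] ℝ)
    (hy : y ∈ (extChartAt (𝓡 n) α₀.1).target) :
    (extChartAt (cotModel n) α₀).symm (y, ξ) = covector ((extChartAt (𝓡 n) α₀.1).symm y)
      (ξ.comp (mfderiv (𝓡 n) 𝓘(ℝ, Eu n) (extChartAt (𝓡 n) α₀.1)
        ((extChartAt (𝓡 n) α₀.1).symm y))) := by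
  have hs := (extChartAt (𝓡 n) α₀.1).map_target hy
  have hyy := (extChartAt (𝓡 n) α₀.1).right_inv hy
  set β : CotangentBundle n M := covector ((extChartAt (𝓡 n) α₀.1).symm y)
      (ξ.comp (mfderiv (𝓡 n) 𝓘(ℝ, Eu n) (extChartAt (𝓡 n) α₀.1)
        ((extChartAt (𝓡 n) α₀.1).symm y))) with hβ
  have hβs : β ∈ (extChartAt (cotModel n) α₀).source := by
    rw [cot_extChartAt_source]
    exact hs
  rw [← (extChartAt (cotModel n) α₀).left_inv hβs, cot_extChartAt_apply _ _ hs]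
  congr 1
  refine Prod.ext hyy.symm ?_
  ext v
  exact congrArg ξ (mfderiv_extChartAt_mfderiv_symm' hs v).symm

theorem cot_proj_symm (α₀ : CotangentBundle n M) {z : Eu n × (Eu n →L[ℝ] ℝ)}
    (hz : z ∈ (extChartAt (cotModel n) α₀).target) :
    ((extChartAt (cotModel n) α₀).symm z).1 = (extChartAt (𝓡 n) α₀.1).symm z.1 := by
  rw [cot_extChartAt_target] at hz
  rw [cot_extChartAt_symm_apply α₀ z.2 hz.1]
  rfl

theorem cot_mdifferentiableAt_proj (β : CotangentBundle n M) :
    MDifferentiableAt (cotModel n) (𝓡 n) (fun β : CotangentBundle n M => β.1) β :=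
  ((contMDiff_proj (n := ∞) (IB := 𝓡 n)
    (fun x : M => TangentSpace (𝓡 n) x →L[ℝ] Trivial M ℝ x)).mdifferentiable (by simp)) β

theorem cot_apply_eq_chart (α₀ β : CotangentBundle n M)
    (h : β.1 ∈ (extChartAt (𝓡 n) α₀.1).source) (w : TangentSpace (𝓡 n) β.1) :
    (β.2 : TangentSpace (𝓡 n) β.1 →L[ℝ] ℝ) w = (extChartAt (cotModel n) α₀ β).2
      (mfderiv (𝓡 n) 𝓘(ℝ, Eu n) (extChartAt (𝓡 n) α₀.1) β.1 w) := by
  rw [cot_extChartAt_apply α₀ β h]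
  exact congrArg (β.2 : Eu n →L[ℝ] ℝ) (mfderiv_symm_mfderiv_extChartAt h w).symm

/-- The differential of the projection of the cotangent bundle, in a chart. -/
theorem mfderiv_cot_proj (α₀ : CotangentBundle n M) {z : Eu n × (Eu n →L[ℝ] ℝ)}
    (hz : z ∈ (extChartAt (cotModel n) α₀).target) (V : Eu n × (Eu n →L[ℝ] ℝ)) :
    (mfderiv (𝓡 n) 𝓘(ℝ, Eu n) (extChartAt (𝓡 n) α₀.1) ((extChartAt (cotModel n) α₀).symm z).1
      (mfderiv (cotModel n) (𝓡 n) (fun β : CotangentBundle n M => β.1)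
        ((extChartAt (cotModel n) α₀).symm z)
        ((mfderiv 𝓘(ℝ, Eu n × (Eu n →L[ℝ] ℝ)) (cotModel n) (extChartAt (cotModel n) α₀).symm z :
          (Eu n × (Eu n →L[ℝ] ℝ)) →L[ℝ] Eu n × (Eu n →L[ℝ] ℝ)) V)) : Eu n) = V.1 := by
  have hz' := hz
  rw [cot_extChartAt_target] at hz'
  have hs : ((extChartAt (cotModel n) α₀).symm z).1 ∈ (extChartAt (𝓡 n) α₀.1).source := by
    rw [cot_proj_symm α₀ hz]
    exact (extChartAt (𝓡 n) α₀.1).map_target hz'.1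
  have hsm := mdifferentiableAt_extChartAt_symm (J := cotModel n) hz
  have hp := cot_mdifferentiableAt_proj ((extChartAt (cotModel n) α₀).symm z)
  have h1 := mfderiv_comp z hp hsm
  have h2 := mfderiv_comp z (mdifferentiableAt_extChartAt_of_mem hs)
    (hp.comp z hsm)
  rw [h1] at h2
  rw [mfderiv_eq_fderiv] at h2
  -- Read in the two charts, the bundle projection is `Prod.fst`; the chain rule transfers its
  -- derivative to the manifold.
  have h3 : (extChartAt (𝓡 n) α₀.1 ∘ ((fun β : CotangentBundle n M => β.1) ∘
      (extChartAt (cotModel n) α₀).symm)) =ᶠ[𝓝 z] fun z => z.1 := by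
    filter_upwards [extChartAt_target_mem_nhds_of_mem hz] with w hw
    have hw' := hw
    rw [cot_extChartAt_target] at hw'
    simp only [Function.comp]
    rw [cot_proj_symm α₀ hw, (extChartAt (𝓡 n) α₀.1).right_inv hw'.1]
  rw [h3.fderiv_eq, fderiv_fst] at h2
  exact (DFunLike.congr_fun h2 V).symm

/-- The Liouville form in a chart is `(y, ξ) ↦ ξ dy`. -/
theorem liouvilleOneForm_inChart (α₀ : CotangentBundle n M) {z : Eu n × (Eu n →L[ℝ] ℝ)}
    (hz : z ∈ (extChartAt (cotModel n) α₀).target) :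
    oneFormInChart (cotModel n) (liouvilleOneForm (n := n) (M := M)) α₀ z
      = z.2.comp (ContinuousLinearMap.fst ℝ (Eu n) (Eu n →L[ℝ] ℝ)) := by
  refine ContinuousLinearMap.ext fun V => ?_
  have hs : ((extChartAt (cotModel n) α₀).symm z).1 ∈ (extChartAt (𝓡 n) α₀.1).source := by
    rw [cot_proj_symm α₀ hz]
    rw [cot_extChartAt_target] at hz
    exact (extChartAt (𝓡 n) α₀.1).map_target hz.1
  have h := cot_apply_eq_chart α₀ ((extChartAt (cotModel n) α₀).symm z) hs
    (mfderiv (cotModel n) (𝓡 n) (fun β : CotangentBundle n M => β.1)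
        ((extChartAt (cotModel n) α₀).symm z)
        ((mfderiv 𝓘(ℝ, Eu n × (Eu n →L[ℝ] ℝ)) (cotModel n) (extChartAt (cotModel n) α₀).symm z :
          (Eu n × (Eu n →L[ℝ] ℝ)) →L[ℝ] Eu n × (Eu n →L[ℝ] ℝ)) V))
  refine h.trans ?_
  rw [mfderiv_cot_proj α₀ hz, (extChartAt (cotModel n) α₀).right_inv hz]
  rfl

end CotangentCharts

/-! ### Exterior derivatives in charts -/

section ExtDeriv

variable {F : Type*} [NormedAddCommGroup F] [NormedSpace ℝ F]
  {H : Type*} [TopologicalSpace H] {J : ModelWithCorners ℝ F H} [J.Boundaryless]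
  {N : Type*} [TopologicalSpace N] [ChartedSpace H N] [IsManifold J ∞ N]

/-- The exterior derivative of a pulled back 1-form on a vector space. -/
theorem fderiv_pullback_oneForm_antisymm {a : F → F →L[ℝ] ℝ} {Φ : F → F} {y : F}
    (ha : DifferentiableAt ℝ a (Φ y)) (hΦ : ContDiffAt ℝ ∞ Φ y) (v w : F) :
    fderiv ℝ (fun y => (a (Φ y)).comp (fderiv ℝ Φ y)) y v w
        - fderiv ℝ (fun y => (a (Φ y)).comp (fderiv ℝ Φ y)) y w v =
      fderiv ℝ a (Φ y) (fderiv ℝ Φ y v) (fderiv ℝ Φ y w)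
        - fderiv ℝ a (Φ y) (fderiv ℝ Φ y w) (fderiv ℝ Φ y v) := by
  have hd : DifferentiableAt ℝ Φ y := hΦ.differentiableAt (by simp)
  have hd2 : DifferentiableAt ℝ (fderiv ℝ Φ) y :=
    (hΦ.fderiv_right (m := 1) (by norm_cast)).differentiableAt (by simp)
  have h1 : DifferentiableAt ℝ (fun y => a (Φ y)) y := ha.comp y hd
  have hsymm : IsSymmSndFDerivAt ℝ Φ y := hΦ.isSymmSndFDerivAt (by simp; norm_cast)
  have h2 := (h1.hasFDerivAt.clm_comp hd2.hasFDerivAt).fderiv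
  rw [h2]
  have h3 : fderiv ℝ (fun y => a (Φ y)) y = (fderiv ℝ a (Φ y)).comp (fderiv ℝ Φ y) :=
    fderiv_comp y ha hd
  rw [h3]
  -- The second derivatives of Φ are symmetric, so they cancel in the antisymmetrized expression.
  have h4 := hsymm v w
  simp only [add_apply, ContinuousLinearMap.comp_apply, ContinuousLinearMap.compL_apply,
    ContinuousLinearMap.flip_apply]
  rw [h4]
  ring

/-- The exterior derivative of a 1-form may be computed in any chart. -/
theorem extDerivOneForm_eq_inChart (θ : ∀ x : N, TangentSpace J x →L[ℝ] ℝ) {x₀ x : N}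
    (hx : x ∈ (extChartAt J x₀).source)
    (hθ : DifferentiableAt ℝ (oneFormInChart J θ x₀) (extChartAt J x₀ x))
    (V W : TangentSpace J x) :
    extDerivOneForm J θ x V W =
      fderiv ℝ (oneFormInChart J θ x₀) (extChartAt J x₀ x)
          (mfderiv J 𝓘(ℝ, F) (extChartAt J x₀) x V) (mfderiv J 𝓘(ℝ, F) (extChartAt J x₀) x W)
        - fderiv ℝ (oneFormInChart J θ x₀) (extChartAt J x₀ x)
          (mfderiv J 𝓘(ℝ, F) (extChartAt J x₀) x W)
          (mfderiv J 𝓘(ℝ, F) (extChartAt J x₀) x V) := by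
  set Φ : F → F := fun y => extChartAt J x₀ ((extChartAt J x).symm y) with hΦdef
  have hxx := mem_extChartAt_source (I := J) x
  have hy := (extChartAt J x).map_source hxx
  have hli : (extChartAt J x).symm (extChartAt J x x) = x := (extChartAt J x).left_inv hxx
  have hΦx : Φ (extChartAt J x x) = extChartAt J x₀ x := by rw [hΦdef]; simp only [hli]
  have hΦ : ContDiffAt ℝ ∞ Φ (extChartAt J x x) := contDiffAt_chart_transition hxx hx
  have hsrc : ∀ᶠ y in 𝓝 (extChartAt J x x), (extChartAt J x).symm y ∈ (extChartAt J x₀).source := by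
    have hc : ContinuousAt (extChartAt J x).symm (extChartAt J x x) :=
      (mdifferentiableAt_extChartAt_symm hy).continuousAt
    refine hc.eventually_mem ?_
    rw [hli]
    exact (isOpen_extChartAt_source x₀).mem_nhds hx
  have hev : oneFormInChart J θ x =ᶠ[𝓝 (extChartAt J x x)]
      fun y => (oneFormInChart J θ x₀ (Φ y)).comp (fderiv ℝ Φ y) := by
    filter_upwards [hsrc, extChartAt_target_mem_nhds_of_mem hy] with y hys hyt
    refine ContinuousLinearMap.ext fun v => ?_
    have h1 := mfderiv_symm_eq_of_transition hyt hys v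
    change (θ ((extChartAt J x).symm y) : F →L[ℝ] ℝ) _ =
      (θ ((extChartAt J x₀).symm (Φ y)) : F →L[ℝ] ℝ) _
    have h2 : (extChartAt J x₀).symm (Φ y) = (extChartAt J x).symm y :=
      (extChartAt J x₀).left_inv hys
    rw [h2]
    exact congrArg (θ ((extChartAt J x).symm y) : F →L[ℝ] ℝ) h1
  have hfd : ∀ V : TangentSpace J x, fderiv ℝ Φ (extChartAt J x x) (chartDifferential J x V) =
      mfderiv J 𝓘(ℝ, F) (extChartAt J x₀) x V := fun V =>
    (mfderiv_eq_fderiv_extChartAt hxx (mdifferentiableAt_extChartAt_of_mem hx) V).symm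
  change fderiv ℝ (oneFormInChart J θ x) (extChartAt J x x)
          (chartDifferential J x V) (chartDifferential J x W)
        - fderiv ℝ (oneFormInChart J θ x) (extChartAt J x x)
          (chartDifferential J x W) (chartDifferential J x V) = _
  rw [hev.fderiv_eq, fderiv_pullback_oneForm_antisymm (by rwa [hΦx]) hΦ, hΦx, hfd, hfd]

/-- The exterior derivative of a 1-form whose expression in some chart is linear. -/
theorem extDerivOneForm_eq_of_linear_inChart {θ : ∀ x : N, TangentSpace J x →L[ℝ] ℝ} {x₀ x : N}
    (hx : x ∈ (extChartAt J x₀).source) {L : F →L[ℝ] F →L[ℝ] ℝ}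
    (hθ : oneFormInChart J θ x₀ =ᶠ[𝓝 (extChartAt J x₀ x)] L) (V W : TangentSpace J x) :
    extDerivOneForm J θ x V W =
      L (mfderiv J 𝓘(ℝ, F) (extChartAt J x₀) x V) (mfderiv J 𝓘(ℝ, F) (extChartAt J x₀) x W)
        - L (mfderiv J 𝓘(ℝ, F) (extChartAt J x₀) x W)
          (mfderiv J 𝓘(ℝ, F) (extChartAt J x₀) x V) := by
  rw [extDerivOneForm_eq_inChart θ hx (L.differentiableAt.congr_of_eventuallyEq hθ),
    hθ.fderiv_eq, L.fderiv]

end ExtDeriv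

/-! ### The canonical symplectic form in charts -/

/-- The symplectic form `((v, η), (w, ζ)) ↦ ζ v - η w` on `F × F*`. -/
noncomputable def stdSymplectic (F : Type*) [NormedAddCommGroup F] [NormedSpace ℝ F] :
    LinearMap.BilinForm ℝ (F × (F →L[ℝ] ℝ)) :=
  LinearMap.mk₂ ℝ (fun V W => W.2 V.1 - V.2 W.1)
    (fun _ _ _ => by simp; ring) (fun _ _ _ => by simp; ring)
    (fun _ _ _ => by simp; ring) (fun _ _ _ => by simp; ring)

theorem stdSymplectic_apply {F : Type*} [NormedAddCommGroup F] [NormedSpace ℝ F]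
    (V W : F × (F →L[ℝ] ℝ)) : stdSymplectic F V W = W.2 V.1 - V.2 W.1 := rfl

/-- The 1-form `(y, ξ) ↦ ξ dy` on `F × F*`. -/
noncomputable def stdLiouville (F : Type*) [NormedAddCommGroup F] [NormedSpace ℝ F] :
    (F × (F →L[ℝ] ℝ)) →L[ℝ] (F × (F →L[ℝ] ℝ)) →L[ℝ] ℝ :=
  ((ContinuousLinearMap.compL ℝ (F × (F →L[ℝ] ℝ)) F ℝ).flip
    (ContinuousLinearMap.fst ℝ F (F →L[ℝ] ℝ))).comp (ContinuousLinearMap.snd ℝ F (F →L[ℝ] ℝ))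

section CotangentForm

variable {n : ℕ} {M : Type*} [TopologicalSpace M] [ChartedSpace (Eu n) M] [IsManifold (𝓡 n) ∞ M]

/-- The Liouville form is linear in every cotangent chart, so its exterior derivative has constant
coefficients there. Since the exterior derivative does not depend on the chart, Ω_can has the
standard form at all points of a chart domain and not only at its centre. -/
theorem canonicalForm_eq_inChart {α₀ α : CotangentBundle n M}
    (hα : α ∈ (extChartAt (cotModel n) α₀).source) (V W : TangentSpace (cotModel n) α) :
    canonicalForm α V W = stdSymplectic (Eu n)
      (dChart (cotModel n) α₀ α V)
      (dChart (cotModel n) α₀ α W) := by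
  have hz := (extChartAt (cotModel n) α₀).map_source hα
  have hev : oneFormInChart (cotModel n) (liouvilleOneForm (n := n) (M := M)) α₀
      =ᶠ[𝓝 (extChartAt (cotModel n) α₀ α)] stdLiouville (Eu n) := by
    filter_upwards [extChartAt_target_mem_nhds_of_mem hz] with w hw
    exact liouvilleOneForm_inChart α₀ hw
  exact (congrArg Neg.neg (extDerivOneForm_eq_of_linear_inChart hα hev V W)).trans (neg_sub _ _)

end CotangentForm

/-! ### The canonical Poisson bracket in charts -/

section PoissonBracket

variable {n : ℕ} {M : Type*} [TopologicalSpace M] [ChartedSpace (Eu n) M] [IsManifold (𝓡 n) ∞ M]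

theorem cotDiff_eq_inChart {f : CotangentBundle n M → ℝ} {α₀ α : CotangentBundle n M}
    (hα : α ∈ (extChartAt (cotModel n) α₀).source)
    (hf : MDifferentiableAt (cotModel n) 𝓘(ℝ, ℝ) f α) (V : TangentSpace (cotModel n) α) :
    cotDiff f α V = fderiv ℝ (fun z => f ((extChartAt (cotModel n) α₀).symm z))
      (extChartAt (cotModel n) α₀ α)
      (dChart (cotModel n) α₀ α V) :=
  mfderiv_eq_fderiv_dChart hα hf V

/-- The canonical Poisson bracket in a chart. -/
theorem poissonBracket_eq_inChart {f g : CotangentBundle n M → ℝ} {α₀ α : CotangentBundle n M}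
    (hα : α ∈ (extChartAt (cotModel n) α₀).source)
    (hf : MDifferentiableAt (cotModel n) 𝓘(ℝ, ℝ) f α)
    (hg : MDifferentiableAt (cotModel n) 𝓘(ℝ, ℝ) g α) {f' g' : (Eu n × (Eu n →L[ℝ] ℝ)) →L[ℝ] ℝ}
    (hf' : HasFDerivAt (fun z => f ((extChartAt (cotModel n) α₀).symm z)) f'
      (extChartAt (cotModel n) α₀ α))
    (hg' : HasFDerivAt (fun z => g ((extChartAt (cotModel n) α₀).symm z)) g'
      (extChartAt (cotModel n) α₀ α))
    {x : Eu n} (hx : ∀ η, g' (0, η) = η x) :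
    poissonBracket f g α =
      f' (x, -g'.comp (ContinuousLinearMap.inl ℝ (Eu n) (Eu n →L[ℝ] ℝ))) := by
  set c : TangentSpace (cotModel n) α →L[ℝ] Eu n × (Eu n →L[ℝ] ℝ) :=
    dChart (cotModel n) α₀ α with hc
  have hsurj : ∀ v : Eu n × (Eu n →L[ℝ] ℝ), ∃ V : TangentSpace (cotModel n) α, c V = v :=
    dChart_surjective hα
  have hdg : ∀ W, cotDiff g α W = g' (c W) := fun W => by
    rw [cotDiff_eq_inChart hα hg, hg'.fderiv]
  have hdec : ∀ v : Eu n × (Eu n →L[ℝ] ℝ), g' v = g' (v.1, 0) + g' (0, v.2) := fun v => by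
    rw [← map_add]; simp
  -- `hamiltonianVector` is a choice, so a solution has to be exhibited before its defining equation
  -- can be used. Pairing with purely vertical and purely horizontal vectors then pins down its two
  -- components.
  have hex : ∃ V : TangentSpace (cotModel n) α, ∀ W, canonicalForm α V W = cotDiff g α W := by
    obtain ⟨V, hV⟩ := hsurj (x, -g'.comp (ContinuousLinearMap.inl ℝ (Eu n) (Eu n →L[ℝ] ℝ)))
    refine ⟨V, fun W => ?_⟩
    rw [canonicalForm_eq_inChart hα, hdg, ← hc, hV, stdSymplectic_apply, hdec (c W), hx]
    simp
    ring
  have hspec : ∀ W, canonicalForm α (hamiltonianVector g α) W = cotDiff g α W :=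
    Classical.epsilon_spec hex
  have hV : c (hamiltonianVector g α) =
      (x, -g'.comp (ContinuousLinearMap.inl ℝ (Eu n) (Eu n →L[ℝ] ℝ))) := by
    have key : ∀ v : Eu n × (Eu n →L[ℝ] ℝ),
        v.2 (c (hamiltonianVector g α)).1 - (c (hamiltonianVector g α)).2 v.1 = g' v := by
      intro v
      obtain ⟨W, rfl⟩ := hsurj v
      rw [← hdg, ← hspec W, canonicalForm_eq_inChart hα, ← hc, stdSymplectic_apply]
    refine Prod.ext ?_ ?_
    · refine (SeparatingDual.eq_iff_forall_dual_eq (R := ℝ)).2 fun η => ?_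
      have := key (0, η)
      rw [hx] at this
      simpa using this
    · ext w
      have := key (w, 0)
      simp only [zero_apply, zero_sub] at this
      simp only [neg_apply, ContinuousLinearMap.comp_apply,
        ContinuousLinearMap.inl_apply]
      linarith
  change cotDiff f α (hamiltonianVector g α) = _
  rw [cotDiff_eq_inChart hα hf, ← hc, hV, hf'.fderiv]

end PoissonBracket

/-! ### Top degree forms -/

section TopForms

/-- By Cramer's rule the i-th summand is the i-th diagonal entry of adj(M) A M. The sum is the trace
of this product, and cyclicity moves adj(M) next to M, where the product is det M times the
identity. -/
theorem Matrix.sum_det_updateCol_mul {ι : Type*} [Fintype ι] [DecidableEq ι]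
    (A M : Matrix ι ι ℝ) :
    ∑ i, (M.updateCol i fun j => (A * M) j i).det = A.trace * M.det := by
  have h : ∀ i, (M.updateCol i fun j => (A * M) j i).det = (M.adjugate * (A * M)) i i := by
    intro i
    rw [← Matrix.cramer_apply, Matrix.cramer_eq_adjugate_mulVec]
    rfl
  simp_rw [h]
  change (M.adjugate * (A * M)).trace = _
  rw [Matrix.trace_mul_comm, Matrix.mul_assoc, Matrix.mul_adjugate]
  simp [mul_comm]

variable {V : Type*} [AddCommGroup V] [Module ℝ V] {ι : Type*} [Fintype ι] [DecidableEq ι]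

/-- A linear map acts as a derivation on forms of top degree through its trace. -/
theorem AlternatingMap.sum_update_eq_trace_mul [FiniteDimensional ℝ V]
    (hι : Module.finrank ℝ V = Fintype.card ι) (f : V [⋀^ι]→ₗ[ℝ] ℝ) (A : V →ₗ[ℝ] V) (v : ι → V) :
    ∑ i, f (Function.update v i (A (v i))) = LinearMap.trace ℝ V A * f v := by
  let b : Module.Basis ι ℝ V :=
    (Module.finBasis ℝ V).reindex ((finCongr hι).trans (Fintype.equivFin ι).symm)
  have hf := f.eq_smul_basis_det b
  have hupd : ∀ i, b.det (Function.update v i (A (v i))) =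
      ((b.toMatrix v).updateCol i fun j => (LinearMap.toMatrix b b A * b.toMatrix v) j i).det := by
    intro i
    rw [Module.Basis.det_apply, Module.Basis.toMatrix_update]
    congr 2
    funext j
    have := congrFun (LinearMap.toMatrix_mulVec_repr b b A (v i)) j
    exact this.symm
  rw [hf]
  simp only [AlternatingMap.smul_apply, smul_eq_mul, ← Finset.mul_sum, hupd]
  rw [Matrix.sum_det_updateCol_mul, LinearMap.trace_eq_matrix_trace ℝ b, Module.Basis.det_apply]
  ring

/-- Forms of top degree are proportional. -/
theorem AlternatingMap.exists_eq_smul_of_ne_zero [FiniteDimensional ℝ V]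
    (hι : Module.finrank ℝ V = Fintype.card ι) (f : V [⋀^ι]→ₗ[ℝ] ℝ) {g : V [⋀^ι]→ₗ[ℝ] ℝ}
    (hg : g ≠ 0) : ∃ c : ℝ, f = c • g := by
  let b : Module.Basis ι ℝ V :=
    (Module.finBasis ℝ V).reindex ((finCongr hι).trans (Fintype.equivFin ι).symm)
  have hf := f.eq_smul_basis_det b
  have hg' := g.eq_smul_basis_det b
  have hgb : g b ≠ 0 := fun h => hg (by rw [hg', h, zero_smul])
  refine ⟨f b / g b, ?_⟩
  rw [hf, hg', smul_smul]
  congr 1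
  simp [AlternatingMap.smul_apply, Module.Basis.det_self]
  field_simp

theorem wedgePower_compLinearMap {W : Type*} [AddCommGroup W] [Module ℝ W]
    (η : LinearMap.BilinForm ℝ V) (r : ℕ) (T : W →ₗ[ℝ] V) :
    (wedgePower η r).compLinearMap T = wedgePower (η.comp T T) r := by
  ext v
  simp only [wedgePower, AlternatingMap.compLinearMap_apply, AlternatingMap.smul_apply,
    MultilinearMap.alternatization_apply]
  rfl

theorem wedgePower_apply (η : LinearMap.BilinForm ℝ V) (r : ℕ) (v : Fin r × Fin 2 → V) :
    wedgePower η r v = ((2 : ℝ) ^ r)⁻¹ * ∑ σ : Equiv.Perm (Fin r × Fin 2),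
      ((Equiv.Perm.sign σ : ℤ) : ℝ) * ∏ i, η (v (σ (i, 0))) (v (σ (i, 1))) := by
  simp only [wedgePower, AlternatingMap.smul_apply, MultilinearMap.alternatization_apply,
    smul_eq_mul]
  congr 1
  refine Finset.sum_congr rfl fun σ _ => ?_
  rw [Units.smul_def, zsmul_eq_mul]
  rfl

/-- The permutations which contribute to the top power of a symplectic form on a symplectic basis
contribute non-negative terms. -/
theorem sign_mul_prod_symplectic_nonneg {r : ℕ} {p : Fin r × Fin 2 → Fin r × Fin 2 → ℝ}
    (h01 : ∀ i, p (i, 0) (i, 1) = 1) (h10 : ∀ i, p (i, 1) (i, 0) = -1)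
    (hne : ∀ a b, a.1 ≠ b.1 → p a b = 0) (σ : Equiv.Perm (Fin r × Fin 2)) :
    0 ≤ ((Equiv.Perm.sign σ : ℤ) : ℝ) * ∏ i, p (σ (i, 0)) (σ (i, 1)) := by
  by_cases hz : ∏ i, p (σ (i, 0)) (σ (i, 1)) = 0
  · rw [hz, mul_zero]
  rw [Finset.prod_eq_zero_iff] at hz
  push Not at hz
  have hpair : ∀ i, (σ (i, 0)).1 = (σ (i, 1)).1 := fun i => by
    by_contra h
    exact hz i (Finset.mem_univ _) (hne _ _ h)
  have hall : ∀ i j, (σ (i, j)).1 = (σ (i, 0)).1 := fun i j => by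
    fin_cases j
    · rfl
    · exact (hpair i).symm
  have hsurj : Function.Surjective fun i => (σ (i, 0)).1 := fun k => by
    refine ⟨(σ.symm (k, 0)).1, ?_⟩
    have := hall (σ.symm (k, 0)).1 (σ.symm (k, 0)).2
    simp only [Prod.mk.eta, Equiv.apply_symm_apply] at this
    exact this.symm
  -- A permutation with non-zero contribution maps each pair {(i, 0), (i, 1)} onto another pair. It
  -- is a permutation τ of the pairs combined with a flip or the identity, ε i, inside each of them.
  let τ : Equiv.Perm (Fin r) :=
    Equiv.ofBijective _ ⟨Finite.injective_iff_surjective.2 hsurj, hsurj⟩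
  have hε : ∀ i, Function.Injective fun j => (σ (i, j)).2 := fun i j j' h => by
    have : σ (i, j) = σ (i, j') := Prod.ext ((hall i j).trans (hall i j').symm) h
    exact (Prod.ext_iff.1 (σ.injective this)).2
  let ε : Fin r → Equiv.Perm (Fin 2) := fun i =>
    Equiv.ofBijective _ ⟨hε i, Finite.injective_iff_surjective.1 (hε i)⟩
  have hσ : σ = Equiv.prodCongrLeft (fun _ => τ) * Equiv.prodCongrRight ε := by
    refine Equiv.ext fun a => ?_
    exact Prod.ext (hall a.1 a.2) rfl
  -- The permutation τ acts on both members of the pairs, so its sign appears squared. Only the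
  -- signs of the ε i remain, and the factors of the product have the same signs, so the whole term
  -- is a product of squares.
  have hs : Equiv.Perm.sign σ = ∏ i, Equiv.Perm.sign (ε i) := by
    rw [hσ, map_mul, Equiv.Perm.sign_prodCongrLeft, Equiv.Perm.sign_prodCongrRight]
    simp
  have hterm : ∀ i, p (σ (i, 0)) (σ (i, 1)) = ((Equiv.Perm.sign (ε i) : ℤ) : ℝ) := by
    intro i
    have h0 : σ (i, 0) = (τ i, ε i 0) := rfl
    have h1 : σ (i, 1) = (τ i, ε i 1) := Prod.ext (hall i 1) rfl
    rw [h0, h1]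
    have hcases : ∀ e : Equiv.Perm (Fin 2), e = 1 ∨ e = Equiv.swap 0 1 := by decide
    rcases hcases (ε i) with h | h
    · rw [h]; simp [h01]
    · rw [h]; simp [h10]
  rw [hs]
  simp only [hterm]
  push_cast
  rw [← Finset.prod_mul_distrib]
  exact Finset.prod_nonneg fun i _ => mul_self_nonneg _

/-- The top power of the standard symplectic form does not vanish. -/
theorem wedgePower_stdSymplectic_ne_zero (r : ℕ) : wedgePower (stdSymplectic (Eu r)) r ≠ 0 := by
  intro h
  let b : Fin r → Eu r := fun i => EuclideanSpace.single i (1 : ℝ)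
  let c : Fin r → (Eu r →L[ℝ] ℝ) := fun i => EuclideanSpace.proj i
  let v : Fin r × Fin 2 → Eu r × (Eu r →L[ℝ] ℝ) := fun a => if a.2 = 0 then (b a.1, 0) else (0, c a.1)
  have hcb : ∀ i j, c i (b j) = if i = j then 1 else 0 := fun i j => by
    simp [c, b]
  have hnn := sign_mul_prod_symplectic_nonneg (r := r)
    (p := fun a b => stdSymplectic (Eu r) (v a) (v b))
    (fun i => by simp [v, stdSymplectic_apply, hcb])
    (fun i => by simp [v, stdSymplectic_apply, hcb])
    (fun a b hab => by
      have hba : b.1 ≠ a.1 := hab.symm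
      by_cases ha : a.2 = 0 <;> by_cases hb : b.2 = 0 <;>
        simp [v, stdSymplectic_apply, ha, hb, hcb, hab, hba])
  have hv := DFunLike.congr_fun h v
  rw [wedgePower_apply] at hv
  have hpos : 0 < ∑ σ : Equiv.Perm (Fin r × Fin 2), ((Equiv.Perm.sign σ : ℤ) : ℝ) *
      ∏ i, stdSymplectic (Eu r) (v (σ (i, 0))) (v (σ (i, 1))) := by
    -- No cancellation can occur among the terms, so the term 1 of the identity permutation suffices
    -- for positivity.
    refine Finset.sum_pos' (fun σ _ => hnn σ) ⟨1, Finset.mem_univ _, ?_⟩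
    simp [v, stdSymplectic_apply, hcb]
  have h2 : (0 : ℝ) < ((2 : ℝ) ^ r)⁻¹ := by positivity
  exact (mul_pos h2 hpos).ne' hv

end TopForms

/-! ### Invariant volume forms on the cotangent bundle -/

section LieDerivative

variable {F : Type*} [NormedAddCommGroup F] [NormedSpace ℝ F] [FiniteDimensional ℝ F]
  {H : Type*} [TopologicalSpace H] {J : ModelWithCorners ℝ F H} [J.Boundaryless]
  {N : Type*} [TopologicalSpace N] [ChartedSpace H N] [IsManifold J ∞ N]
  {ι : Type*} [Fintype ι] [DecidableEq ι]

/-- Invariance of a form of top degree whose coefficient in the charts is the function `f`. -/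
theorem preservesForm_iff_of_inChart (hι : Module.finrank ℝ F = Fintype.card ι)
    {X : ∀ x : N, TangentSpace J x} {μ : ∀ x : N, TangentSpace J x [⋀^ι]→ₗ[ℝ] ℝ}
    {ϖ : F [⋀^ι]→ₗ[ℝ] ℝ} (hϖ : ϖ ≠ 0) {f : N → ℝ} (hf : ∀ x, MDifferentiableAt J 𝓘(ℝ, ℝ) f x)
    (hμ : ∀ x₀, ∀ y ∈ (extChartAt J x₀).target,
      formInChart μ x₀ y = f ((extChartAt J x₀).symm y) • ϖ) :
    PreservesForm X μ ↔ ∀ x, fderiv ℝ (fun y => f ((extChartAt J x).symm y)) (extChartAt J x x)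
        (vectorFieldInChart X x (extChartAt J x x))
      + f x * LinearMap.trace ℝ F (fderiv ℝ (vectorFieldInChart X x) (extChartAt J x x)) = 0 := by
  -- Since ϖ is constant, the first term of the Lie derivative only differentiates f, and the
  -- remaining sum is the action of DX on a form of top degree, that is, multiplication by its
  -- trace.
  have key : ∀ x V, lieDerivForm X μ x V =
      (fderiv ℝ (fun y => f ((extChartAt J x).symm y)) (extChartAt J x x)
        (vectorFieldInChart X x (extChartAt J x x))
      + f x * LinearMap.trace ℝ F (fderiv ℝ (vectorFieldInChart X x) (extChartAt J x x)))
      * ϖ fun i => dChart J x x (V i) := by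
    intro x V
    have hx := mem_extChartAt_source (I := J) x
    have hy := (extChartAt J x).map_source hx
    have hli : (extChartAt J x).symm (extChartAt J x x) = x := (extChartAt J x).left_inv hx
    set v : ι → F := fun i => dChart J x x (V i) with hv
    have hev : (fun y => formInChart μ x y v) =ᶠ[𝓝 (extChartAt J x x)]
        fun y => f ((extChartAt J x).symm y) * ϖ v := by
      filter_upwards [extChartAt_target_mem_nhds_of_mem hy] with y hyt
      rw [hμ x y hyt]
      rfl
    have hd : DifferentiableAt ℝ (fun y => f ((extChartAt J x).symm y)) (extChartAt J x x) :=
      differentiableAt_comp_extChartAt_symm hy (by rw [hli]; exact hf x)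
    have h1 : fderiv ℝ (fun y => formInChart μ x y v) (extChartAt J x x)
        (vectorFieldInChart X x (extChartAt J x x)) =
        fderiv ℝ (fun y => f ((extChartAt J x).symm y)) (extChartAt J x x)
          (vectorFieldInChart X x (extChartAt J x x)) * ϖ v := by
      rw [hev.fderiv_eq, fderiv_mul_const hd]
      simp [mul_comm]
    have h2 : ∑ i, formInChart μ x (extChartAt J x x)
        (Function.update v i (fderiv ℝ (vectorFieldInChart X x) (extChartAt J x x) (v i))) =
        f x * (LinearMap.trace ℝ F (fderiv ℝ (vectorFieldInChart X x) (extChartAt J x x))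
          * ϖ v) := by
      rw [← ϖ.sum_update_eq_trace_mul hι, Finset.mul_sum, hμ x _ hy, hli]
      rfl
    change fderiv ℝ (fun y => formInChart μ x y v) (extChartAt J x x)
        (vectorFieldInChart X x (extChartAt J x x)) + ∑ i, formInChart μ x (extChartAt J x x)
        (Function.update v i (fderiv ℝ (vectorFieldInChart X x) (extChartAt J x x) (v i))) = _
    rw [h1, h2]
    ring
  refine ⟨fun h x => ?_, fun h x V => by rw [key, h x, zero_mul]⟩
  obtain ⟨v, hv⟩ : ∃ v, ϖ v ≠ 0 := by
    by_contra! h0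
    exact hϖ (AlternatingMap.ext h0)
  have := h x fun i => dChartInv J x x (v i)
  rw [key] at this
  simp only [dChart_dChartInv (mem_extChartAt_source x)] at this
  exact (mul_eq_zero.1 this).resolve_right hv

end LieDerivative

/-! ### Densities relative to the Liouville volume -/

section CotangentVolume

variable {n : ℕ} {M : Type*} [TopologicalSpace M] [ChartedSpace (Eu n) M] [IsManifold (𝓡 n) ∞ M]

theorem finrank_cotModelSpace (n : ℕ) :
    Module.finrank ℝ (Eu n × (Eu n →L[ℝ] ℝ)) = Fintype.card (Fin n × Fin 2) := by
  have h : Module.finrank ℝ (Eu n →L[ℝ] ℝ) = n := by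
    rw [← LinearMap.toContinuousLinearMap.finrank_eq, Module.finrank_linearMap]
    simp
  rw [Module.finrank_prod, h]
  simp [mul_two]

/-- Cotangent charts are Darboux charts, so the coefficients of ν are constant in them. The
divergence with respect to ν is thus the plain trace of the derivative in the chart. -/
theorem liouvilleVolume_inChart (α₀ : CotangentBundle n M) {z : Eu n × (Eu n →L[ℝ] ℝ)}
    (hz : z ∈ (extChartAt (cotModel n) α₀).target) :
    formInChart (J := cotModel n) (liouvilleVolume (n := n) (M := M)) α₀ z =
      wedgePower (stdSymplectic (Eu n)) n := by
  have hs := (extChartAt (cotModel n) α₀).map_target hz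
  refine (wedgePower_compLinearMap (canonicalForm ((extChartAt (cotModel n) α₀).symm z)) n
    (mfderiv 𝓘(ℝ, Eu n × (Eu n →L[ℝ] ℝ)) (cotModel n) (extChartAt (cotModel n) α₀).symm z :
      (Eu n × (Eu n →L[ℝ] ℝ)) →L[ℝ] TangentSpace (cotModel n)
        ((extChartAt (cotModel n) α₀).symm z)).toLinearMap).trans ?_
  congr 1
  refine LinearMap.ext₂ fun V W => ?_
  have h := canonicalForm_eq_inChart hs
    ((mfderiv 𝓘(ℝ, Eu n × (Eu n →L[ℝ] ℝ)) (cotModel n) (extChartAt (cotModel n) α₀).symm z :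
      (Eu n × (Eu n →L[ℝ] ℝ)) →L[ℝ] Eu n × (Eu n →L[ℝ] ℝ)) V)
    ((mfderiv 𝓘(ℝ, Eu n × (Eu n →L[ℝ] ℝ)) (cotModel n) (extChartAt (cotModel n) α₀).symm z :
      (Eu n × (Eu n →L[ℝ] ℝ)) →L[ℝ] Eu n × (Eu n →L[ℝ] ℝ)) W)
  refine h.trans ?_
  congr 1
  · congr 1
    exact mfderiv_extChartAt_mfderiv_symm hz V
  · exact mfderiv_extChartAt_mfderiv_symm hz W

theorem smul_liouvilleVolume_inChart (f : CotangentBundle n M → ℝ) (α₀ : CotangentBundle n M)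
    {z : Eu n × (Eu n →L[ℝ] ℝ)} (hz : z ∈ (extChartAt (cotModel n) α₀).target) :
    formInChart (J := cotModel n) (fun α => f α • liouvilleVolume α) α₀ z =
      f ((extChartAt (cotModel n) α₀).symm z) • wedgePower (stdSymplectic (Eu n)) n := by
  rw [← liouvilleVolume_inChart α₀ hz]
  rfl

/-- The divergence criterion for the invariance of the form `f ν`. -/
theorem preservesForm_smul_liouvilleVolume_iff
    {X : ∀ β : CotangentBundle n M, TangentSpace (cotModel n) β} {f : CotangentBundle n M → ℝ}
    (hf : ∀ α, MDifferentiableAt (cotModel n) 𝓘(ℝ, ℝ) f α) :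
    PreservesForm X (fun α => f α • liouvilleVolume α) ↔ ∀ α,
      fderiv ℝ (fun z => f ((extChartAt (cotModel n) α).symm z)) (extChartAt (cotModel n) α α)
        (vectorFieldInChart X α (extChartAt (cotModel n) α α))
      + f α * LinearMap.trace ℝ (Eu n × (Eu n →L[ℝ] ℝ))
        (fderiv ℝ (vectorFieldInChart X α) (extChartAt (cotModel n) α α)) = 0 :=
  preservesForm_iff_of_inChart (finrank_cotModelSpace n) (wedgePower_stdSymplectic_ne_zero n) hf
    fun α₀ _ hz => smul_liouvilleVolume_inChart f α₀ hz

/-- The derivative of exp ρ is exp ρ times that of ρ, so the non-zero factor exp ρ divides out and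
leaves a condition that is affine in ρ. -/
theorem preservesForm_expVolume_iff
    {X : ∀ β : CotangentBundle n M, TangentSpace (cotModel n) β} {ρ : CotangentBundle n M → ℝ}
    (hρ : ∀ α, MDifferentiableAt (cotModel n) 𝓘(ℝ, ℝ) ρ α) :
    PreservesForm X (expVolume ρ) ↔ ∀ α,
      fderiv ℝ (fun z => ρ ((extChartAt (cotModel n) α).symm z)) (extChartAt (cotModel n) α α)
        (vectorFieldInChart X α (extChartAt (cotModel n) α α))
      + LinearMap.trace ℝ (Eu n × (Eu n →L[ℝ] ℝ))
        (fderiv ℝ (vectorFieldInChart X α) (extChartAt (cotModel n) α α)) = 0 := by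
  have hexp : ∀ α, MDifferentiableAt (cotModel n) 𝓘(ℝ, ℝ) (fun α => Real.exp (ρ α)) α := fun α =>
    (Real.differentiable_exp.differentiableAt.mdifferentiableAt).comp α (hρ α)
  refine (preservesForm_smul_liouvilleVolume_iff hexp).trans (forall_congr' fun α => ?_)
  have hx := mem_extChartAt_source (I := cotModel n) α
  have hli := (extChartAt (cotModel n) α).left_inv hx
  have hd : DifferentiableAt ℝ (fun z => ρ ((extChartAt (cotModel n) α).symm z))
      (extChartAt (cotModel n) α α) :=
    differentiableAt_comp_extChartAt_symm ((extChartAt (cotModel n) α).map_source hx)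
      (by rw [hli]; exact hρ α)
  rw [fderiv_exp hd, hli, smul_apply, smul_eq_mul, ← mul_add, mul_eq_zero,
    or_iff_right (Real.exp_ne_zero _)]

theorem contMDiff_of_contDiffOn_extChartAt_symm {f : CotangentBundle n M → ℝ}
    (hf : ∀ α₀ : CotangentBundle n M, ContDiffOn ℝ ∞
      (fun z => f ((extChartAt (cotModel n) α₀).symm z)) (extChartAt (cotModel n) α₀).target) :
    ContMDiff (cotModel n) 𝓘(ℝ, ℝ) ∞ f := by
  intro α
  have h1 := (((hf α).contDiffAt (extChartAt_target_mem_nhds α)).contMDiffAt).comp α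
    (contMDiffAt_extChartAt (I := cotModel n) (n := ∞) (x := α))
  refine h1.congr_of_eventuallyEq ?_
  filter_upwards [extChartAt_source_mem_nhds (I := cotModel n) α] with β hβ
  simp only [Function.comp]
  rw [(extChartAt (cotModel n) α).left_inv hβ]

/-- Every volume form on the cotangent bundle is a multiple of the Liouville volume form. -/
theorem IsVolumeForm.exists_eq_smul_liouvilleVolume
    {μ : ∀ β : CotangentBundle n M, TangentSpace (cotModel n) β [⋀^Fin n × Fin 2]→ₗ[ℝ] ℝ}
    (hμ : IsVolumeForm μ) : ∃ f : CotangentBundle n M → ℝ,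
      ContMDiff (cotModel n) 𝓘(ℝ, ℝ) ∞ f ∧ (∀ α, f α ≠ 0) ∧
      μ = fun α => f α • liouvilleVolume α := by
  have hne : ∀ α : CotangentBundle n M, liouvilleVolume α ≠ 0 := fun α h => by
    have h1 := liouvilleVolume_inChart α (mem_extChartAt_target (I := cotModel n) α)
    refine wedgePower_stdSymplectic_ne_zero n (h1.symm.trans ?_)
    have h2 := (extChartAt (cotModel n) α).left_inv (mem_extChartAt_source (I := cotModel n) α)
    change (liouvilleVolume _).compLinearMap _ = _
    rw [h2, h]
    rfl
  have hex : ∀ α : CotangentBundle n M, ∃ c : ℝ, μ α = c • liouvilleVolume α := fun α =>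
    AlternatingMap.exists_eq_smul_of_ne_zero (V := Eu n × (Eu n →L[ℝ] ℝ))
      (finrank_cotModelSpace n) (μ α) (hne α)
  choose f hf using hex
  refine ⟨f, contMDiff_of_contDiffOn_extChartAt_symm fun α₀ => ?_, fun α h => ?_, funext hf⟩
  · obtain ⟨v, hv⟩ : ∃ v, wedgePower (stdSymplectic (Eu n)) n v ≠ 0 := by
      by_contra! h0
      exact wedgePower_stdSymplectic_ne_zero n (AlternatingMap.ext h0)
    refine ((hμ.1 α₀ v).div_const (wedgePower (stdSymplectic (Eu n)) n v)).congr fun z hz => ?_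
    have h2 := smul_liouvilleVolume_inChart f α₀ hz
    rw [← show μ = fun α => f α • liouvilleVolume α from funext hf] at h2
    rw [h2, AlternatingMap.smul_apply, smul_eq_mul]
    field_simp
  · refine hμ.2 α ?_
    rw [hf, h, zero_smul]

/-- A vector field which preserves a volume form preserves one of the form `exp(ρ) ν`. -/
theorem IsVolumeForm.exists_preservesForm_expVolume
    {μ : ∀ β : CotangentBundle n M, TangentSpace (cotModel n) β [⋀^Fin n × Fin 2]→ₗ[ℝ] ℝ}
    (hμ : IsVolumeForm μ) {X : ∀ β : CotangentBundle n M, TangentSpace (cotModel n) β}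
    (hX : PreservesForm X μ) : ∃ ρ : CotangentBundle n M → ℝ,
      ContMDiff (cotModel n) 𝓘(ℝ, ℝ) ∞ ρ ∧ PreservesForm X (expVolume ρ) := by
  obtain ⟨f, hf, hf0, rfl⟩ := hμ.exists_eq_smul_liouvilleVolume
  -- `Real.log` is log|·|, smooth away from 0 on both sides, so the sign of f does not matter. If f
  -- is negative, the form obtained is the negative of the original one, which is equally invariant.
  have hρ : ContMDiff (cotModel n) 𝓘(ℝ, ℝ) ∞ fun α => Real.log (f α) := fun α =>
    ((Real.contDiffAt_log.2 (hf0 α)).contMDiffAt).comp α (hf α)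
  refine ⟨_, hρ, (preservesForm_expVolume_iff (hρ.mdifferentiable (by simp))).2 fun α => ?_⟩
  have h := (preservesForm_smul_liouvilleVolume_iff (hf.mdifferentiable (by simp))).1 hX α
  have hx := mem_extChartAt_source (I := cotModel n) α
  have hli := (extChartAt (cotModel n) α).left_inv hx
  have hd : DifferentiableAt ℝ (fun z => f ((extChartAt (cotModel n) α).symm z))
      (extChartAt (cotModel n) α α) :=
    differentiableAt_comp_extChartAt_symm ((extChartAt (cotModel n) α).map_source hx)
      (by rw [hli]; exact hf.mdifferentiable (by simp) α)
  have h0 : f ((extChartAt (cotModel n) α).symm (extChartAt (cotModel n) α α)) ≠ 0 := hf0 _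
  rw [(hd.hasFDerivAt.log h0).fderiv, hli, smul_apply, smul_eq_mul]
  have := hf0 α
  field_simp
  linarith

theorem isVolumeForm_expVolume {ρ : CotangentBundle n M → ℝ}
    (hρ : ContMDiff (cotModel n) 𝓘(ℝ, ℝ) ∞ ρ) : IsVolumeForm (expVolume ρ) := by
  refine ⟨fun α₀ v => ?_, fun α h => ?_⟩
  · have h1 : ContDiffOn ℝ ∞ (fun z => ρ ((extChartAt (cotModel n) α₀).symm z))
        (extChartAt (cotModel n) α₀).target :=
      (hρ.comp_contMDiffOn (contMDiffOn_extChartAt_symm α₀)).contDiffOn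
    refine (h1.exp.mul (contDiffOn_const (c := wedgePower (stdSymplectic (Eu n)) n v))).congr
      fun z hz => ?_
    exact DFunLike.congr_fun
        (smul_liouvilleVolume_inChart (fun α => Real.exp (ρ α)) α₀ hz) v
  · have h1 := smul_liouvilleVolume_inChart (fun α => Real.exp (ρ α)) α
      (mem_extChartAt_target (I := cotModel n) α)
    have h2 := (extChartAt (cotModel n) α).left_inv (mem_extChartAt_source (I := cotModel n) α)
    have h3 : formInChart (J := cotModel n) (fun α => Real.exp (ρ α) • liouvilleVolume α) α
        (extChartAt (cotModel n) α α) = 0 := by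
      change (expVolume ρ _).compLinearMap _ = _
      rw [h2, h]
      rfl
    rw [h3] at h1
    exact (smul_ne_zero (Real.exp_ne_zero _) (wedgePower_stdSymplectic_ne_zero n)) h1.symm

end CotangentVolume

/-! ### Vector fields in charts -/

section VectorFields

variable {F : Type*} [NormedAddCommGroup F] [NormedSpace ℝ F]
  {H : Type*} [TopologicalSpace H] {J : ModelWithCorners ℝ F H} [J.Boundaryless]
  {N : Type*} [TopologicalSpace N] [ChartedSpace H N] [IsManifold J ∞ N]

omit [J.Boundaryless] [IsManifold J ∞ N] in
theorem vectorFieldInChart_eq_dChart (X : ∀ x : N, TangentSpace J x) (x₀ : N) (y : F) :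
    vectorFieldInChart X x₀ y =
      dChart J x₀ ((extChartAt J x₀).symm y) (X ((extChartAt J x₀).symm y)) := rfl

theorem contMDiffAt_comp_extChartAt_symm_iff {E' : Type*} [NormedAddCommGroup E']
    [NormedSpace ℝ E'] {f : N → E'} {x₀ x : N} (hx : x ∈ (extChartAt J x₀).source) :
    ContMDiffAt J 𝓘(ℝ, E') ∞ f x ↔
      ContDiffAt ℝ ∞ (fun y => f ((extChartAt J x₀).symm y)) (extChartAt J x₀ x) := by
  have hli := (extChartAt J x₀).left_inv hx
  constructor
  · intro h
    have hs : ContMDiffAt 𝓘(ℝ, F) J ∞ (extChartAt J x₀).symm (extChartAt J x₀ x) :=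
      (contMDiffOn_extChartAt_symm x₀).contMDiffAt
        (extChartAt_target_mem_nhds_of_mem ((extChartAt J x₀).map_source hx))
    rw [← hli] at h
    exact (h.comp _ hs).contDiffAt
  · intro h
    have h1 := h.contMDiffAt.comp x
      (contMDiffAt_extChartAt' (I := J) (n := ∞) (by rwa [extChartAt_source] at hx))
    refine h1.congr_of_eventuallyEq ?_
    filter_upwards [(isOpen_extChartAt_source x₀).mem_nhds hx] with x' hx'
    exact congrArg f ((extChartAt J x₀).left_inv hx').symm

omit [J.Boundaryless] in
theorem mdifferentiableAt_of_comp_extChartAt_symm {E' : Type*} [NormedAddCommGroup E']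
    [NormedSpace ℝ E'] {f : N → E'} {x₀ x : N} (hx : x ∈ (extChartAt J x₀).source)
    (h : DifferentiableAt ℝ (fun y => f ((extChartAt J x₀).symm y)) (extChartAt J x₀ x)) :
    MDifferentiableAt J 𝓘(ℝ, E') f x := by
  have h1 := h.mdifferentiableAt.comp x (mdifferentiableAt_extChartAt_of_mem hx)
  refine h1.congr_of_eventuallyEq ?_
  filter_upwards [(isOpen_extChartAt_source x₀).mem_nhds hx] with x' hx'
  exact congrArg f ((extChartAt J x₀).left_inv hx').symm

/-- A vector field is smooth at a point if its coordinate expression in a chart is. -/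
theorem contMDiffAt_vectorField_iff {X : ∀ x : N, TangentSpace J x} {x₀ x : N}
    (hx : x ∈ (extChartAt J x₀).source) :
    ContMDiffAt J J.tangent ∞ (fun x => (⟨x, X x⟩ : TangentBundle J N)) x ↔
      ContDiffAt ℝ ∞ (vectorFieldInChart X x₀) (extChartAt J x₀ x) := by
  have hb : x ∈ (trivializationAt F (TangentSpace J) x₀).baseSet := by
    rwa [extChartAt_source] at hx
  rw [show (J.tangent) = J.prod 𝓘(ℝ, F) from rfl]
  refine (Trivialization.contMDiffAt_section_iff (IB := J) _ hb).trans ?_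
  have h1 : (fun x => (trivializationAt F (TangentSpace J) x₀ ⟨x, X x⟩).2) =ᶠ[𝓝 x]
      fun x => dChart J x₀ x (X x) := by
    filter_upwards [(isOpen_extChartAt_source x₀).mem_nhds hx] with x' hx'
    rw [extChartAt_source] at hx'
    have := TangentBundle.continuousLinearMapAt_trivializationAt (I := J) hx'
    have h2 := DFunLike.congr_fun this (X x')
    refine Eq.trans ?_ h2
    rw [Trivialization.continuousLinearMapAt_apply,
      Trivialization.coe_linearMapAt_of_mem _ (by exact hx')]
  rw [h1.contMDiffAt_iff, contMDiffAt_comp_extChartAt_symm_iff hx]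
  rfl

/-- The Lie bracket in the preferred chart. -/
theorem dChart_mlieBracket [CompleteSpace F] (V W : ∀ x : N, TangentSpace J x) (x : N) :
    dChart J x x (VectorField.mlieBracket J V W x) =
      fderiv ℝ (vectorFieldInChart W x) (extChartAt J x x)
          (vectorFieldInChart V x (extChartAt J x x))
        - fderiv ℝ (vectorFieldInChart V x) (extChartAt J x x)
          (vectorFieldInChart W x (extChartAt J x x)) := by
  have hx := mem_extChartAt_source (I := J) x
  have hev : ∀ V : ∀ x : N, TangentSpace J x,
      VectorField.mpullbackWithin 𝓘(ℝ, F) J (extChartAt J x).symm V (range J)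
        =ᶠ[𝓝 (extChartAt J x x)] vectorFieldInChart V x := by
    intro V
    filter_upwards [extChartAt_target_mem_nhds (I := J) x] with y hy
    rw [VectorField.mpullbackWithin_apply]
    have h := isInvertible_mfderivWithin_extChartAt_symm hy
    refine (h.inverse_apply_eq).2 ?_
    exact (DFunLike.congr_fun (mfderivWithin_extChartAt_symm_comp_mfderiv_extChartAt hy)
      (V ((extChartAt J x).symm y))).symm
  have hinv := isInvertible_mfderiv_extChartAt (I := J) hx
  have h1 : dChart J x x (VectorField.mlieBracket J V W x) = VectorField.lieBracketWithin ℝ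
      (VectorField.mpullbackWithin 𝓘(ℝ, F) J (extChartAt J x).symm V (range J))
      (VectorField.mpullbackWithin 𝓘(ℝ, F) J (extChartAt J x).symm W (range J))
      ((extChartAt J x).symm ⁻¹' univ ∩ range J) (extChartAt J x x) := by
    rw [← VectorField.mlieBracketWithin_univ, VectorField.mlieBracketWithin_apply]
    exact ((hinv.inverse_apply_eq).1 rfl).symm
  have h2 : ∀ (A B : F → F) (s : Set F), s = univ →
      A =ᶠ[𝓝 (extChartAt J x x)] vectorFieldInChart V x →
      B =ᶠ[𝓝 (extChartAt J x x)] vectorFieldInChart W x →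
      VectorField.lieBracketWithin ℝ A B s (extChartAt J x x) =
        VectorField.lieBracket ℝ (vectorFieldInChart V x) (vectorFieldInChart W x)
          (extChartAt J x x) := by
    rintro A B _ rfl hA hB
    rw [VectorField.lieBracketWithin_univ, hA.lieBracket_vectorField_eq hB]
  exact h1.trans (h2 _ _ _ (by simp [J.range_eq_univ]) (hev V) (hev W))

end VectorFields

/-! ### Local sections of submersions -/

section LocalSection

/-- A smooth map whose differential is onto has a smooth local right inverse. -/
theorem exists_contDiffAt_rightInverse {E F : Type*} [NormedAddCommGroup E] [NormedSpace ℝ E]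
    [CompleteSpace E] [NormedAddCommGroup F] [NormedSpace ℝ F] [FiniteDimensional ℝ F]
    {f : E → F} {x : E} (hf : ContDiffAt ℝ ∞ f x) (hsurj : Function.Surjective (fderiv ℝ f x)) :
    ∃ g : F → E, ContDiffAt ℝ ∞ g (f x) ∧ g (f x) = x ∧ ∀ᶠ y in 𝓝 (f x), f (g y) = y := by
  have hF : CompleteSpace F := FiniteDimensional.complete ℝ F
  obtain ⟨A, hA⟩ := (fderiv ℝ f x).toLinearMap.exists_rightInverse_of_surjective
    (LinearMap.range_eq_top.2 hsurj)
  let A' : F →L[ℝ] E := LinearMap.toContinuousLinearMap A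
  -- On the affine slice x + A u, with A a right inverse of the differential, f has derivative the
  -- identity, so the inverse function theorem applies.
  let ψ : F → E := fun u => x + A' u
  have hψ : ContDiff ℝ ∞ ψ := contDiff_const.add A'.contDiff
  have hψ0 : ψ 0 = x := by simp [ψ]
  have hfψ : ContDiffAt ℝ ∞ (f ∘ ψ) 0 := by
    refine ContDiffAt.comp 0 ?_ hψ.contDiffAt
    rwa [hψ0]
  have hd : HasFDerivAt (f ∘ ψ) ((ContinuousLinearEquiv.refl ℝ F : F ≃L[ℝ] F) : F →L[ℝ] F) 0 := by
    have h1 : HasFDerivAt ψ A' 0 := A'.hasFDerivAt.const_add x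
    have h2 : HasFDerivAt f (fderiv ℝ f x) (ψ 0) := by
      rw [hψ0]; exact (hf.differentiableAt (by simp)).hasFDerivAt
    have h3 := h2.comp 0 h1
    convert h3 using 1
    ext v
    exact (DFunLike.congr_fun hA v).symm
  have hne : (∞ : WithTop ℕ∞) ≠ 0 := by simp
  have hval : (f ∘ ψ) 0 = f x := by simp [hψ0]
  refine ⟨ψ ∘ hfψ.localInverse hd hne, ?_, ?_, ?_⟩
  · have h1 := hfψ.to_localInverse hd hne
    rw [hval] at h1
    exact hψ.contDiffAt.comp _ h1
  · have h1 := hfψ.localInverse_apply_image hd hne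
    rw [hval] at h1
    simp only [Function.comp]
    rw [h1, hψ0]
  · have h1 := (hfψ.hasStrictFDerivAt' hd hne).eventually_right_inverse
    rw [hval] at h1
    exact h1

end LocalSection

/-! ### The horizontal lift in coordinates -/

namespace ChaplyginSystem

section HorizontalLift

variable {n r k : ℕ} {Q S G : Type*}
  [TopologicalSpace Q] [ChartedSpace (Eu n) Q] [IsManifold (𝓡 n) ∞ Q]
  [TopologicalSpace S] [ChartedSpace (Eu r) S] [IsManifold (𝓡 r) ∞ S]
  [TopologicalSpace G] [ChartedSpace (Eu k) G] [Group G] [LieGroup (𝓡 k) ∞ G]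
  [MulAction G Q] (C : ChaplyginSystem n r k Q S G)

/-- The points of `Q` over the domain of the chart of `S` around `s₀`. -/
def shapeDomain (s₀ : S) : Set Q := C.pr ⁻¹' (extChartAt (𝓡 r) s₀).source

theorem isOpen_shapeDomain (s₀ : S) : IsOpen (C.shapeDomain s₀) :=
  (isOpen_extChartAt_source s₀).preimage C.pr_smooth.continuous

/-- The coordinates around `s₀` of the shape `π(q)`. -/
noncomputable def shapeCoord (s₀ : S) (q : Q) : Eu r := extChartAt (𝓡 r) s₀ (C.pr q)

/-- The differential of the shape coordinates. -/
noncomputable def dShape (s₀ : S) (q : Q) : TangentSpace (𝓡 n) q →L[ℝ] Eu r :=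
  (dChart (𝓡 r) s₀ (C.pr q)).comp (mfderiv (𝓡 n) (𝓡 r) C.pr q)

/-- The horizontal lift of the vectors with constant coordinates around `s₀`. -/
noncomputable def horC (s₀ : S) (q : Q) : Eu r →L[ℝ] TangentSpace (𝓡 n) q :=
  LinearMap.toContinuousLinearMap ((C.D q).subtype ∘ₗ (C.horLift q).toLinearMap ∘ₗ
    (dChartInv (𝓡 r) s₀ (C.pr q)).toLinearMap)

theorem horC_apply (s₀ : S) (q : Q) (w : Eu r) :
    C.horC s₀ q w = C.horLift q (dChartInv (𝓡 r) s₀ (C.pr q) w) := rfl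

theorem horC_mem_D (s₀ : S) (q : Q) (w : Eu r) : C.horC s₀ q w ∈ C.D q :=
  (C.horLift q (dChartInv (𝓡 r) s₀ (C.pr q) w)).2

theorem tangentD_horLift (q : Q) (v : TangentSpace (𝓡 r) (C.pr q)) :
    C.tangentD q (C.horLift q v) = v :=
  (LinearEquiv.ofBijective (C.tangentD q) (C.tangentD_bijective q)).apply_symm_apply v

theorem horLift_tangentD (q : Q) (v : C.D q) : C.horLift q (C.tangentD q v) = v :=
  (LinearEquiv.ofBijective (C.tangentD q) (C.tangentD_bijective q)).symm_apply_apply v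

variable {C} in
theorem dShape_horC {s₀ : S} {q : Q} (hq : q ∈ C.shapeDomain s₀) (w : Eu r) :
    C.dShape s₀ q (C.horC s₀ q w) = w := by
  have h := C.tangentD_horLift q (dChartInv (𝓡 r) s₀ (C.pr q) w)
  exact (congrArg (dChart (𝓡 r) s₀ (C.pr q)) h).trans (dChart_dChartInv hq w)

variable {C} in
theorem horC_dShape {s₀ : S} {q : Q} (hq : q ∈ C.shapeDomain s₀) {v : TangentSpace (𝓡 n) q}
    (hv : v ∈ C.D q) : C.horC s₀ q (C.dShape s₀ q v) = v := by
  have h := C.horLift_tangentD q ⟨v, hv⟩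
  rw [horC_apply]
  refine Eq.trans ?_ (congrArg Subtype.val h)
  congr 2
  exact dChartInv_dChart hq _

variable {C} in
-- T_q π is injective on D_q. Identities between horizontal vectors can therefore be checked on
-- their shape coordinates alone; the smoothness and the equivariance of the horizontal lift are
-- both proved in this way.
theorem eq_of_mem_D_of_dShape_eq {s₀ : S} {q : Q} (hq : q ∈ C.shapeDomain s₀)
    {v w : TangentSpace (𝓡 n) q} (hv : v ∈ C.D q) (hw : w ∈ C.D q)
    (h : C.dShape s₀ q v = C.dShape s₀ q w) : v = w := by
  rw [← horC_dShape hq hv, h, horC_dShape hq hw]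

variable {C} in
theorem contMDiffAt_shapeCoord {s₀ : S} {q : Q} (hq : q ∈ C.shapeDomain s₀) :
    ContMDiffAt (𝓡 n) 𝓘(ℝ, Eu r) ∞ (C.shapeCoord s₀) q :=
  (contMDiffAt_extChartAt' (I := 𝓡 r) (n := ∞) (x := s₀) (x' := C.pr q)
    (by rw [← extChartAt_source (𝓡 r)]; exact hq)).comp q (C.pr_smooth q)

variable {C} in
theorem mfderiv_shapeCoord {s₀ : S} {q : Q} (hq : q ∈ C.shapeDomain s₀)
    (v : TangentSpace (𝓡 n) q) :
    (mfderiv (𝓡 n) 𝓘(ℝ, Eu r) (C.shapeCoord s₀) q v : Eu r) = C.dShape s₀ q v := by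
  have h := mfderiv_comp q (mdifferentiableAt_extChartAt_of_mem hq)
    ((C.pr_smooth q).mdifferentiableAt (by simp))
  exact DFunLike.congr_fun h v

variable {C} in
theorem fderiv_shapeCoord_inChart {s₀ : S} {q₀ q : Q} (hq : q ∈ C.shapeDomain s₀)
    (hq₀ : q ∈ (extChartAt (𝓡 n) q₀).source) (v : TangentSpace (𝓡 n) q) :
    fderiv ℝ (fun x => C.shapeCoord s₀ ((extChartAt (𝓡 n) q₀).symm x)) (extChartAt (𝓡 n) q₀ q)
      (dChart (𝓡 n) q₀ q v) = C.dShape s₀ q v := by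
  rw [← mfderiv_shapeCoord hq]
  exact (mfderiv_eq_fderiv_dChart hq₀
    ((contMDiffAt_shapeCoord hq).mdifferentiableAt (by simp)) v).symm

/-- The horizontal lift in coordinates around `s₀` and `q₀`. -/
noncomputable def horCoord (s₀ : S) (q₀ : Q) (x : Eu n) : Eu r →L[ℝ] Eu n :=
  (dChart (𝓡 n) q₀ ((extChartAt (𝓡 n) q₀).symm x)).comp
    (C.horC s₀ ((extChartAt (𝓡 n) q₀).symm x))

variable {C} in
-- Take a smooth local frame Z of D. Since Tπ restricted to D is an isomorphism, the matrix B of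
-- shape velocities of the frame is invertible, and the horizontal lift is Z ∘ B⁻¹, which is smooth
-- because inversion of linear maps is.
theorem contDiffAt_horCoord {s₀ : S} {q₀ q : Q} (hq : q ∈ C.shapeDomain s₀)
    (hq₀ : q ∈ (extChartAt (𝓡 n) q₀).source) :
    ContDiffAt ℝ ∞ (C.horCoord s₀ q₀) (extChartAt (𝓡 n) q₀ q) := by
  obtain ⟨O, hO, hqO, Z, hZ, hD⟩ := C.D_smooth q
  set e := extChartAt (𝓡 n) q₀ with he
  have hli : e.symm (e q) = q := e.left_inv hq₀
  have hyt := e.map_source hq₀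
  let Zc : Eu n → Eu r →L[ℝ] Eu n := fun x =>
    ∑ j, (EuclideanSpace.proj j : Eu r →L[ℝ] ℝ).smulRight (vectorFieldInChart (Z j) q₀ x)
  have hZc : ContDiffAt ℝ ∞ Zc (e q) := by
    refine ContDiffAt.sum fun j _ => ?_
    have h1 : ContDiffAt ℝ ∞ (vectorFieldInChart (Z j) q₀) (e q) :=
      (contMDiffAt_vectorField_iff hq₀).1 ((hZ j).contMDiffAt (hO.mem_nhds hqO))
    exact contDiffAt_const.smulRight h1
  let u : Eu n → Eu r := fun x => C.shapeCoord s₀ (e.symm x)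
  have hu : ContDiffAt ℝ ∞ u (e q) :=
    (contMDiffAt_comp_extChartAt_symm_iff hq₀).1 (contMDiffAt_shapeCoord hq)
  let B : Eu n → Eu r →L[ℝ] Eu r := fun x => (fderiv ℝ u x).comp (Zc x)
  have hB : ContDiffAt ℝ ∞ B (e q) :=
    (hu.fderiv_right (m := ∞) (by simp)).clm_comp hZc
  have hsymm : ContinuousAt e.symm (e q) :=
    (mdifferentiableAt_extChartAt_symm hyt).continuousAt
  have hnear : ∀ᶠ x in 𝓝 (e q), x ∈ e.target ∧ e.symm x ∈ O ∧ e.symm x ∈ C.shapeDomain s₀ := by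
    refine Filter.Eventually.and (extChartAt_target_mem_nhds_of_mem hyt)
      ((hsymm.eventually_mem ?_).and (hsymm.eventually_mem ?_))
    · rw [hli]; exact hO.mem_nhds hqO
    · rw [hli]; exact (C.isOpen_shapeDomain s₀).mem_nhds hq
  have hZapp : ∀ x c, Zc x c = dChart (𝓡 n) q₀ (e.symm x) (∑ j, c j • Z j (e.symm x)) := by
    intro x c
    simp only [Zc, sum_apply, ContinuousLinearMap.smulRight_apply, map_sum, map_smul]
    rfl
  have hBapp : ∀ x, x ∈ e.target → e.symm x ∈ C.shapeDomain s₀ → ∀ c,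
      B x c = C.dShape s₀ (e.symm x) (∑ j, c j • Z j (e.symm x)) := by
    intro x hx hd c
    have h := fderiv_shapeCoord_inChart (q₀ := q₀) hd (e.map_target hx)
      (∑ j, c j • Z j (e.symm x))
    rw [← he, e.right_inv hx] at h
    rw [← h, ← hZapp]
    rfl
  have hinv : ∀ x, x ∈ e.target → e.symm x ∈ O → e.symm x ∈ C.shapeDomain s₀ →
      (B x).IsInvertible := by
    intro x hx hO hd
    have hs : Function.Surjective (B x) := by
      intro w
      have h1 := C.horC_mem_D s₀ (e.symm x) w
      rw [hD _ hO, Submodule.mem_span_range_iff_exists_fun] at h1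
      obtain ⟨c, hc⟩ := h1
      refine ⟨WithLp.toLp 2 c, ?_⟩
      rw [hBapp x hx hd]
      refine (congrArg _ hc).trans (dShape_horC hd w)
    have hi : Function.Injective (B x) :=
      LinearMap.injective_iff_surjective (f := (B x).toLinearMap).2 hs
    exact ⟨(LinearEquiv.ofBijective (B x).toLinearMap ⟨hi, hs⟩).toContinuousLinearEquiv, by
      ext; rfl⟩
  have hev : C.horCoord s₀ q₀ =ᶠ[𝓝 (e q)] fun x => (Zc x).comp (B x).inverse := by
    filter_upwards [hnear] with x ⟨hx, hxO, hd⟩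
    ext1 w
    have hB' := hinv x hx hxO hd
    have h1 : B x ((B x).inverse w) = w := (hB'.inverse_apply_eq.1 rfl).symm
    rw [ContinuousLinearMap.comp_apply, hZapp]
    change dChart (𝓡 n) q₀ (e.symm x) (C.horC s₀ (e.symm x) w) = _
    congr 1
    refine eq_of_mem_D_of_dShape_eq hd (C.horC_mem_D _ _ _) ?_ ?_
    · rw [hD _ hxO]
      exact Submodule.sum_mem _ fun j _ => Submodule.smul_mem _ _ (Submodule.subset_span ⟨j, rfl⟩)
    · rw [dShape_horC hd, ← hBapp x hx hd, h1]
  refine ContDiffAt.congr_of_eventuallyEq ?_ hev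
  have hB0 : (B (e q)).IsInvertible := by
    refine hinv _ hyt ?_ ?_ <;> rwa [hli]
  exact hZc.clm_comp ((hB0.contDiffAt_map_inverse).comp _ hB)

variable {C} in
theorem contMDiffAt_horC {s₀ : S} {q : Q} (hq : q ∈ C.shapeDomain s₀) (w : Eu r) :
    ContMDiffAt (𝓡 n) (𝓡 n).tangent ∞
      (fun q => (⟨q, C.horC s₀ q w⟩ : TangentBundle (𝓡 n) Q)) q := by
  have hx := mem_extChartAt_source (I := 𝓡 n) q
  rw [contMDiffAt_vectorField_iff hx]
  exact (contDiffAt_horCoord hq hx).clm_apply contDiffAt_const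

end HorizontalLift

end ChaplyginSystem

/-! ### Invariance under the symmetry group -/

namespace ChaplyginSystem

section Invariance

variable {n r k : ℕ} {Q S G : Type*}
  [TopologicalSpace Q] [ChartedSpace (Eu n) Q] [IsManifold (𝓡 n) ∞ Q]
  [TopologicalSpace S] [ChartedSpace (Eu r) S] [IsManifold (𝓡 r) ∞ S]
  [TopologicalSpace G] [ChartedSpace (Eu k) G] [Group G] [LieGroup (𝓡 k) ∞ G]
  [MulAction G Q] (C : ChaplyginSystem n r k Q S G)

include C in
theorem contMDiff_smul_const (g : G) : ContMDiff (𝓡 n) (𝓡 n) ∞ (fun q : Q => g • q) := by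
  have := C.action_smooth
  exact (contMDiff_smul (I := 𝓡 k) (I' := 𝓡 n) (n := ∞)).comp
    ((contMDiff_const (c := g)).prodMk contMDiff_id)

theorem pr_smul (g : G) (q : Q) : C.pr (g • q) = C.pr q :=
  ((C.pr_fibre q (g • q)).2 ⟨g, rfl⟩).symm

variable {C} in
theorem smul_mem_shapeDomain {s₀ : S} {q : Q} (hq : q ∈ C.shapeDomain s₀) (g : G) :
    g • q ∈ C.shapeDomain s₀ := by
  rw [shapeDomain, mem_preimage, C.pr_smul]
  exact hq

variable {C} in
theorem dShape_mfderiv_smul {s₀ : S} {q : Q} (hq : q ∈ C.shapeDomain s₀) (g : G)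
    (v : TangentSpace (𝓡 n) q) :
    C.dShape s₀ (g • q) (mfderiv (𝓡 n) (𝓡 n) (fun x : Q => g • x) q v) = C.dShape s₀ q v := by
  have hgq := smul_mem_shapeDomain hq g
  have h := mfderiv_comp q ((contMDiffAt_shapeCoord hgq).mdifferentiableAt (by simp))
    ((C.contMDiff_smul_const g).mdifferentiable (by simp) q)
  have hfun : (C.shapeCoord s₀ ∘ fun x : Q => g • x) = C.shapeCoord s₀ := by
    funext x
    exact congrArg (extChartAt (𝓡 r) s₀) (C.pr_smul g x)
  rw [hfun] at h
  rw [← mfderiv_shapeCoord hq, ← mfderiv_shapeCoord hgq]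
  exact (DFunLike.congr_fun h v).symm

variable {C} in
/-- The horizontal lift is equivariant. -/
theorem mfderiv_smul_horC {s₀ : S} {q : Q} (hq : q ∈ C.shapeDomain s₀) (g : G) (w : Eu r) :
    mfderiv (𝓡 n) (𝓡 n) (fun x : Q => g • x) q (C.horC s₀ q w) = C.horC s₀ (g • q) w := by
  have hgq := smul_mem_shapeDomain hq g
  refine eq_of_mem_D_of_dShape_eq hgq ?_ (C.horC_mem_D _ _ _) ?_
  · rw [← C.D_invariant]
    exact ⟨_, C.horC_mem_D _ _ _, rfl⟩
  · rw [dShape_mfderiv_smul hq, dShape_horC hq, dShape_horC hgq]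

include C in
theorem isInvertible_mfderiv_smul (g : G) (q : Q) :
    (mfderiv (𝓡 n) (𝓡 n) (fun x : Q => g • x) q).IsInvertible := by
  have hd : ∀ (g : G) (q : Q), MDifferentiableAt (𝓡 n) (𝓡 n) (fun x : Q => g • x) q :=
    fun g q => (C.contMDiff_smul_const g).mdifferentiable (by simp) q
  have hcomp : ∀ (g : G) (q : Q) (v : TangentSpace (𝓡 n) q),
      (mfderiv (𝓡 n) (𝓡 n) (fun x : Q => g⁻¹ • x) (g • q)
        (mfderiv (𝓡 n) (𝓡 n) (fun x : Q => g • x) q v) : Eu n) = v := by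
    intro g q v
    have h := mfderiv_comp q (hd g⁻¹ (g • q)) (hd g q)
    have hfun : ((fun x : Q => g⁻¹ • x) ∘ fun x : Q => g • x) = id := by
      funext x
      simp
    rw [hfun, mfderiv_id] at h
    exact (DFunLike.congr_fun h v).symm
  have hi : Function.Injective (mfderiv (𝓡 n) (𝓡 n) (fun x : Q => g • x) q) := by
    intro v w h
    have h2 := congrArg (mfderiv (𝓡 n) (𝓡 n) (fun x : Q => g⁻¹ • x) (g • q)) h
    exact (hcomp g q v).symm.trans (h2.trans (hcomp g q w))
  have hs : Function.Surjective (mfderiv (𝓡 n) (𝓡 n) (fun x : Q => g • x) q) :=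
    LinearMap.injective_iff_surjective_of_finrank_eq_finrank
      (f := (mfderiv (𝓡 n) (𝓡 n) (fun x : Q => g • x) q).toLinearMap)
      (by rw [finrank_tangentEu, finrank_tangentEu]) |>.1 hi
  exact ⟨(LinearEquiv.ofBijective (mfderiv (𝓡 n) (𝓡 n) (fun x : Q => g • x) q).toLinearMap
    ⟨hi, hs⟩).toContinuousLinearEquiv, by ext; rfl⟩

/-- The bracket of the horizontal lifts of two coordinate fields. -/
noncomputable def horBracket (s₀ : S) (w u : Eu r) (q : Q) : TangentSpace (𝓡 n) q :=
  VectorField.mlieBracket (𝓡 n) (fun q => C.horC s₀ q w) (fun q => C.horC s₀ q u) q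

variable {C} in
-- Translations by G preserve the horizontal lifts near q, and Lie brackets are natural under local
-- diffeomorphisms.
theorem mfderiv_smul_horBracket {s₀ : S} {q : Q} (hq : q ∈ C.shapeDomain s₀) (g : G)
    (w u : Eu r) :
    mfderiv (𝓡 n) (𝓡 n) (fun x : Q => g • x) q (C.horBracket s₀ w u q) =
      C.horBracket s₀ w u (g • q) := by
  have hgq := smul_mem_shapeDomain hq g
  have hmd : ∀ w : Eu r, MDifferentiableAt (𝓡 n) (𝓡 n).tangent
      (fun q => (⟨q, C.horC s₀ q w⟩ : TangentBundle (𝓡 n) Q)) (g • q) := fun w =>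
    (contMDiffAt_horC hgq w).mdifferentiableAt (by simp)
  have hmin : IsManifold (𝓡 n) (minSmoothness ℝ 3) Q := by
    rw [minSmoothness_of_isRCLikeNormedField]
    infer_instance
  have h := VectorField.mpullback_mlieBracket (n := ∞) (hmd w) (hmd u)
    (C.contMDiff_smul_const g q) (by simp; norm_cast)
  have hev : ∀ w : Eu r, VectorField.mpullback (𝓡 n) (𝓡 n) (fun x : Q => g • x)
      (fun q => C.horC s₀ q w) =ᶠ[𝓝 q] fun q => C.horC s₀ q w := by
    intro w
    filter_upwards [(C.isOpen_shapeDomain s₀).mem_nhds hq] with x hx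
    exact (C.isInvertible_mfderiv_smul g x).inverse_apply_eq.2 (mfderiv_smul_horC hx g w).symm
  exact ((C.isInvertible_mfderiv_smul g q).inverse_apply_eq.1
    (h.trans ((hev w).mlieBracket_vectorField_eq (hev u)))).symm

variable {C} in
theorem contMDiffAt_horBracket {s₀ : S} {q : Q} (hq : q ∈ C.shapeDomain s₀) (w u : Eu r) :
    ContMDiffAt (𝓡 n) (𝓡 n).tangent ∞
      (fun q => (⟨q, C.horBracket s₀ w u q⟩ : TangentBundle (𝓡 n) Q)) q := by
  have : IsManifold (𝓡 n) (((⊤ : ℕ∞) : WithTop ℕ∞) + 1) Q := by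
    change IsManifold (𝓡 n) ∞ Q
    infer_instance
  have hmin : IsManifold (𝓡 n) (minSmoothness ℝ 2) Q := by
    rw [minSmoothness_of_isRCLikeNormedField]
    infer_instance
  exact ContMDiffAt.mlieBracket_vectorField (m := ⊤) (n := ⊤) (contMDiffAt_horC hq w)
    (contMDiffAt_horC hq u) (by simp)

theorem contMDiffAt_metric_apply {V W : ∀ q : Q, TangentSpace (𝓡 n) q} {q : Q}
    (hV : ContMDiffAt (𝓡 n) (𝓡 n).tangent ∞ (fun q => (⟨q, V q⟩ : TangentBundle (𝓡 n) Q)) q)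
    (hW : ContMDiffAt (𝓡 n) (𝓡 n).tangent ∞ (fun q => (⟨q, W q⟩ : TangentBundle (𝓡 n) Q)) q) :
    ContMDiffAt (𝓡 n) 𝓘(ℝ, ℝ) ∞ (fun q => C.metric.inner q (V q) (W q)) q := by
  have h : ContMDiffAt (𝓡 n) ((𝓡 n).prod 𝓘(ℝ)) ∞
      (fun m ↦ TotalSpace.mk' ℝ (E := Bundle.Trivial Q ℝ) m (C.metric.inner m (V m) (W m))) q :=
    ContMDiffAt.clm_bundle_apply₂ (F₁ := Eu n) (F₂ := Eu n) (C.metric.contMDiff q) hV hW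
  simp only [contMDiffAt_totalSpace] at h
  exact h.2

end Invariance

end ChaplyginSystem

/-! ### The coordinate expressions of the reduced data -/

namespace ChaplyginSystem

section ReducedData

variable {n r k : ℕ} {Q S G : Type*}
  [TopologicalSpace Q] [ChartedSpace (Eu n) Q] [IsManifold (𝓡 n) ∞ Q]
  [TopologicalSpace S] [ChartedSpace (Eu r) S] [IsManifold (𝓡 r) ∞ S]
  [TopologicalSpace G] [ChartedSpace (Eu k) G] [Group G] [LieGroup (𝓡 k) ∞ G]
  [MulAction G Q] (C : ChaplyginSystem n r k Q S G)

/-- A point of `Q` over the point with coordinates `y` around `s₀`. -/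
noncomputable def basePoint (s₀ : S) (y : Eu r) : Q := C.point ((extChartAt (𝓡 r) s₀).symm y)

theorem pr_basePoint (s₀ : S) (y : Eu r) :
    C.pr (C.basePoint s₀ y) = (extChartAt (𝓡 r) s₀).symm y := C.pr_point _

variable {C} in
theorem basePoint_mem_shapeDomain {s₀ : S} {y : Eu r} (hy : y ∈ (extChartAt (𝓡 r) s₀).target) :
    C.basePoint s₀ y ∈ C.shapeDomain s₀ := by
  rw [shapeDomain, mem_preimage, pr_basePoint]
  exact (extChartAt (𝓡 r) s₀).map_target hy

variable {C} in
theorem shapeCoord_basePoint {s₀ : S} {y : Eu r} (hy : y ∈ (extChartAt (𝓡 r) s₀).target) :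
    C.shapeCoord s₀ (C.basePoint s₀ y) = y := by
  rw [shapeCoord, pr_basePoint, (extChartAt (𝓡 r) s₀).right_inv hy]

variable {C} in
theorem basePoint_shapeCoord {s₀ : S} {q : Q} (hq : q ∈ C.shapeDomain s₀) :
    ∃ g : G, g • q = C.basePoint s₀ (C.shapeCoord s₀ q) := by
  rw [← C.pr_fibre, pr_basePoint]
  exact ((extChartAt (𝓡 r) s₀).left_inv hq).symm

variable {C} in
theorem apply_basePoint_shapeCoord {A : Type*} {s₀ : S} {f : Q → A}
    (hf : ∀ q ∈ C.shapeDomain s₀, ∀ g : G, f (g • q) = f q) {q : Q} (hq : q ∈ C.shapeDomain s₀) :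
    f (C.basePoint s₀ (C.shapeCoord s₀ q)) = f q := by
  obtain ⟨g, hg⟩ := basePoint_shapeCoord hq
  rw [← hg, hf q hq]

variable {C} in
/-- Smooth invariant functions descend to smooth functions of the shape coordinates. -/
theorem contDiffAt_comp_basePoint {s₀ : S} {f : Q → ℝ}
    (hf : ∀ q ∈ C.shapeDomain s₀, ∀ g : G, f (g • q) = f q)
    (hs : ∀ q ∈ C.shapeDomain s₀, ContMDiffAt (𝓡 n) 𝓘(ℝ, ℝ) ∞ f q) {y : Eu r}
    (hy : y ∈ (extChartAt (𝓡 r) s₀).target) :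
    ContDiffAt ℝ ∞ (fun y => f (C.basePoint s₀ y)) y := by
  have hq := basePoint_mem_shapeDomain (C := C) hy
  have hqy := shapeCoord_basePoint (C := C) hy
  set q := C.basePoint s₀ y
  have hx := mem_extChartAt_source (I := 𝓡 n) q
  set e := extChartAt (𝓡 n) q
  have hli : e.symm (e q) = q := e.left_inv hx
  have hu : ContDiffAt ℝ ∞ (fun x => C.shapeCoord s₀ (e.symm x)) (e q) :=
    (contMDiffAt_comp_extChartAt_symm_iff hx).1 (contMDiffAt_shapeCoord hq)
  have hsurj : Function.Surjective (fderiv ℝ (fun x => C.shapeCoord s₀ (e.symm x)) (e q)) :=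
    fun w => ⟨_, (fderiv_shapeCoord_inChart hq hx (C.horC s₀ q w)).trans (dShape_horC hq w)⟩
  -- `basePoint` is an arbitrary choice and need not vary continuously. Near y it is replaced by a
  -- smooth local section of the submersion; the two points lie on the same orbit, so the invariant
  -- f has the same value at both.
  obtain ⟨τ, hτ, hτ0, hτr⟩ := exists_contDiffAt_rightInverse hu hsurj
  have huq : C.shapeCoord s₀ (e.symm (e q)) = y := by rw [hli, hqy]
  rw [huq] at hτ hτ0 hτr
  have hfe : ContDiffAt ℝ ∞ (fun x => f (e.symm x)) (e q) :=
    (contMDiffAt_comp_extChartAt_symm_iff hx).1 (hs q hq)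
  have hcomp : ContDiffAt ℝ ∞ (fun y => f (e.symm (τ y))) y := by
    rw [← hτ0] at hfe
    exact hfe.comp y hτ
  refine hcomp.congr_of_eventuallyEq ?_
  have hcont : ContinuousAt (fun y => e.symm (τ y)) y := by
    have h1 : ContinuousAt e.symm (τ y) := by
      rw [hτ0]
      exact (mdifferentiableAt_extChartAt_symm (e.map_source hx)).continuousAt
    exact ContinuousAt.comp (f := τ) h1 hτ.continuousAt
  have hdom : ∀ᶠ y' in 𝓝 y, e.symm (τ y') ∈ C.shapeDomain s₀ := by
    refine hcont.eventually_mem ?_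
    rw [hτ0, hli]
    exact (C.isOpen_shapeDomain s₀).mem_nhds hq
  filter_upwards [hdom, hτr] with y' hd hr
  rw [← apply_basePoint_shapeCoord hf hd, hr]

/-! #### The reduced metric -/

/-- The metric on horizontal lifts. -/
noncomputable def metricK (s₀ : S) (q : Q) : Eu r →L[ℝ] Eu r →L[ℝ] ℝ :=
  LinearMap.toContinuousLinearMap
    { toFun := fun w => (C.metric.inner q (C.horC s₀ q w)).comp (C.horC s₀ q)
      map_add' := fun _ _ => by simp
      map_smul' := fun _ _ => by simp }

theorem metricK_apply (s₀ : S) (q : Q) (w u : Eu r) :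
    C.metricK s₀ q w u = C.metric.inner q (C.horC s₀ q w) (C.horC s₀ q u) := rfl

theorem metricK_symm (s₀ : S) (q : Q) (w u : Eu r) :
    C.metricK s₀ q w u = C.metricK s₀ q u w := C.metric.symm _ _ _

variable {C} in
theorem metricK_injective {s₀ : S} {q : Q} (hq : q ∈ C.shapeDomain s₀) :
    Function.Injective (C.metricK s₀ q) := by
  rw [injective_iff_map_eq_zero]
  intro w hw
  by_contra h
  have h1 : C.horC s₀ q w ≠ 0 := fun h0 => h (by rw [← dShape_horC hq w, h0, map_zero])
  have h2 := C.metric.pos q _ h1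
  rw [← metricK_apply, hw] at h2
  exact lt_irrefl _ h2

variable {C} in
theorem isInvertible_metricK {s₀ : S} {q : Q} (hq : q ∈ C.shapeDomain s₀) :
    (C.metricK s₀ q).IsInvertible := by
  have hfr : Module.finrank ℝ (Eu r) = Module.finrank ℝ (Eu r →L[ℝ] ℝ) := by
    rw [← LinearMap.toContinuousLinearMap.finrank_eq, Module.finrank_linearMap]
    simp
  have hi := metricK_injective hq
  have hs : Function.Surjective (C.metricK s₀ q) :=
    (LinearMap.injective_iff_surjective_of_finrank_eq_finrank
      (f := (C.metricK s₀ q).toLinearMap) hfr).1 hi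
  exact ⟨(LinearEquiv.ofBijective (C.metricK s₀ q).toLinearMap
    ⟨hi, hs⟩).toContinuousLinearEquiv, by ext; rfl⟩

variable {C} in
theorem metricK_smul {s₀ : S} {q : Q} (hq : q ∈ C.shapeDomain s₀) (g : G) :
    C.metricK s₀ (g • q) = C.metricK s₀ q := by
  ext1 w
  ext1 u
  rw [metricK_apply, metricK_apply, ← mfderiv_smul_horC hq, ← mfderiv_smul_horC hq,
    C.metric_invariant]

/-- The inverse of the reduced metric. -/
noncomputable def cometric (s₀ : S) (y : Eu r) : (Eu r →L[ℝ] ℝ) →L[ℝ] Eu r :=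
  (C.metricK s₀ (C.basePoint s₀ y)).inverse

variable {C} in
theorem cometric_shapeCoord {s₀ : S} {q : Q} (hq : q ∈ C.shapeDomain s₀) :
    C.cometric s₀ (C.shapeCoord s₀ q) = (C.metricK s₀ q).inverse :=
  apply_basePoint_shapeCoord (f := fun q => (C.metricK s₀ q).inverse)
    (fun q hq g => by rw [metricK_smul hq]) hq

variable {C} in
theorem metricK_cometric {s₀ : S} {q : Q} (hq : q ∈ C.shapeDomain s₀) (ξ : Eu r →L[ℝ] ℝ) :
    C.metricK s₀ q (C.cometric s₀ (C.shapeCoord s₀ q) ξ) = ξ := by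
  rw [cometric_shapeCoord hq]
  exact ((isInvertible_metricK hq).inverse_apply_eq.1 rfl).symm

variable {C} in
theorem cometric_metricK {s₀ : S} {q : Q} (hq : q ∈ C.shapeDomain s₀) (w : Eu r) :
    C.cometric s₀ (C.shapeCoord s₀ q) (C.metricK s₀ q w) = w := by
  rw [cometric_shapeCoord hq]
  exact (isInvertible_metricK hq).inverse_apply_eq.2 rfl

variable {C} in
theorem cometric_symm {s₀ : S} {y : Eu r} (hy : y ∈ (extChartAt (𝓡 r) s₀).target)
    (ξ η : Eu r →L[ℝ] ℝ) : ξ (C.cometric s₀ y η) = η (C.cometric s₀ y ξ) := by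
  have hq := basePoint_mem_shapeDomain (C := C) hy
  have h := metricK_cometric hq
  rw [shapeCoord_basePoint hy] at h
  conv_lhs => rw [← h ξ]
  conv_rhs => rw [← h η]
  exact C.metricK_symm _ _ _ _

variable {C} in
theorem cometric_surjective {s₀ : S} {y : Eu r} (hy : y ∈ (extChartAt (𝓡 r) s₀).target) :
    Function.Surjective (C.cometric s₀ y) := by
  have hq := basePoint_mem_shapeDomain (C := C) hy
  intro w
  have h := cometric_metricK hq w
  rw [shapeCoord_basePoint hy] at h
  exact ⟨_, h⟩

variable {C} in
theorem contDiffOn_cometric (s₀ : S) :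
    ContDiffOn ℝ ∞ (C.cometric s₀) (extChartAt (𝓡 r) s₀).target := by
  have hK : ContDiffOn ℝ ∞ (fun y => C.metricK s₀ (C.basePoint s₀ y))
      (extChartAt (𝓡 r) s₀).target := by
    refine contDiffOn_clm_apply.2 fun w => contDiffOn_clm_apply.2 fun u => fun y hy => ?_
    refine (contDiffAt_comp_basePoint (f := fun q => C.metricK s₀ q w u)
      (fun q hq g => by rw [metricK_smul hq]) (fun q hq => ?_) hy).contDiffWithinAt
    exact C.contMDiffAt_metric_apply (contMDiffAt_horC hq w) (contMDiffAt_horC hq u)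
  intro y hy
  have h1 := (isInvertible_metricK (basePoint_mem_shapeDomain (C := C) hy)).contDiffAt_map_inverse
    (𝕜 := ℝ) (n := ∞)
  exact h1.comp_contDiffWithinAt y (hK y hy)

/-! #### The gyroscopic tensor -/

/-- The projection `T_q π ∘ P` in coordinates. -/
noncomputable def baseProj (s₀ : S) (q : Q) : TangentSpace (𝓡 n) q →L[ℝ] Eu r :=
  (C.dShape s₀ q).comp (LinearMap.toContinuousLinearMap ((C.D q).subtype ∘ₗ C.proj q))

theorem baseProj_apply (s₀ : S) (q : Q) (v : TangentSpace (𝓡 n) q) :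
    C.baseProj s₀ q v = C.dShape s₀ q (C.proj q v) := rfl

variable {C} in
theorem horC_baseProj {s₀ : S} {q : Q} (hq : q ∈ C.shapeDomain s₀) (v : TangentSpace (𝓡 n) q) :
    C.horC s₀ q (C.baseProj s₀ q v) = C.proj q v :=
  horC_dShape hq (C.proj q v).2

theorem inner_proj (q : Q) (v w : TangentSpace (𝓡 n) q) (hw : w ∈ C.D q) :
    C.metric.inner q (C.proj q v) w = C.metric.inner q v w := by
  have h1 : v - C.proj q v ∈ C.Dperp q := by
    rw [proj, ← Submodule.projectionOnto_apply_eq_zero_iff (C.isCompl_Dperp q)]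
    rw [map_sub, Submodule.projectionOnto_apply_left, sub_self]
  have h2 : C.metric.inner q w (v - C.proj q v) = 0 := h1 w hw
  have h3 : C.metric.inner q w (v - C.proj q v)
      = C.metric.inner q w v - C.metric.inner q w (C.proj q v) := map_sub _ _ _
  have h4 := C.metric.symm q w v
  have h5 := C.metric.symm q w (C.proj q v)
  exact (sub_eq_zero.1 (by rw [← h4, ← h5, ← h3, h2])).symm

variable {C} in
-- The projector is orthogonal, so it disappears from inner products with horizontal vectors.
-- Neither its smoothness nor its equivariance then has to be established separately.
theorem metricK_baseProj {s₀ : S} {q : Q} (hq : q ∈ C.shapeDomain s₀)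
    (v : TangentSpace (𝓡 n) q) (w : Eu r) :
    C.metricK s₀ q (C.baseProj s₀ q v) w = C.metric.inner q v (C.horC s₀ q w) := by
  rw [metricK_apply, horC_baseProj hq, C.inner_proj _ _ _ (C.horC_mem_D _ _ _)]

/-- The bracket of the horizontal lifts of two coordinate fields, in coordinates. -/
noncomputable def horBracketCoord (s₀ : S) (q : Q) : Eu r →L[ℝ] Eu r →L[ℝ] Eu n :=
  (fderiv ℝ (C.horCoord s₀ q) (extChartAt (𝓡 n) q q)).comp
      (C.horCoord s₀ q (extChartAt (𝓡 n) q q))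
    - ((fderiv ℝ (C.horCoord s₀ q) (extChartAt (𝓡 n) q q)).comp
      (C.horCoord s₀ q (extChartAt (𝓡 n) q q))).flip

theorem horBracketCoord_apply (s₀ : S) (q : Q) (w u : Eu r) :
    C.horBracketCoord s₀ q w u =
      fderiv ℝ (C.horCoord s₀ q) (extChartAt (𝓡 n) q q)
        (C.horCoord s₀ q (extChartAt (𝓡 n) q q) w) u
      - fderiv ℝ (C.horCoord s₀ q) (extChartAt (𝓡 n) q q)
        (C.horCoord s₀ q (extChartAt (𝓡 n) q q) u) w := rfl

theorem vectorFieldInChart_horC (s₀ : S) (q₀ : Q) (w : Eu r) :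
    vectorFieldInChart (fun q => C.horC s₀ q w) q₀ = fun x => C.horCoord s₀ q₀ x w := rfl

variable {C} in
theorem dChart_horBracket {s₀ : S} {q : Q} (hq : q ∈ C.shapeDomain s₀) (w u : Eu r) :
    dChart (𝓡 n) q q (C.horBracket s₀ w u q) = C.horBracketCoord s₀ q w u := by
  have hd : DifferentiableAt ℝ (C.horCoord s₀ q) (extChartAt (𝓡 n) q q) :=
    (contDiffAt_horCoord hq (mem_extChartAt_source q)).differentiableAt (by simp)
  rw [horBracket, dChart_mlieBracket, vectorFieldInChart_horC, vectorFieldInChart_horC,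
    horBracketCoord_apply, fderiv_clm_apply hd (differentiableAt_const _),
    fderiv_clm_apply hd (differentiableAt_const _)]
  simp

/-- The gyroscopic tensor in coordinates around `s₀`, computed at `q`. -/
noncomputable def gyroC (s₀ : S) (q : Q) : Eu r →L[ℝ] Eu r →L[ℝ] Eu r :=
  (ContinuousLinearMap.compL ℝ (Eu r) (Eu n) (Eu r)
    ((C.baseProj s₀ q).comp (dChartInv (𝓡 n) q q))).comp (C.horBracketCoord s₀ q)

theorem gyroC_apply (s₀ : S) (q : Q) (w u : Eu r) : C.gyroC s₀ q w u =
    C.baseProj s₀ q (dChartInv (𝓡 n) q q (C.horBracketCoord s₀ q w u)) := rfl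

variable {C} in
-- Constant coordinate fields commute, so the term [Y, Z] of the gyroscopic tensor vanishes for them
-- and only the projected bracket of the lifts is left.
theorem gyroC_eq_horBracket {s₀ : S} {q : Q} (hq : q ∈ C.shapeDomain s₀) (w u : Eu r) :
    C.gyroC s₀ q w u = C.baseProj s₀ q (C.horBracket s₀ w u q) := by
  rw [gyroC_apply, ← dChart_horBracket hq, dChartInv_dChart (mem_extChartAt_source q)]

theorem gyroC_antisymm (s₀ : S) (q : Q) (w u : Eu r) :
    C.gyroC s₀ q w u = -C.gyroC s₀ q u w := by
  rw [gyroC_apply, gyroC_apply, ← map_neg, ← map_neg, horBracketCoord_apply,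
    horBracketCoord_apply, neg_sub]

variable {C} in
-- Lowering the index with the reduced metric leaves an expression in the metric, the lifts and
-- their bracket, all of which are known to be smooth and G-equivariant. Both properties of the
-- gyroscopic tensor are read off from this.
theorem metricK_gyroC {s₀ : S} {q : Q} (hq : q ∈ C.shapeDomain s₀) (w u : Eu r) :
    C.metricK s₀ q (C.gyroC s₀ q w u) =
      (C.metric.inner q (C.horBracket s₀ w u q)).comp (C.horC s₀ q) := by
  ext v
  rw [gyroC_eq_horBracket hq, metricK_baseProj hq]
  rfl

variable {C} in
theorem gyroC_smul {s₀ : S} {q : Q} (hq : q ∈ C.shapeDomain s₀) (g : G) :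
    C.gyroC s₀ (g • q) = C.gyroC s₀ q := by
  have hgq := smul_mem_shapeDomain hq g
  ext1 w
  ext1 u
  refine metricK_injective hq ?_
  rw [metricK_gyroC hq, ← metricK_smul hq g, metricK_gyroC hgq]
  ext v
  rw [ContinuousLinearMap.comp_apply, ContinuousLinearMap.comp_apply,
    ← mfderiv_smul_horBracket hq, ← mfderiv_smul_horC hq, C.metric_invariant]

/-- The gyroscopic tensor in coordinates around `s₀`. -/
noncomputable def gyroS (s₀ : S) (y : Eu r) : Eu r →L[ℝ] Eu r →L[ℝ] Eu r :=
  C.gyroC s₀ (C.basePoint s₀ y)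

variable {C} in
theorem gyroS_shapeCoord {s₀ : S} {q : Q} (hq : q ∈ C.shapeDomain s₀) :
    C.gyroS s₀ (C.shapeCoord s₀ q) = C.gyroC s₀ q :=
  apply_basePoint_shapeCoord (C := C) (f := C.gyroC s₀) (fun _ hq g => gyroC_smul hq g) hq

variable {C} in
theorem contDiffOn_gyroS (s₀ : S) :
    ContDiffOn ℝ ∞ (C.gyroS s₀) (extChartAt (𝓡 r) s₀).target := by
  refine contDiffOn_clm_apply.2 fun w => contDiffOn_clm_apply.2 fun u => ?_
  have hN : ContDiffOn ℝ ∞ (fun y => (C.metric.inner (C.basePoint s₀ y)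
      (C.horBracket s₀ w u (C.basePoint s₀ y))).comp (C.horC s₀ (C.basePoint s₀ y)))
      (extChartAt (𝓡 r) s₀).target := by
    refine contDiffOn_clm_apply.2 fun v => fun y hy => ?_
    refine (contDiffAt_comp_basePoint
      (f := fun q => C.metric.inner q (C.horBracket s₀ w u q) (C.horC s₀ q v))
      (fun q hq g => ?_) (fun q hq => ?_) hy).contDiffWithinAt
    · rw [← mfderiv_smul_horBracket hq, ← mfderiv_smul_horC hq, C.metric_invariant]
    · exact C.contMDiffAt_metric_apply (contMDiffAt_horBracket hq w u) (contMDiffAt_horC hq v)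
  -- The tensor is recovered from its lowered version by raising the index with the smooth inverse
  -- metric.
  refine ((contDiffOn_cometric (C := C) s₀).clm_apply hN).congr fun y hy => ?_
  have hq := basePoint_mem_shapeDomain (C := C) hy
  have h := cometric_metricK hq (C.gyroC s₀ (C.basePoint s₀ y) w u)
  rw [metricK_gyroC hq, shapeCoord_basePoint hy] at h
  exact h.symm

/-- The potential energy in coordinates around `s₀`. -/
noncomputable def potentialS (s₀ : S) (y : Eu r) : ℝ := C.U (C.basePoint s₀ y)

variable {C} in
theorem potentialS_shapeCoord {s₀ : S} {q : Q} (hq : q ∈ C.shapeDomain s₀) :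
    C.potentialS s₀ (C.shapeCoord s₀ q) = C.U q :=
  apply_basePoint_shapeCoord (C := C) (f := C.U) (fun q _ (g : G) => C.U_invariant g q) hq

variable {C} in
theorem contDiffOn_potentialS (s₀ : S) :
    ContDiffOn ℝ ∞ (C.potentialS s₀) (extChartAt (𝓡 r) s₀).target := fun _ hy =>
  (contDiffAt_comp_basePoint (C := C) (f := C.U) (fun q _ (g : G) => C.U_invariant g q)
    (fun q _ => C.U_smooth q) hy).contDiffWithinAt

end ReducedData

end ChaplyginSystem

/-! ### The reduced equations in coordinates -/

section ReducedField

set_option synthInstance.maxHeartbeats 200000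

variable {F : Type*} [NormedAddCommGroup F] [NormedSpace ℝ F]
  (M : F → (F →L[ℝ] ℝ) →L[ℝ] F) (U : F → ℝ) (B : F → F →L[ℝ] F →L[ℝ] F)

/-- The Hamiltonian `ξ(M ξ) / 2 + U`. -/
noncomputable def chartHamiltonian (z : F × (F →L[ℝ] ℝ)) : ℝ :=
  (1 / 2 : ℝ) * z.2 (M z.1 z.2) + U z.1

/-- The differential of `ξ(M ξ) / 2 + U` in the base direction. -/
noncomputable def chartForce (z : F × (F →L[ℝ] ℝ)) : F →L[ℝ] ℝ :=
  (1 / 2 : ℝ) • z.2.comp ((fderiv ℝ M z.1).flip z.2) + fderiv ℝ U z.1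

/-- The Hamiltonian vector field of `ξ(M ξ) / 2 + U` with the gyroscopic force of `B`. -/
noncomputable def gyroField (z : F × (F →L[ℝ] ℝ)) : F × (F →L[ℝ] ℝ) :=
  (M z.1 z.2, -(chartForce M U z + z.2.comp ((B z.1).flip (M z.1 z.2))))

variable {M U B}

/-- The two derivatives of the quadratic form along the fibre coincide by symmetry of M, which
cancels the factor 1/2. The fibre derivative is given as evaluation at the vector M ξ because
`poissonBracket_eq_inChart` needs it in this form. -/
theorem hasFDerivAt_chartHamiltonian {y : F} {ξ : F →L[ℝ] ℝ}
    (hM : DifferentiableAt ℝ M y) (hU : DifferentiableAt ℝ U y)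
    (hs : ∀ η, ξ (M y η) = η (M y ξ)) :
    ∃ L : F × (F →L[ℝ] ℝ) →L[ℝ] ℝ, HasFDerivAt (chartHamiltonian M U) L (y, ξ) ∧
      (∀ η, L (0, η) = η (M y ξ)) ∧ L.comp (.inl ℝ F (F →L[ℝ] ℝ)) = chartForce M U (y, ξ) := by
  have hfst : HasFDerivAt Prod.fst (ContinuousLinearMap.fst ℝ F (F →L[ℝ] ℝ)) (y, ξ) :=
    hasFDerivAt_fst
  have h1 := HasFDerivAt.comp (y, ξ) (g := M) (g' := fderiv ℝ M y) hM.hasFDerivAt hfst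
  have h2 : HasFDerivAt (fun z : F × (F →L[ℝ] ℝ) => U z.1)
      ((fderiv ℝ U y).comp (.fst ℝ F (F →L[ℝ] ℝ))) (y, ξ) :=
    HasFDerivAt.comp (g := U) (f := Prod.fst) (y, ξ) hU.hasFDerivAt hasFDerivAt_fst
  have hsnd : HasFDerivAt (fun z : F × (F →L[ℝ] ℝ) => z.2) (.snd ℝ F (F →L[ℝ] ℝ)) (y, ξ) :=
    hasFDerivAt_snd
  have h3 := ((hsnd.clm_apply (HasFDerivAt.clm_apply (c := fun z : F × (F →L[ℝ] ℝ) => M z.1) h1 hsnd)).const_mul (1 / 2 : ℝ)).add h2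
  refine ⟨_, h3, fun η => ?_, ?_⟩
  · simp [hs η]
    ring
  · ext w
    simp [chartForce]

theorem contDiffOn_gyroField {O : Set F} (hO : IsOpen O) (hM : ContDiffOn ℝ ∞ M O)
    (hU : ContDiffOn ℝ ∞ U O) (hB : ContDiffOn ℝ ∞ B O) :
    ContDiffOn ℝ ∞ (gyroField M U B) (O ×ˢ univ) := by
  have hfst : ContDiffOn ℝ ∞ (Prod.fst : F × (F →L[ℝ] ℝ) → F) (O ×ˢ univ) := contDiffOn_fst
  have hsnd : ContDiffOn ℝ ∞ (Prod.snd : F × (F →L[ℝ] ℝ) → _) (O ×ˢ univ) := contDiffOn_snd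
  have hm : MapsTo (Prod.fst : F × (F →L[ℝ] ℝ) → F) (O ×ˢ univ) O := fun z hz => hz.1
  have hM' := hM.comp hfst hm
  have hB' := hB.comp hfst hm
  have hdM := (hM.fderiv_of_isOpen hO (m := ∞) (by simp)).comp hfst hm
  have hdU := (hU.fderiv_of_isOpen hO (m := ∞) (by simp)).comp hfst hm
  have hMa := hM'.clm_apply hsnd
  refine hMa.prodMk (ContDiffOn.neg ?_)
  refine (((hsnd.clm_comp (((ContinuousLinearMap.flipₗᵢ ℝ F (F →L[ℝ] ℝ) F).contDiff.comp_contDiffOn hdM).clm_apply hsnd)).const_smul (1 / 2 : ℝ)).add hdU).add ?_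
  exact hsnd.clm_comp (((ContinuousLinearMap.flipₗᵢ ℝ F F F).contDiff.comp_contDiffOn hB').clm_apply hMa)

/-- The trace only involves the two diagonal blocks of the derivative. This is the block from base
to base, found on the slice of constant ξ. -/
theorem fderiv_gyroField_inl {y : F} {ξ : F →L[ℝ] ℝ} {O : Set F} (hO : IsOpen O) (hy : y ∈ O)
    (hM : ContDiffOn ℝ ∞ M O) (hU : ContDiffOn ℝ ∞ U O) (hB : ContDiffOn ℝ ∞ B O) (w : F) :
    (fderiv ℝ (gyroField M U B) (y, ξ) (w, 0)).1 = fderiv ℝ M y w ξ := by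
  have hG : DifferentiableAt ℝ (gyroField M U B) (y, ξ) :=
    ((contDiffOn_gyroField hO hM hU hB).contDiffAt
      ((hO.prod isOpen_univ).mem_nhds ⟨hy, mem_univ _⟩)).differentiableAt (by simp)
  have hMd : DifferentiableAt ℝ M y := (hM.contDiffAt (hO.mem_nhds hy)).differentiableAt (by simp)
  have h1 := (hasFDerivAt_fst.comp (y, ξ) hG.hasFDerivAt).comp y
    (hasFDerivAt_prodMk_left (𝕜 := ℝ) y ξ)
  have h2 : HasFDerivAt (fun y => M y ξ) _ y := hMd.hasFDerivAt.clm_apply (hasFDerivAt_const ξ y)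
  have h3 := DFunLike.congr_fun (h1.unique h2) w
  simpa using h3

/-- This is the block from fibre to fibre. The potential is constant along the fibres and drops out,
while each of the two terms quadratic in ξ contributes two summands. -/
theorem fderiv_gyroField_inr {y : F} {ξ : F →L[ℝ] ℝ} {O : Set F} (hO : IsOpen O) (hy : y ∈ O)
    (hM : ContDiffOn ℝ ∞ M O) (hU : ContDiffOn ℝ ∞ U O) (hB : ContDiffOn ℝ ∞ B O)
    (η : F →L[ℝ] ℝ) :
    (fderiv ℝ (gyroField M U B) (y, ξ) (0, η)).2 =
      -((1 / 2 : ℝ) • (η.comp ((fderiv ℝ M y).flip ξ) + ξ.comp ((fderiv ℝ M y).flip η))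
        + (η.comp ((B y).flip (M y ξ)) + ξ.comp ((B y).flip (M y η)))) := by
  have hG : DifferentiableAt ℝ (gyroField M U B) (y, ξ) :=
    ((contDiffOn_gyroField hO hM hU hB).contDiffAt
      ((hO.prod isOpen_univ).mem_nhds ⟨hy, mem_univ _⟩)).differentiableAt (by simp)
  have h1 := (hasFDerivAt_snd.comp (y, ξ) hG.hasFDerivAt).comp ξ
    (hasFDerivAt_prodMk_right (𝕜 := ℝ) y ξ)
  have hid := hasFDerivAt_id (𝕜 := ℝ) ξ
  have hlin : ∀ L : (F →L[ℝ] ℝ) →L[ℝ] F →L[ℝ] F, HasFDerivAt (fun ξ : F →L[ℝ] ℝ => ξ.comp (L ξ))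
      _ ξ := fun L => hid.clm_comp L.hasFDerivAt
  have h2 := ((((hlin (fderiv ℝ M y).flip).const_smul (1 / 2 : ℝ)).add_const
    (fderiv ℝ U y)).add (hlin ((B y).flip.comp (M y)))).neg
  have h3 := DFunLike.congr_fun (h1.unique h2) η
  refine Eq.trans ?_ (h3.trans ?_)
  · simp
  · ext w
    simp
    ring

/-- Write T as the sum of its two row components, each factoring through one summand, and use the
cyclicity of the trace. -/
theorem LinearMap.trace_prod_eq {E₁ E₂ : Type*} [AddCommGroup E₁] [Module ℝ E₁]
    [FiniteDimensional ℝ E₁] [AddCommGroup E₂] [Module ℝ E₂] [FiniteDimensional ℝ E₂]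
    (T : E₁ × E₂ →ₗ[ℝ] E₁ × E₂) :
    LinearMap.trace ℝ (E₁ × E₂) T =
      LinearMap.trace ℝ E₁ (LinearMap.fst ℝ E₁ E₂ ∘ₗ T ∘ₗ LinearMap.inl ℝ E₁ E₂)
      + LinearMap.trace ℝ E₂ (LinearMap.snd ℝ E₁ E₂ ∘ₗ T ∘ₗ LinearMap.inr ℝ E₁ E₂) := by
  have h : T = LinearMap.inl ℝ E₁ E₂ ∘ₗ (LinearMap.fst ℝ E₁ E₂ ∘ₗ T)
      + LinearMap.inr ℝ E₁ E₂ ∘ₗ (LinearMap.snd ℝ E₁ E₂ ∘ₗ T) := by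
    ext <;> simp
  conv_lhs => rw [h]
  rw [map_add, LinearMap.trace_comp_comm' (LinearMap.fst ℝ E₁ E₂ ∘ₗ T),
    LinearMap.trace_comp_comm' (LinearMap.snd ℝ E₁ E₂ ∘ₗ T), LinearMap.comp_assoc, LinearMap.comp_assoc]

/-- The trace of the transpose. -/
theorem LinearMap.trace_precomp {E : Type*} [NormedAddCommGroup E] [NormedSpace ℝ E]
    [FiniteDimensional ℝ E] (A : E →L[ℝ] E) (T : (E →L[ℝ] ℝ) →ₗ[ℝ] (E →L[ℝ] ℝ))
    (hT : ∀ η, T η = η.comp A) :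
    LinearMap.trace ℝ (E →L[ℝ] ℝ) T = LinearMap.trace ℝ E A.toLinearMap := by
  rw [← LinearMap.trace_transpose' (f := A.toLinearMap),
    ← LinearMap.trace_conj' T (LinearMap.toContinuousLinearMap (E := E) (F' := ℝ) (𝕜 := ℝ)).symm]
  congr 1
  ext φ v
  simp [LinearEquiv.conj_apply, hT, Module.Dual.transpose_apply]

/-- The divergence of the reduced field. -/
theorem trace_fderiv_gyroField [FiniteDimensional ℝ F] {y : F} {ξ : F →L[ℝ] ℝ} {O : Set F}
    (hO : IsOpen O) (hy : y ∈ O)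
    (hM : ContDiffOn ℝ ∞ M O) (hU : ContDiffOn ℝ ∞ U O) (hB : ContDiffOn ℝ ∞ B O)
    (hs : ∀ y ∈ O, ∀ ξ η : F →L[ℝ] ℝ, ξ (M y η) = η (M y ξ)) (ha : ∀ w u, B y w u = -B y u w) :
    LinearMap.trace ℝ (F × (F →L[ℝ] ℝ)) (fderiv ℝ (gyroField M U B) (y, ξ)).toLinearMap =
      -LinearMap.trace ℝ F ((B y).flip (M y ξ)).toLinearMap := by
  have hMd : DifferentiableAt ℝ M y := (hM.contDiffAt (hO.mem_nhds hy)).differentiableAt (by simp)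
  -- M is symmetric on a whole neighbourhood, so its directional derivatives are symmetric as well.
  have hds : ∀ (w : F) (η : F →L[ℝ] ℝ), ξ (fderiv ℝ M y w η) = η (fderiv ℝ M y w ξ) := by
    intro w η
    have h1 : ∀ ξ η : F →L[ℝ] ℝ, HasFDerivAt (fun y => ξ (M y η))
        (ξ.comp ((fderiv ℝ M y).flip η)) y := fun ξ η =>
      (ξ.hasFDerivAt.comp y (hMd.hasFDerivAt.clm_apply (hasFDerivAt_const η y))).congr_fderiv
        (by ext; simp)
    have h2 : (fun y => ξ (M y η)) =ᶠ[𝓝 y] fun y => η (M y ξ) := by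
      filter_upwards [hO.mem_nhds hy] with y hy using hs y hy ξ η
    exact DFunLike.congr_fun (((h1 ξ η).congr_of_eventuallyEq h2.symm).unique (h1 η ξ)) w
  let A : F →L[ℝ] F := (fderiv ℝ M y).flip ξ
  let E : F →L[ℝ] F := (B y).flip (M y ξ)
  let L : F →ₗ[ℝ] F →L[ℝ] ℝ :=
    ((ContinuousLinearMap.compL ℝ F F ℝ ξ).comp (B y)).toLinearMap
  have hL : ∀ u w, L u w = ξ (B y u w) := fun _ _ => rfl
  let P : (F →L[ℝ] ℝ) →ₗ[ℝ] (F →L[ℝ] ℝ) :=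
    ((ContinuousLinearMap.compL ℝ F F ℝ).flip (-A - E)).toLinearMap
  -- L is antisymmetric and M symmetric, so -(L ∘ M) is the transpose of M ∘ L. Then -tr(LM) =
  -- tr(ML) = tr(LM), and the trace vanishes.
  have hLM : LinearMap.trace ℝ (F →L[ℝ] ℝ) (L ∘ₗ (M y).toLinearMap) = 0 := by
    have h1 : LinearMap.trace ℝ (F →L[ℝ] ℝ) (-(L ∘ₗ (M y).toLinearMap)) =
        LinearMap.trace ℝ F ((M y).toLinearMap ∘ₗ L) := by
      refine LinearMap.trace_precomp (LinearMap.toContinuousLinearMap ((M y).toLinearMap ∘ₗ L)) _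
        fun η => ?_
      ext w
      change -(L (M y η) w) = η (M y (L w))
      rw [hs y hy η (L w), hL, hL, ha, map_neg, neg_neg]
    have h2 := map_neg (LinearMap.trace ℝ (F →L[ℝ] ℝ)) (L ∘ₗ (M y).toLinearMap)
    rw [h1, ← LinearMap.trace_comp_comm'] at h2
    linarith
  have h1 : LinearMap.fst ℝ F (F →L[ℝ] ℝ) ∘ₗ (fderiv ℝ (gyroField M U B) (y, ξ)).toLinearMap ∘ₗ
      LinearMap.inl ℝ F (F →L[ℝ] ℝ) = A.toLinearMap := by
    ext w
    exact fderiv_gyroField_inl hO hy hM hU hB w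
  have h2 : LinearMap.snd ℝ F (F →L[ℝ] ℝ) ∘ₗ (fderiv ℝ (gyroField M U B) (y, ξ)).toLinearMap ∘ₗ
      LinearMap.inr ℝ F (F →L[ℝ] ℝ) = P + L ∘ₗ (M y).toLinearMap := by
    ext η w
    refine (DFunLike.congr_fun (fderiv_gyroField_inr hO hy hM hU hB η) w).trans ?_
    change -((1 / 2 : ℝ) * (η (fderiv ℝ M y w ξ) + ξ (fderiv ℝ M y w η))
      + (η (B y w (M y ξ)) + ξ (B y w (M y η)))) =
      η (-fderiv ℝ M y w ξ - B y w (M y ξ)) + ξ (B y (M y η) w)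
    rw [hds, ha w (M y η), map_neg, map_sub, map_neg]
    ring
  -- The base block contributes tr A and the fibre block -tr A - tr E. The cancellation of tr A is
  -- Liouville's theorem for the Hamiltonian part; -tr E is the gyroscopic contribution.
  rw [LinearMap.trace_prod_eq, h1, h2, map_add, hLM, LinearMap.trace_precomp (-A - E) P
    fun _ => rfl]
  change LinearMap.trace ℝ F A.toLinearMap +
    (LinearMap.trace ℝ F (-A.toLinearMap - E.toLinearMap) + 0) = _
  rw [map_sub, map_neg]
  ring

end ReducedField

/-! ### The nonholonomic bracket in coordinates -/

namespace ChaplyginSystem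

section Bracket

variable {n r k : ℕ} {Q S G : Type*}
  [TopologicalSpace Q] [ChartedSpace (Eu n) Q] [IsManifold (𝓡 n) ∞ Q]
  [TopologicalSpace S] [ChartedSpace (Eu r) S] [IsManifold (𝓡 r) ∞ S]
  [TopologicalSpace G] [ChartedSpace (Eu k) G] [Group G] [LieGroup (𝓡 k) ∞ G]
  [MulAction G Q] (C : ChaplyginSystem n r k Q S G)

/-- The reduced dynamics in coordinates around `s₀`. -/
noncomputable def reducedField (s₀ : S) : Eu r × (Eu r →L[ℝ] ℝ) → Eu r × (Eu r →L[ℝ] ℝ) :=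
  gyroField (C.cometric s₀) (C.potentialS s₀) (C.gyroS s₀)

variable {C} in
theorem redProj_mem_source {β₀ : CotangentBundle r S} {b : C.DualBundle}
    (hb : b.1 ∈ C.shapeDomain β₀.1) :
    C.redProj b ∈ (extChartAt (cotModel r) β₀).source := by
  rw [cot_extChartAt_source]
  exact hb

variable {C} in
theorem chart_redProj_fst {β₀ : CotangentBundle r S} {b : C.DualBundle}
    (hb : b.1 ∈ C.shapeDomain β₀.1) :
    (extChartAt (cotModel r) β₀ (C.redProj b)).1 = C.shapeCoord β₀.1 b.1 := by
  rw [cot_extChartAt_apply β₀ (C.redProj b) hb]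
  rfl

variable {C} in
theorem chart_redProj_snd {β₀ : CotangentBundle r S} {b : C.DualBundle}
    (hb : b.1 ∈ C.shapeDomain β₀.1) (w : Eu r) :
    (extChartAt (cotModel r) β₀ (C.redProj b)).2 w =
      b.2 (C.horLift b.1 (dChartInv (𝓡 r) β₀.1 (C.pr b.1) w)) := by
  rw [cot_extChartAt_apply β₀ (C.redProj b) hb]
  rfl

variable {C} in
theorem chart_redProj_snd_dShape {β₀ : CotangentBundle r S} {b : C.DualBundle}
    (hb : b.1 ∈ C.shapeDomain β₀.1) (v : C.D b.1) :
    (extChartAt (cotModel r) β₀ (C.redProj b)).2 (C.dShape β₀.1 b.1 v) = b.2 v := by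
  rw [chart_redProj_snd hb]
  exact congrArg b.2 (Subtype.ext (horC_dShape hb v.2))

theorem projDual_apply (b : C.DualBundle) (v : TangentSpace (𝓡 n) b.1) :
    ((C.projDual b).2 : TangentSpace (𝓡 n) b.1 →L[ℝ] ℝ) v = b.2 (C.proj b.1 v) := rfl

theorem proj_apply_of_mem (q : Q) (v : C.D q) : C.proj q v = v :=
  Submodule.projectionOnto_apply_left (C.isCompl_Dperp q) v

theorem inner_sharp (q : Q) (a : TangentSpace (𝓡 n) q →L[ℝ] ℝ) (w : TangentSpace (𝓡 n) q) :
    C.metric.inner q (C.sharp q a) w = a w :=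
  LinearMap.BilinForm.apply_toDual_symm_apply (B := C.bilin q) (hB := C.bilin_nondegenerate q)
    a.toLinearMap w

theorem eq_sharp {q : Q} {a : TangentSpace (𝓡 n) q →L[ℝ] ℝ} {v : TangentSpace (𝓡 n) q}
    (h : ∀ w, C.metric.inner q v w = a w) : C.sharp q a = v := by
  rw [← sub_eq_zero]
  by_contra hne
  refine (C.metric.pos q _ hne).ne' ?_
  have h1 := map_sub (C.metric.inner q) (C.sharp q a) v
  rw [h1]
  exact sub_eq_zero.2 ((C.inner_sharp q a _).trans (h _).symm)

variable {C} in
/-- The constrained Hamiltonian in coordinates. -/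
theorem constrainedHamiltonian_eq_chart {β₀ : CotangentBundle r S} {b : C.DualBundle}
    (hb : b.1 ∈ C.shapeDomain β₀.1) :
    C.constrainedHamiltonian b = chartHamiltonian (C.cometric β₀.1) (C.potentialS β₀.1)
      (extChartAt (cotModel r) β₀ (C.redProj b)) := by
  set z := extChartAt (cotModel r) β₀ (C.redProj b) with hz
  set u : Eu r := C.cometric β₀.1 z.1 z.2 with hu
  have hz1 : z.1 = C.shapeCoord β₀.1 b.1 := chart_redProj_fst hb
  have hKu : C.metricK β₀.1 b.1 u = z.2 := by rw [hu, hz1, metricK_cometric hb]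
  -- The metric dual of P* b is horizontal: it is the lift of the shape velocity u = M ξ. The
  -- kinetic energy on D* is therefore that of the reduced metric.
  have hs : C.sharp b.1 (C.projDual b).2 = C.horC β₀.1 b.1 u := by
    refine C.eq_sharp fun w => ?_
    rw [C.metric.symm, ← metricK_baseProj hb, metricK_symm, hKu, baseProj_apply, hz,
      chart_redProj_snd_dShape hb]
    rfl
  have h1 : ((C.projDual b).2 : TangentSpace (𝓡 n) b.1 →L[ℝ] ℝ) (C.horC β₀.1 b.1 u) = z.2 u := by
    rw [projDual_apply, hz, chart_redProj_snd hb]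
    exact congrArg b.2 (C.proj_apply_of_mem b.1 _)
  have h2 : C.U b.1 = C.potentialS β₀.1 z.1 := by rw [hz1, potentialS_shapeCoord hb]
  change 1 / 2 * ((C.projDual b).2 : TangentSpace (𝓡 n) b.1 →L[ℝ] ℝ)
    (C.sharp b.1 (C.projDual b).2) + C.U b.1 = _
  rw [hs, h1, h2]
  rfl

/-- The map `T*Q → D* → T*S` in coordinates. -/
noncomputable def liftCoord (s₀ : S) (q₀ : Q) (z : Eu n × (Eu n →L[ℝ] ℝ)) :
    Eu r × (Eu r →L[ℝ] ℝ) :=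
  (C.shapeCoord s₀ ((extChartAt (𝓡 n) q₀).symm z.1), z.2.comp (C.horCoord s₀ q₀ z.1))

variable {C} in
theorem chart_redProj_restrictD {β₀ : CotangentBundle r S} {α₀ : CotangentBundle n Q}
    {z : Eu n × (Eu n →L[ℝ] ℝ)} (hz : z.1 ∈ (extChartAt (𝓡 n) α₀.1).target)
    (hd : (extChartAt (𝓡 n) α₀.1).symm z.1 ∈ C.shapeDomain β₀.1) :
    extChartAt (cotModel r) β₀
      (C.redProj (C.restrictD ((extChartAt (cotModel n) α₀).symm z))) =
      C.liftCoord β₀.1 α₀.1 z := by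
  have h := cot_extChartAt_symm_apply α₀ z.2 hz
  rw [Prod.mk.eta] at h
  rw [h]
  refine Prod.ext (chart_redProj_fst (C := C) (b := C.restrictD (covector _ _)) hd) ?_
  ext1 w
  exact chart_redProj_snd (C := C) (b := C.restrictD (covector _ _)) hd w

variable {C} in
-- The fibre component ζ ∘ A(x) is bilinear in ζ and A(x). The product rule term ζ ∘ DA(a), which
-- measures how the horizontal lift varies along Q, is the origin of the gyroscopic force.
theorem hasFDerivAt_liftCoord {s₀ : S} {q : Q} (hq : q ∈ C.shapeDomain s₀) (ζ : Eu n →L[ℝ] ℝ) :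
    ∃ L : Eu n × (Eu n →L[ℝ] ℝ) →L[ℝ] Eu r × (Eu r →L[ℝ] ℝ),
      HasFDerivAt (C.liftCoord s₀ q) L (extChartAt (𝓡 n) q q, ζ) ∧
      ∀ a η, L (a, η) = (fderiv ℝ (fun x => C.shapeCoord s₀ ((extChartAt (𝓡 n) q).symm x))
          (extChartAt (𝓡 n) q q) a,
        η.comp (C.horCoord s₀ q (extChartAt (𝓡 n) q q))
          + ζ.comp (fderiv ℝ (C.horCoord s₀ q) (extChartAt (𝓡 n) q q) a)) := by
  have hx := mem_extChartAt_source (I := 𝓡 n) q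
  set x₀ := extChartAt (𝓡 n) q q
  have hfst : HasFDerivAt Prod.fst (ContinuousLinearMap.fst ℝ (Eu n) (Eu n →L[ℝ] ℝ)) (x₀, ζ) :=
    hasFDerivAt_fst
  have hsnd : HasFDerivAt Prod.snd (ContinuousLinearMap.snd ℝ (Eu n) (Eu n →L[ℝ] ℝ)) (x₀, ζ) :=
    hasFDerivAt_snd
  have hu : DifferentiableAt ℝ (fun x => C.shapeCoord s₀ ((extChartAt (𝓡 n) q).symm x)) x₀ :=
    ((contMDiffAt_comp_extChartAt_symm_iff hx).1 (contMDiffAt_shapeCoord hq)).differentiableAt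
      (by simp)
  have hA : DifferentiableAt ℝ (C.horCoord s₀ q) x₀ :=
    (contDiffAt_horCoord hq hx).differentiableAt (by simp)
  have h1 := HasFDerivAt.comp (x₀, ζ) (g := fun x => C.shapeCoord s₀ ((extChartAt (𝓡 n) q).symm x))
    hu.hasFDerivAt hfst
  have h2 := HasFDerivAt.comp (x₀, ζ) (g := C.horCoord s₀ q) hA.hasFDerivAt hfst
  have h3 := hsnd.clm_comp h2
  refine ⟨_, h1.prodMk h3, fun a η => Prod.ext rfl ?_⟩
  ext w
  simp
  ring

variable {C} in
/-- The nonholonomic vector field in coordinates. -/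
theorem nhBracket_eq_reducedField {φ : CotangentBundle r S → ℝ} {β₀ : CotangentBundle r S}
    {b : C.DualBundle} (hb : b.1 ∈ C.shapeDomain β₀.1)
    (hφ : MDifferentiableAt (cotModel r) 𝓘(ℝ, ℝ) φ (C.redProj b)) :
    C.nhBracket (fun b => φ (C.redProj b)) C.constrainedHamiltonian b =
      fderiv ℝ (fun z => φ ((extChartAt (cotModel r) β₀).symm z))
        (extChartAt (cotModel r) β₀ (C.redProj b))
        (C.reducedField β₀.1 (extChartAt (cotModel r) β₀ (C.redProj b))) := by
  set α₀ := C.projDual b with hα₀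
  set z₀ := extChartAt (cotModel n) α₀ α₀ with hz₀
  set z := extChartAt (cotModel r) β₀ (C.redProj b) with hz
  set x₀ := extChartAt (𝓡 n) b.1 b.1 with hx₀
  set y := C.shapeCoord β₀.1 b.1
  have hq := mem_extChartAt_source (I := 𝓡 n) b.1
  have hα : α₀ ∈ (extChartAt (cotModel n) α₀).source := mem_extChartAt_source α₀
  have hz₀e : z₀ = (x₀, ((α₀.2 : TangentSpace (𝓡 n) b.1 →L[ℝ] ℝ).comp
      (dChartInv (𝓡 n) b.1 b.1) : Eu n →L[ℝ] ℝ)) := cot_extChartAt_apply α₀ α₀ hq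
  -- i_D* ∘ P* is the identity, since P fixes D.
  have hres : C.redProj (C.restrictD α₀) = C.redProj b := by
    congr 1
    refine Sigma.ext rfl (heq_of_eq ?_)
    ext v
    exact congrArg b.2 (C.proj_apply_of_mem b.1 v)
  have hlift0 : C.liftCoord β₀.1 b.1 z₀ = z := by
    have h := chart_redProj_restrictD (C := C) (β₀ := β₀) (α₀ := α₀) (z := z₀)
      (by rw [hz₀e]; exact (extChartAt (𝓡 n) b.1).map_source hq)
      (by rw [hz₀e]; exact ((extChartAt (𝓡 n) b.1).left_inv hq).symm ▸ hb)
    rw [hz₀, (extChartAt (cotModel n) α₀).left_inv hα, hres] at h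
    exact h.symm
  have hz1 : z.1 = y := chart_redProj_fst hb
  have hyt : y ∈ (extChartAt (𝓡 r) β₀.1).target := (extChartAt (𝓡 r) β₀.1).map_source hb
  have hO := isOpen_extChartAt_target (I := 𝓡 r) β₀.1
  have hzξ : z = (y, z.2) := Prod.ext hz1 rfl
  -- The functions near `z₀`.
  have hnear : ∀ᶠ z in 𝓝 z₀, z.1 ∈ (extChartAt (𝓡 n) b.1).target ∧
      (extChartAt (𝓡 n) b.1).symm z.1 ∈ C.shapeDomain β₀.1 := by
    have hxt : x₀ ∈ (extChartAt (𝓡 n) b.1).target := (extChartAt (𝓡 n) b.1).map_source hq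
    have h1 : ∀ᶠ x in 𝓝 x₀, x ∈ (extChartAt (𝓡 n) b.1).target ∧
        (extChartAt (𝓡 n) b.1).symm x ∈ C.shapeDomain β₀.1 := by
      refine Filter.Eventually.and (extChartAt_target_mem_nhds_of_mem hxt) ?_
      refine (mdifferentiableAt_extChartAt_symm hxt).continuousAt.eventually_mem ?_
      rw [(extChartAt (𝓡 n) b.1).left_inv hq]
      exact (C.isOpen_shapeDomain β₀.1).mem_nhds hb
    have h2 : Tendsto Prod.fst (𝓝 z₀) (𝓝 x₀) := by
      rw [hz₀e]
      exact continuous_fst.tendsto _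
    exact h2.eventually h1
  have hf_ev : (fun z => φ (C.redProj (C.restrictD ((extChartAt (cotModel n) α₀).symm z))))
      =ᶠ[𝓝 z₀] (fun z => φ ((extChartAt (cotModel r) β₀).symm z)) ∘ C.liftCoord β₀.1 b.1 := by
    filter_upwards [hnear] with z' hz'
    have h := chart_redProj_restrictD (C := C) (β₀ := β₀) (α₀ := α₀) hz'.1 hz'.2
    refine Eq.trans ?_ (congrArg (fun z => φ ((extChartAt (cotModel r) β₀).symm z)) h)
    refine congrArg φ ((extChartAt (cotModel r) β₀).left_inv (redProj_mem_source ?_)).symm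
    have hp := cot_proj_symm α₀ (z := z') (by rw [cot_extChartAt_target]; exact ⟨hz'.1, mem_univ _⟩)
    exact (congrArg (· ∈ C.shapeDomain β₀.1) hp).mpr hz'.2
  have hg_ev : (fun z => C.constrainedHamiltonian
        (C.restrictD ((extChartAt (cotModel n) α₀).symm z)))
      =ᶠ[𝓝 z₀] chartHamiltonian (C.cometric β₀.1) (C.potentialS β₀.1) ∘
        C.liftCoord β₀.1 b.1 := by
    filter_upwards [hnear] with z' hz'
    have h := chart_redProj_restrictD (C := C) (β₀ := β₀) (α₀ := α₀) hz'.1 hz'.2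
    refine Eq.trans (constrainedHamiltonian_eq_chart ?_)
      (congrArg (chartHamiltonian (C.cometric β₀.1) (C.potentialS β₀.1)) h)
    have hp := cot_proj_symm α₀ (z := z') (by rw [cot_extChartAt_target]; exact ⟨hz'.1, mem_univ _⟩)
    exact (congrArg (· ∈ C.shapeDomain β₀.1) hp).mpr hz'.2
  -- Their derivatives.
  set ζ : Eu n →L[ℝ] ℝ := (α₀.2 : TangentSpace (𝓡 n) b.1 →L[ℝ] ℝ).comp (dChartInv (𝓡 n) b.1 b.1)
  obtain ⟨L, hL, hLapp⟩ := hasFDerivAt_liftCoord hb ζ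
  rw [← hx₀, ← hz₀e] at hL
  have hφ' : DifferentiableAt ℝ (fun z => φ ((extChartAt (cotModel r) β₀).symm z)) z :=
    differentiableAt_comp_extChartAt_symm
      ((extChartAt (cotModel r) β₀).map_source (redProj_mem_source hb))
      (by rwa [hz, (extChartAt (cotModel r) β₀).left_inv (redProj_mem_source hb)])
  obtain ⟨h', hh', hh'η, hh'w⟩ := hasFDerivAt_chartHamiltonian (y := y) (ξ := z.2)
    (((contDiffOn_cometric (C := C) β₀.1).contDiffAt (hO.mem_nhds hyt)).differentiableAt (by simp))
    (((contDiffOn_potentialS (C := C) β₀.1).contDiffAt (hO.mem_nhds hyt)).differentiableAt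
      (by simp))
    (fun η => cometric_symm hyt _ _)
  rw [← hzξ, ← hlift0] at hh'
  rw [← hlift0] at hφ'
  have hf' := (hφ'.hasFDerivAt.comp z₀ hL).congr_of_eventuallyEq hf_ev
  have hg' := (hh'.comp z₀ hL).congr_of_eventuallyEq hg_ev
  rw [hlift0] at hf'
  set A := C.horCoord β₀.1 b.1 x₀
  set u : Eu r := C.cometric β₀.1 y z.2
  have hdu : ∀ w : Eu r, fderiv ℝ (fun x => C.shapeCoord β₀.1 ((extChartAt (𝓡 n) b.1).symm x)) x₀
      (A w) = w := by
    intro w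
    have hAw : A w = dChart (𝓡 n) b.1 b.1 (C.horC β₀.1 b.1 w) := by
      have hqq : (extChartAt (𝓡 n) b.1).symm x₀ = b.1 := (extChartAt (𝓡 n) b.1).left_inv hq
      change dChart (𝓡 n) b.1 ((extChartAt (𝓡 n) b.1).symm x₀)
        (C.horC β₀.1 ((extChartAt (𝓡 n) b.1).symm x₀) w) = _
      rw [hqq]
    rw [hAw, hx₀, fderiv_shapeCoord_inChart hb hq, dShape_horC hb]
  -- The lifted Hamiltonian depends on ζ only through ζ ∘ A, so the velocity on Q is the horizontal
  -- lift A u of the shape velocity.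
  have hx : ∀ η, (h'.comp L) (0, η) = η (A u) := by
    intro η
    rw [ContinuousLinearMap.comp_apply, hLapp, map_zero, map_zero, ContinuousLinearMap.comp_zero,
      add_zero, hh'η]
    rfl
  have hbr := poissonBracket_eq_inChart (f := fun α => φ (C.redProj (C.restrictD α)))
    (g := fun α => C.constrainedHamiltonian (C.restrictD α)) hα
    (mdifferentiableAt_of_comp_extChartAt_symm hα hf'.differentiableAt)
    (mdifferentiableAt_of_comp_extChartAt_symm hα hg'.differentiableAt) hf' hg' hx
  refine hbr.trans ?_
  rw [ContinuousLinearMap.comp_apply]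
  congr 1
  -- The covector ζ comes from P* b, so it ignores the component orthogonal to D. Of the bracket it
  -- sees only the projected part, which is the gyroscopic tensor.
  have hζ : ∀ w v, ζ (C.horBracketCoord β₀.1 b.1 w v) = z.2 (C.gyroS β₀.1 y w v) := by
    intro w v
    rw [gyroS_shapeCoord hb, gyroC_apply, baseProj_apply, hz, chart_redProj_snd_dShape hb]
    rfl
  rw [hLapp, reducedField, gyroField, hz1]
  refine Prod.ext (hdu u) ?_
  ext w
  have hw : (h'.comp L) (A w, 0) = chartForce (C.cometric β₀.1) (C.potentialS β₀.1) z w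
      + ζ (fderiv ℝ (C.horCoord β₀.1 b.1) x₀ (A w) u) := by
    rw [ContinuousLinearMap.comp_apply, hLapp, ContinuousLinearMap.zero_comp, zero_add, hdu, hzξ,
      ← hh'w]
    have hsplit : ∀ (a : Eu r) (η : Eu r →L[ℝ] ℝ), h' (a, η) = h' (a, 0) + h' (0, η) := by
      intro a η
      rw [← map_add]
      simp
    rw [hsplit, hh'η]
    rfl
  have hB := hζ w u
  rw [horBracketCoord_apply, map_sub] at hB
  -- One derivative of A comes from differentiating the Hamiltonian and the other from following φ
  -- along A u. Their difference DA(A w) u - DA(A u) w is the bracket of the lifts of w and u.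
  change -(h'.comp L) (A w, 0) + ζ (fderiv ℝ (C.horCoord β₀.1 b.1) x₀ (A u) w) =
    -(chartForce (C.cometric β₀.1) (C.potentialS β₀.1) z w + z.2 (C.gyroS β₀.1 y w u))
  rw [hw, ← hB]
  ring

end Bracket

end ChaplyginSystem

/-! ### Existence and uniqueness of the reduced dynamics -/

/-- Charts of the cotangent bundle agree near a point with globally smooth maps. -/
theorem exists_contMDiff_eventuallyEq_extChartAt {r : ℕ} {S : Type*} [TopologicalSpace S]
    [T2Space S] [ChartedSpace (Eu r) S] [IsManifold (𝓡 r) ∞ S] {β₀ β : CotangentBundle r S}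
    (hβ : β ∈ (extChartAt (cotModel r) β₀).source) :
    ∃ φ : CotangentBundle r S → Eu r × (Eu r →L[ℝ] ℝ),
      ContMDiff (cotModel r) 𝓘(ℝ, Eu r × (Eu r →L[ℝ] ℝ)) ∞ φ ∧
        φ =ᶠ[𝓝 β] extChartAt (cotModel r) β₀ := by
  have hβ' := hβ
  rw [cot_extChartAt_source] at hβ'
  -- The cut-off is a bump function on S pulled back to T*S. Its support need not be compact, but it
  -- stays in the domain of the cotangent chart, which is a union of whole fibres.
  obtain ⟨χ, -, hχ⟩ := ((SmoothBumpFunction.nhds_basis_tsupport (I := 𝓡 r) β.1).mem_iff).1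
    ((isOpen_extChartAt_source β₀.1).mem_nhds hβ')
  have hcont : Continuous (fun β : CotangentBundle r S => β.1) :=
    FiberBundle.continuous_proj (Eu r →L[ℝ] ℝ)
      (fun x : S => TangentSpace (𝓡 r) x →L[ℝ] Trivial S ℝ x)
  refine ⟨fun β => χ β.1 • extChartAt (cotModel r) β₀ β, ?_, ?_⟩
  · refine contMDiff_of_tsupport fun β' hβ' => ?_
    have h1 : tsupport (fun β : CotangentBundle r S => χ β.1 • extChartAt (cotModel r) β₀ β) ⊆
        (fun β : CotangentBundle r S => β.1) ⁻¹' tsupport χ := by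
      refine closure_minimal (fun β hβ => ?_) ((isClosed_tsupport χ).preimage hcont)
      exact subset_tsupport χ fun h0 => hβ (by simp [h0])
    have h2 : β' ∈ (extChartAt (cotModel r) β₀).source := by
      rw [cot_extChartAt_source]
      exact hχ (h1 hβ')
    rw [extChartAt_source] at h2
    have h3 : ContMDiffAt (cotModel r) 𝓘(ℝ, ℝ) ∞ (fun β : CotangentBundle r S => χ β.1) β' :=
      (χ.contMDiff.comp (contMDiff_proj (n := ∞) (IB := 𝓡 r)
        (fun x : S => TangentSpace (𝓡 r) x →L[ℝ] Trivial S ℝ x))) β'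
    exact h3.smul (contMDiffAt_extChartAt' h2)
  · filter_upwards [hcont.continuousAt.eventually χ.eventuallyEq_one] with β' h
    rw [h]
    exact one_smul ℝ _

namespace ChaplyginSystem

section ReducedDynamics

variable {n r k : ℕ} {Q S G : Type*}
  [TopologicalSpace Q] [ChartedSpace (Eu n) Q] [IsManifold (𝓡 n) ∞ Q]
  [TopologicalSpace S] [ChartedSpace (Eu r) S] [IsManifold (𝓡 r) ∞ S]
  [TopologicalSpace G] [ChartedSpace (Eu k) G] [Group G] [LieGroup (𝓡 k) ∞ G]
  [MulAction G Q] (C : ChaplyginSystem n r k Q S G)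

/-- Over β at π(q) lies the composition of β with T_q π restricted to D_q. Surjectivity is what lets
the relation with X_nh determine the reduced field at every point. -/
theorem exists_redProj_eq (β : CotangentBundle r S) : ∃ b : C.DualBundle, C.redProj b = β := by
  obtain ⟨s, a⟩ := β
  obtain ⟨q, rfl⟩ := C.pr_surjective s
  refine ⟨⟨q, (a : TangentSpace (𝓡 r) (C.pr q) →L[ℝ] ℝ).toLinearMap ∘ₗ C.tangentD q⟩, ?_⟩
  refine congrArg (TotalSpace.mk (C.pr q)) ?_
  ext v
  exact congrArg (a : TangentSpace (𝓡 r) (C.pr q) →L[ℝ] ℝ) (C.tangentD_horLift q v)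

variable {C} in
/-- A vector is determined by its action on smooth functions. -/
theorem dChart_eq_reducedField [T2Space S] {β₀ : CotangentBundle r S} {b : C.DualBundle}
    (hb : C.redProj b ∈ (extChartAt (cotModel r) β₀).source)
    {V : TangentSpace (cotModel r) (C.redProj b)}
    (hV : ∀ φ : CotangentBundle r S → ℝ, ContMDiff (cotModel r) 𝓘(ℝ, ℝ) ∞ φ →
      cotDiff φ (C.redProj b) V =
        C.nhBracket (fun b' => φ (C.redProj b')) C.constrainedHamiltonian b) :
    dChart (cotModel r) β₀ (C.redProj b) V =
      C.reducedField β₀.1 (extChartAt (cotModel r) β₀ (C.redProj b)) := by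
  have hd : b.1 ∈ C.shapeDomain β₀.1 := by
    rw [cot_extChartAt_source] at hb
    exact hb
  -- Linear functionals of the chart, extended to global smooth functions, serve as test functions
  -- and recover all coordinates of the vector.
  obtain ⟨φ, hφ, hφe⟩ := exists_contMDiff_eventuallyEq_extChartAt hb
  refine (SeparatingDual.eq_iff_forall_dual_eq (R := ℝ)).2 fun ℓ => ?_
  have hs : ContMDiff (cotModel r) 𝓘(ℝ, ℝ) ∞ (fun β => ℓ (φ β)) := ℓ.contMDiff.comp hφ
  have hm : MDifferentiableAt (cotModel r) 𝓘(ℝ, ℝ) (fun β => ℓ (φ β)) (C.redProj b) :=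
    hs.mdifferentiableAt (by simp)
  have h := hV _ hs
  rw [cotDiff_eq_inChart hb hm, nhBracket_eq_reducedField hd hm] at h
  have hz := (extChartAt (cotModel r) β₀).map_source hb
  have hev : (fun z => ℓ (φ ((extChartAt (cotModel r) β₀).symm z)))
      =ᶠ[𝓝 (extChartAt (cotModel r) β₀ (C.redProj b))] ℓ := by
    have hc := (mdifferentiableAt_extChartAt_symm (J := cotModel r) hz).continuousAt
    rw [ContinuousAt, (extChartAt (cotModel r) β₀).left_inv hb] at hc
    filter_upwards [hc.eventually hφe, extChartAt_target_mem_nhds_of_mem hz] with z h1 h2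
    rw [h1, (extChartAt (cotModel r) β₀).right_inv h2]
  rw [hev.fderiv_eq, ℓ.fderiv] at h
  exact h

variable {C} in
theorem cotDiff_dChartInv_reducedField {φ : CotangentBundle r S → ℝ} {β₀ : CotangentBundle r S}
    {b : C.DualBundle} (hb : C.redProj b ∈ (extChartAt (cotModel r) β₀).source)
    (hφ : MDifferentiableAt (cotModel r) 𝓘(ℝ, ℝ) φ (C.redProj b)) :
    cotDiff φ (C.redProj b) (dChartInv (cotModel r) β₀ (C.redProj b)
      (C.reducedField β₀.1 (extChartAt (cotModel r) β₀ (C.redProj b)))) =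
        C.nhBracket (fun b' => φ (C.redProj b')) C.constrainedHamiltonian b := by
  have hd : b.1 ∈ C.shapeDomain β₀.1 := by
    rw [cot_extChartAt_source] at hb
    exact hb
  rw [nhBracket_eq_reducedField hd hφ, cotDiff_eq_inChart hb hφ, dChart_dChartInv hb]

variable {C} in
/-- The reduced dynamics in coordinates. -/
theorem IsReducedDynamics.vectorFieldInChart_eq [T2Space S]
    {X : ∀ β : CotangentBundle r S, TangentSpace (cotModel r) β} (hX : C.IsReducedDynamics X)
    (β₀ : CotangentBundle r S) {z : Eu r × (Eu r →L[ℝ] ℝ)}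
    (hz : z ∈ (extChartAt (cotModel r) β₀).target) :
    vectorFieldInChart X β₀ z = C.reducedField β₀.1 z := by
  obtain ⟨b, hb⟩ := C.exists_redProj_eq ((extChartAt (cotModel r) β₀).symm z)
  have hs := (extChartAt (cotModel r) β₀).map_target hz
  have h := dChart_eq_reducedField (hb ▸ hs) (V := X (C.redProj b)) fun φ hφ => hX.2 φ hφ b
  rw [hb, (extChartAt (cotModel r) β₀).right_inv hz] at h
  exact h

theorem contDiffOn_reducedField (β₀ : CotangentBundle r S) :
    ContDiffOn ℝ ∞ (C.reducedField β₀.1) (extChartAt (cotModel r) β₀).target := by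
  rw [cot_extChartAt_target]
  exact contDiffOn_gyroField (isOpen_extChartAt_target β₀.1) (contDiffOn_cometric β₀.1)
    (contDiffOn_potentialS β₀.1) (contDiffOn_gyroS β₀.1)

/-- The field is defined at each point by the preferred chart of that point. No transformation law
is needed: `huniq` shows that any related field has the expression `reducedField` in every chart,
and this yields both the smoothness of X and its uniqueness. -/
theorem existsUnique_isReducedDynamics [T2Space S] :
    ∃! X : ∀ β : CotangentBundle r S, TangentSpace (cotModel r) β, C.IsReducedDynamics X := by
  let X : ∀ β : CotangentBundle r S, TangentSpace (cotModel r) β := fun β =>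
    dChartInv (cotModel r) β β (C.reducedField β.1 (extChartAt (cotModel r) β β))
  have hX : ∀ φ : CotangentBundle r S → ℝ, ContMDiff (cotModel r) 𝓘(ℝ, ℝ) ∞ φ →
      ∀ b : C.DualBundle, cotDiff φ (C.redProj b) (X (C.redProj b))
        = C.nhBracket (fun b' => φ (C.redProj b')) C.constrainedHamiltonian b := fun φ hφ b =>
    cotDiff_dChartInv_reducedField (mem_extChartAt_source (C.redProj b))
      (hφ.mdifferentiableAt (by simp))
  have huniq : ∀ Y : ∀ β : CotangentBundle r S, TangentSpace (cotModel r) β,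
      (∀ φ : CotangentBundle r S → ℝ, ContMDiff (cotModel r) 𝓘(ℝ, ℝ) ∞ φ →
        ∀ b : C.DualBundle, cotDiff φ (C.redProj b) (Y (C.redProj b))
          = C.nhBracket (fun b' => φ (C.redProj b')) C.constrainedHamiltonian b) →
      ∀ β₀ β, β ∈ (extChartAt (cotModel r) β₀).source →
        dChart (cotModel r) β₀ β (Y β) = C.reducedField β₀.1 (extChartAt (cotModel r) β₀ β) := by
    intro Y hY β₀ β hβ
    obtain ⟨b, rfl⟩ := C.exists_redProj_eq β
    exact dChart_eq_reducedField hβ fun φ hφ => hY φ hφ b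
  refine ⟨X, ⟨fun β => ?_, hX⟩, fun Y hY => ?_⟩
  · have hβ := mem_extChartAt_source (I := cotModel r) β
    have ht := (extChartAt (cotModel r) β).map_source hβ
    rw [contMDiffAt_vectorField_iff hβ]
    refine ((C.contDiffOn_reducedField β).contDiffAt
      (extChartAt_target_mem_nhds_of_mem ht)).congr_of_eventuallyEq ?_
    filter_upwards [extChartAt_target_mem_nhds_of_mem ht] with z hz
    have h := huniq X hX β _ ((extChartAt (cotModel r) β).map_target hz)
    rw [(extChartAt (cotModel r) β).right_inv hz] at h
    exact h
  · funext β
    have hβ := mem_extChartAt_source (I := cotModel r) β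
    exact dChart_injective hβ ((huniq Y hY.2 β β hβ).trans (huniq X hX β β hβ).symm)

end ReducedDynamics

end ChaplyginSystem

/-! ### The 1-form `Θ` in coordinates -/

section Charts

variable {F : Type*} [NormedAddCommGroup F] [NormedSpace ℝ F]
  {H : Type*} [TopologicalSpace H] {J : ModelWithCorners ℝ F H} [J.Boundaryless]
  {N : Type*} [TopologicalSpace N] [ChartedSpace H N] [IsManifold J ∞ N]

omit [J.Boundaryless] in
theorem trivializationAt_snd_eq_dChart {x₀ x : N} (hx : x ∈ (extChartAt J x₀).source)
    (v : TangentSpace J x) :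
    (trivializationAt F (TangentSpace J) x₀ ⟨x, v⟩).2 = dChart J x₀ x v := by
  rw [extChartAt_source] at hx
  refine Eq.trans ?_ (DFunLike.congr_fun
    (TangentBundle.continuousLinearMapAt_trivializationAt (I := J) hx) v)
  rw [Trivialization.continuousLinearMapAt_apply,
    Trivialization.coe_linearMapAt_of_mem _ (by exact hx)]

omit [J.Boundaryless] [IsManifold J ∞ N] in
theorem vectorFieldInChart_extChartAt (X : ∀ x : N, TangentSpace J x) {x₀ x : N}
    (hx : x ∈ (extChartAt J x₀).source) :
    vectorFieldInChart X x₀ (extChartAt J x₀ x) = dChart J x₀ x (X x) := by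
  rw [vectorFieldInChart_eq_dChart, (extChartAt J x₀).left_inv hx]

/-- Every tangent vector extends to a smooth vector field. -/
theorem exists_contMDiff_vectorField [FiniteDimensional ℝ F] [T2Space N] (x₀ : N) (v : F) :
    ∃ Y : ∀ x : N, TangentSpace J x,
      ContMDiff J J.tangent ∞ (fun x => (⟨x, Y x⟩ : TangentBundle J N)) ∧
        dChart J x₀ x₀ (Y x₀) = v := by
  obtain ⟨χ, -, hχ⟩ := ((SmoothBumpFunction.nhds_basis_tsupport (I := J) x₀).mem_iff).1
    ((isOpen_extChartAt_source (I := J) x₀).mem_nhds (mem_extChartAt_source x₀))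
  have hd : ∀ x ∈ (extChartAt J x₀).source,
      dChart J x₀ x (χ x • dChartInv J x₀ x v) = χ x • v := fun x hx => by
    rw [map_smul, dChart_dChartInv hx]
  refine ⟨fun x => χ x • dChartInv J x₀ x v, fun x => ?_, ?_⟩
  · by_cases hx : x ∈ tsupport χ
    · have hxs := hχ hx
      have hxt := (extChartAt J x₀).map_source hxs
      rw [contMDiffAt_vectorField_iff hxs]
      have h1 : ContDiffAt ℝ ∞ (fun y => χ ((extChartAt J x₀).symm y)) (extChartAt J x₀ x) :=
        (contMDiffAt_comp_extChartAt_symm_iff hxs).1 χ.contMDiff.contMDiffAt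
      refine (h1.smul (contDiffAt_const (c := v))).congr_of_eventuallyEq ?_
      filter_upwards [extChartAt_target_mem_nhds_of_mem hxt] with y hy
      exact hd _ ((extChartAt J x₀).map_target hy)
    · rw [contMDiffAt_vectorField_iff (mem_extChartAt_source x)]
      refine (contDiffAt_const (c := (0 : F))).congr_of_eventuallyEq ?_
      have hxt := (extChartAt J x).map_source (mem_extChartAt_source x)
      have hc := (mdifferentiableAt_extChartAt_symm (J := J) hxt).continuousAt
      rw [ContinuousAt, (extChartAt J x).left_inv (mem_extChartAt_source x)] at hc
      filter_upwards [hc.eventually (notMem_tsupport_iff_eventuallyEq.1 hx)] with y hy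
      have h0 : χ ((extChartAt J x).symm y) = 0 := hy
      rw [vectorFieldInChart_eq_dChart, h0, zero_smul, map_zero]
  · rw [hd x₀ (mem_extChartAt_source x₀), χ.eq_one, one_smul]

end Charts

namespace ChaplyginSystem

/-! ### Tensoriality of the gyroscopic tensor and Θ as its trace -/

section Theta

variable {n r k : ℕ} {Q S G : Type*}
  [TopologicalSpace Q] [ChartedSpace (Eu n) Q] [IsManifold (𝓡 n) ∞ Q]
  [TopologicalSpace S] [ChartedSpace (Eu r) S] [IsManifold (𝓡 r) ∞ S]
  [TopologicalSpace G] [ChartedSpace (Eu k) G] [Group G] [LieGroup (𝓡 k) ∞ G]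
  [MulAction G Q] (C : ChaplyginSystem n r k Q S G)

variable {C} in
theorem hor_eq_horC {s₀ : S} {q : Q} (hq : q ∈ C.shapeDomain s₀)
    (Y : ∀ s : S, TangentSpace (𝓡 r) s) :
    C.hor Y q = C.horC s₀ q (vectorFieldInChart Y s₀ (C.shapeCoord s₀ q)) := by
  rw [shapeCoord, vectorFieldInChart_extChartAt Y hq, horC_apply, dChartInv_dChart hq]
  rfl

variable {C} in
theorem vectorFieldInChart_hor {s₀ : S} {q₀ : Q} {x : Eu n}
    (hx : (extChartAt (𝓡 n) q₀).symm x ∈ C.shapeDomain s₀) (Y : ∀ s : S, TangentSpace (𝓡 r) s) :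
    vectorFieldInChart (C.hor Y) q₀ x = C.horCoord s₀ q₀ x (vectorFieldInChart Y s₀
      (C.shapeCoord s₀ ((extChartAt (𝓡 n) q₀).symm x))) := by
  rw [vectorFieldInChart_eq_dChart, hor_eq_horC hx]
  rfl

/-- The gyroscopic tensor in coordinates is `C^∞`-linear. -/
theorem dChart_gyroAt (q : Q) {X Y : ∀ s : S, TangentSpace (𝓡 r) s} {w : Eu r}
    (hX : ∀ᶠ s in 𝓝 (C.pr q), X s = dChartInv (𝓡 r) (C.pr q) s w)
    (hY : ContMDiffAt (𝓡 r) (𝓡 r).tangent ∞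
      (fun s => (⟨s, Y s⟩ : TangentBundle (𝓡 r) S)) (C.pr q)) :
    dChart (𝓡 r) (C.pr q) (C.pr q) (C.gyroAt X Y q) =
      C.gyroC (C.pr q) q w (dChart (𝓡 r) (C.pr q) (C.pr q) (Y (C.pr q))) := by
  set s := C.pr q with hs
  have hsm := mem_extChartAt_source (I := 𝓡 r) s
  have hq : q ∈ C.shapeDomain s := hsm
  have hx := mem_extChartAt_source (I := 𝓡 n) q
  have hxt := (extChartAt (𝓡 n) q).map_source hx
  set x₀ := extChartAt (𝓡 n) q q with hx₀
  have hqq : (extChartAt (𝓡 n) q).symm x₀ = q := (extChartAt (𝓡 n) q).left_inv hx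
  set y := extChartAt (𝓡 r) s s with hy
  have hyt : y ∈ (extChartAt (𝓡 r) s).target := (extChartAt (𝓡 r) s).map_source hsm
  set Yc := vectorFieldInChart Y s with hYc
  have hYd : DifferentiableAt ℝ Yc y :=
    ((contMDiffAt_vectorField_iff hsm).1 hY).differentiableAt (by simp)
  have hYv : Yc y = dChart (𝓡 r) s s (Y s) := vectorFieldInChart_extChartAt Y hsm
  -- The bracket on the base.
  have hXc : vectorFieldInChart X s =ᶠ[𝓝 y] fun _ => w := by
    have hc := (mdifferentiableAt_extChartAt_symm (J := 𝓡 r) hyt).continuousAt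
    rw [ContinuousAt, (extChartAt (𝓡 r) s).left_inv hsm] at hc
    filter_upwards [hc.eventually hX, extChartAt_target_mem_nhds_of_mem hyt] with y' h1 h2
    rw [vectorFieldInChart_eq_dChart, h1, dChart_dChartInv ((extChartAt (𝓡 r) s).map_target h2)]
  have hbase : dChart (𝓡 r) s s (VectorField.mlieBracket (𝓡 r) X Y s) = fderiv ℝ Yc y w := by
    rw [dChart_mlieBracket, ← hy, ← hYc, hXc.fderiv_eq, hXc.eq_of_nhds]
    simp
  -- The bracket of the horizontal lifts.
  have hnear : ∀ᶠ x in 𝓝 x₀, (extChartAt (𝓡 n) q).symm x ∈ C.shapeDomain s := by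
    refine (mdifferentiableAt_extChartAt_symm hxt).continuousAt.eventually_mem ?_
    rw [hqq]
    exact (C.isOpen_shapeDomain s).mem_nhds hq
  set A := C.horCoord s q
  set u : Eu n → Eu r := fun x => C.shapeCoord s ((extChartAt (𝓡 n) q).symm x)
  have hu0 : u x₀ = y := congrArg (C.shapeCoord s) hqq
  have hud : DifferentiableAt ℝ u x₀ :=
    ((contMDiffAt_comp_extChartAt_symm_iff hx).1 (contMDiffAt_shapeCoord hq)).differentiableAt
      (by simp)
  have hAd : DifferentiableAt ℝ A x₀ := (contDiffAt_horCoord hq hx).differentiableAt (by simp)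
  have hAw : ∀ w, A x₀ w = dChart (𝓡 n) q q (C.horC s q w) := by
    intro w
    change dChart (𝓡 n) q ((extChartAt (𝓡 n) q).symm x₀)
      (C.horC s ((extChartAt (𝓡 n) q).symm x₀) w) = _
    rw [hqq]
  have hdu : ∀ w, fderiv ℝ u x₀ (A x₀ w) = w := by
    intro w
    rw [hAw]
    exact (fderiv_shapeCoord_inChart hq hx _).trans (dShape_horC hq w)
  have hhX : vectorFieldInChart (C.hor X) q =ᶠ[𝓝 x₀] fun x => A x w := by
    have hXu : ∀ᶠ x in 𝓝 x₀, vectorFieldInChart X s (u x) = w :=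
      (hud.continuousAt.tendsto.eventually (hu0 ▸ hXc))
    filter_upwards [hnear, hXu] with x h1 h2
    rw [vectorFieldInChart_hor h1]
    exact congrArg (A x) h2
  have hhY : vectorFieldInChart (C.hor Y) q =ᶠ[𝓝 x₀] fun x => A x (Yc (u x)) := by
    filter_upwards [hnear] with x h1
    exact vectorFieldInChart_hor h1 Y
  have hYu : HasFDerivAt (fun x => Yc (u x)) ((fderiv ℝ Yc y).comp (fderiv ℝ u x₀)) x₀ := by
    have h1 : HasFDerivAt Yc (fderiv ℝ Yc y) (u x₀) := hu0 ▸ hYd.hasFDerivAt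
    exact h1.comp x₀ hud.hasFDerivAt
  have hd1 := hAd.hasFDerivAt.clm_apply (hasFDerivAt_const w x₀)
  have hd2 := hAd.hasFDerivAt.clm_apply hYu
  -- By the Leibniz rule the bracket of the lifts is the tensorial term plus the horizontal lift of
  -- DY(w). Since X is constant in the chart, DY(w) is [X, Y], so subtracting the bracket on the
  -- base leaves the tensorial term.
  have htop : dChart (𝓡 n) q q (VectorField.mlieBracket (𝓡 n) (C.hor X) (C.hor Y) q) =
      C.horBracketCoord s q w (Yc y) + A x₀ (fderiv ℝ Yc y w) := by
    rw [dChart_mlieBracket, ← hx₀, hhX.fderiv_eq, hhY.fderiv_eq, hhX.eq_of_nhds, hhY.eq_of_nhds,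
      hd1.fderiv, hd2.fderiv, horBracketCoord_apply, hu0]
    simp only [add_apply, ContinuousLinearMap.comp_apply, hdu,
      ContinuousLinearMap.flip_apply, zero_apply, map_zero]
    abel
  have htop' : VectorField.mlieBracket (𝓡 n) (C.hor X) (C.hor Y) q =
      dChartInv (𝓡 n) q q (C.horBracketCoord s q w (Yc y)) + C.horC s q (fderiv ℝ Yc y w) := by
    rw [← dChartInv_dChart hx (VectorField.mlieBracket (𝓡 n) (C.hor X) (C.hor Y) q), htop, map_add,
      hAw, dChartInv_dChart hx]
  have hproj : C.baseProj s q (VectorField.mlieBracket (𝓡 n) (C.hor X) (C.hor Y) q) =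
      C.gyroC s q w (Yc y) + fderiv ℝ Yc y w := by
    have h1 : C.baseProj s q (C.horC s q (fderiv ℝ Yc y w)) = fderiv ℝ Yc y w := by
      have h2 := C.proj_apply_of_mem q ⟨_, C.horC_mem_D s q (fderiv ℝ Yc y w)⟩
      rw [baseProj_apply]
      exact (congrArg (fun v : C.D q => C.dShape s q v) h2).trans (dShape_horC hq _)
    rw [htop', map_add, h1, gyroC_apply]
  have h3 := map_sub (dChart (𝓡 r) s s)
    (C.tangentD q (C.proj q (VectorField.mlieBracket (𝓡 n) (C.hor X) (C.hor Y) q)))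
    (VectorField.mlieBracket (𝓡 r) X Y s)
  refine h3.trans ?_
  rw [hbase, ← hYv]
  exact sub_eq_of_eq_add hproj

/-- The 1-form `Θ` in coordinates. -/
theorem theta_eq_trace {Y : ∀ s : S, TangentSpace (𝓡 r) s}
    (hY : ContMDiff (𝓡 r) (𝓡 r).tangent ∞ (fun s => (⟨s, Y s⟩ : TangentBundle (𝓡 r) S))) (s : S) :
    C.theta Y s = LinearMap.trace ℝ (Eu r)
      ((C.gyroS s (extChartAt (𝓡 r) s s)).flip (dChart (𝓡 r) s s (Y s))).toLinearMap := by
  have hsm := mem_extChartAt_source (I := 𝓡 r) s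
  set e := trivializationAt (Eu r) (TangentSpace (𝓡 r)) s with he
  set β := (EuclideanSpace.basisFun (Fin r) ℝ).toBasis with hβ
  have hbs : e.baseSet = (extChartAt (𝓡 r) s).source := by rw [extChartAt_source]; rfl
  have hfr : ∀ j, ∀ x ∈ (extChartAt (𝓡 r) s).source,
      e.localFrame β j x = dChartInv (𝓡 r) s x (β j) := by
    intro j x hx
    have hxb : x ∈ e.baseSet := hbs ▸ hx
    refine dChart_injective hx ?_
    rw [dChart_dChartInv hx, ← trivializationAt_snd_eq_dChart hx,
      e.localFrame_apply_of_mem_baseSet β hxb]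
    simp [Trivialization.basisAt, ← he, hxb]
  have hgy : ∀ j, dChart (𝓡 r) s s (C.gyro (e.localFrame β j) Y s) =
      C.gyroS s (extChartAt (𝓡 r) s s) (β j) (dChart (𝓡 r) s s (Y s)) := by
    intro j
    -- Generalizing the base point turns the transport along π(q) = s in the definition of `gyro`
    -- into the identity.
    have hcast : ∀ (q : Q) (s : S) (h : C.pr q = s) (X : ∀ s : S, TangentSpace (𝓡 r) s) (w : Eu r),
        (∀ᶠ x in 𝓝 s, X x = dChartInv (𝓡 r) s x w) →
        dChart (𝓡 r) s s (h ▸ C.gyroAt X Y q) = C.gyroC s q w (dChart (𝓡 r) s s (Y s)) := by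
      rintro q _ rfl X w hX
      exact C.dChart_gyroAt q hX hY.contMDiffAt
    have hp : C.point s ∈ C.shapeDomain s := by
      rw [shapeDomain, mem_preimage, C.pr_point]
      exact hsm
    have hsc : C.shapeCoord s (C.point s) = extChartAt (𝓡 r) s s := by
      rw [shapeCoord, C.pr_point]
    rw [← hsc, gyroS_shapeCoord hp]
    exact hcast _ _ (C.pr_point s) _ _
      (Filter.eventually_of_mem ((isOpen_extChartAt_source s).mem_nhds hsm) (hfr j))
  have hco : ∀ j (hX : IsLocalFrameOn (𝓡 r) (Eu r) ∞ (e.localFrame β) e.baseSet)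
      (v : TangentSpace (𝓡 r) s), hX.coeff j s v = dChart (𝓡 r) s s v j := by
    intro j hX v
    have hsb : s ∈ e.baseSet := hbs ▸ hsm
    have h1 : hX.coeff j s v = (hX.toBasisAt hsb).repr v j := by
      simp [IsLocalFrameOn.coeff, hsb]
    have h2 := (hX.toBasisAt hsb).sum_repr v
    have h3 : ∀ i, dChart (𝓡 r) s s ((hX.toBasisAt hsb).repr v i • hX.toBasisAt hsb i) =
        (hX.toBasisAt hsb).repr v i • EuclideanSpace.basisFun (Fin r) ℝ i := by
      intro i
      rw [map_smul, IsLocalFrameOn.toBasisAt_coe, hfr i s hsm, dChart_dChartInv hsm]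
      exact congrArg _ (congrFun (EuclideanSpace.basisFun (Fin r) ℝ).coe_toBasis i)
    have h4 : dChart (𝓡 r) s s v =
        ∑ i, (hX.toBasisAt hsb).repr v i • EuclideanSpace.basisFun (Fin r) ℝ i := by
      rw [← Finset.sum_congr rfl fun i _ => h3 i, ← map_sum, h2]
    rw [h1, h4]
    simp [Pi.single_apply]
  rw [theta, frameTrace, LinearMap.trace_eq_sum_inner _ (EuclideanSpace.basisFun (Fin r) ℝ)]
  refine Finset.sum_congr rfl fun j _ => ?_
  rw [hco, hgy, hβ, OrthonormalBasis.coe_toBasis, EuclideanSpace.basisFun_inner]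
  rfl

/-- `ThetaEqDiff` tests against global smooth fields. Every tangent vector extends to such a field
by a bump function, so the condition is equivalent to a pointwise one. -/
theorem thetaEqDiff_iff [T2Space S] {σ : S → ℝ} (hσ : ContMDiff (𝓡 r) 𝓘(ℝ, ℝ) ∞ σ) :
    C.ThetaEqDiff σ ↔ ∀ (s : S) (v : Eu r),
      LinearMap.trace ℝ (Eu r) ((C.gyroS s (extChartAt (𝓡 r) s s)).flip v).toLinearMap =
        fderiv ℝ (fun y => σ ((extChartAt (𝓡 r) s).symm y)) (extChartAt (𝓡 r) s s) v := by
  have hd : ∀ (s : S) (v : TangentSpace (𝓡 r) s), mfderiv (𝓡 r) 𝓘(ℝ, ℝ) σ s v =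
      fderiv ℝ (fun y => σ ((extChartAt (𝓡 r) s).symm y)) (extChartAt (𝓡 r) s s)
        (dChart (𝓡 r) s s v) := fun s v =>
    mfderiv_eq_fderiv_dChart (mem_extChartAt_source s) (hσ.mdifferentiableAt (by simp)) v
  constructor
  · intro h s v
    obtain ⟨Y, hY, hYv⟩ := exists_contMDiff_vectorField (J := 𝓡 r) s v
    have h1 := h Y hY s
    rwa [hd, C.theta_eq_trace hY, hYv] at h1
  · intro h Y hY s
    rw [hd, C.theta_eq_trace hY, h]

end Theta

end ChaplyginSystem

/-! ### Invariant volume forms of the reduced dynamics -/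

section ZeroSection

variable {r : ℕ} {S : Type*} [TopologicalSpace S] [ChartedSpace (Eu r) S]
  [IsManifold (𝓡 r) ∞ S]

theorem contMDiff_covector_zero :
    ContMDiff (𝓡 r) (cotModel r) ∞ (fun s : S => (covector s 0 : CotangentBundle r S)) :=
  Bundle.contMDiff_zeroSection (n := ∞) (IB := 𝓡 r) ℝ
    (fun x : S => TangentSpace (𝓡 r) x →L[ℝ] Trivial S ℝ x)

theorem contMDiff_comp_cot_proj {σ : S → ℝ} (hσ : ContMDiff (𝓡 r) 𝓘(ℝ, ℝ) ∞ σ) :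
    ContMDiff (cotModel r) 𝓘(ℝ, ℝ) ∞ (fun β : CotangentBundle r S => σ β.1) :=
  hσ.comp (contMDiff_proj (n := ∞) (IB := 𝓡 r)
    (fun x : S => TangentSpace (𝓡 r) x →L[ℝ] Trivial S ℝ x))

/-- The preferred charts of the cotangent bundle depend on the base point only. -/
theorem cot_extChartAt_eq (s : S) (a a' : TangentSpace (𝓡 r) s →L[ℝ] ℝ) :
    extChartAt (cotModel r) (covector s a : CotangentBundle r S) =
      extChartAt (cotModel r) (covector s a') := by
  rw [FiberBundle.extChartAt, FiberBundle.extChartAt]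
  rfl

theorem cot_extChartAt_covector (s : S) (a : TangentSpace (𝓡 r) s →L[ℝ] ℝ)
    (ξ : Eu r →L[ℝ] ℝ) :
    extChartAt (cotModel r) (covector s a : CotangentBundle r S)
      (covector s (ξ.comp (dChart (𝓡 r) s s))) = (extChartAt (𝓡 r) s s, ξ) := by
  have hs := mem_extChartAt_source (I := 𝓡 r) s
  rw [cot_extChartAt_apply (covector s a) (covector s (ξ.comp (dChart (𝓡 r) s s))) hs]
  refine Prod.ext rfl ?_
  ext w
  exact congrArg ξ (dChart_dChartInv hs w)

end ZeroSection

namespace ChaplyginSystem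

/-! ### The divergence criterion for the reduced dynamics and its consequences -/

section InvariantVolume

variable {n r k : ℕ} {Q S G : Type*}
  [TopologicalSpace Q] [ChartedSpace (Eu n) Q] [IsManifold (𝓡 n) ∞ Q]
  [TopologicalSpace S] [T2Space S] [ChartedSpace (Eu r) S] [IsManifold (𝓡 r) ∞ S]
  [TopologicalSpace G] [ChartedSpace (Eu k) G] [Group G] [LieGroup (𝓡 k) ∞ G]
  [MulAction G Q] {C : ChaplyginSystem n r k Q S G}
  {X : ∀ β : CotangentBundle r S, TangentSpace (cotModel r) β}

/-- The reduced dynamics preserves `exp (ρ) ν` if and only if `dρ` and the divergence cancel. -/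
theorem IsReducedDynamics.preservesForm_iff (hX : C.IsReducedDynamics X)
    {ρ : CotangentBundle r S → ℝ} (hρ : ContMDiff (cotModel r) 𝓘(ℝ, ℝ) ∞ ρ) :
    PreservesForm X (expVolume ρ) ↔ ∀ (s : S) (ξ : Eu r →L[ℝ] ℝ),
      fderiv ℝ (fun z => ρ ((extChartAt (cotModel r) (covector s 0)).symm z))
        (extChartAt (𝓡 r) s s, ξ) (C.reducedField s (extChartAt (𝓡 r) s s, ξ)) =
      LinearMap.trace ℝ (Eu r) ((C.gyroS s (extChartAt (𝓡 r) s s)).flip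
        (C.cometric s (extChartAt (𝓡 r) s s) ξ)).toLinearMap := by
  -- The preferred cotangent chart depends only on the base point. All covectors at s can thus be
  -- treated in the chart of the zero covector, with ξ ranging over the whole fibre.
  have hkey : ∀ (s : S) (a : TangentSpace (𝓡 r) s →L[ℝ] ℝ) (ξ : Eu r →L[ℝ] ℝ),
      (fderiv ℝ (fun z => ρ ((extChartAt (cotModel r) (covector s a)).symm z))
        (extChartAt (𝓡 r) s s, ξ) (vectorFieldInChart X (covector s a) (extChartAt (𝓡 r) s s, ξ))
      + LinearMap.trace ℝ (Eu r × (Eu r →L[ℝ] ℝ))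
        (fderiv ℝ (vectorFieldInChart X (covector s a)) (extChartAt (𝓡 r) s s, ξ)) = 0) ↔
      fderiv ℝ (fun z => ρ ((extChartAt (cotModel r) (covector s 0)).symm z))
        (extChartAt (𝓡 r) s s, ξ) (C.reducedField s (extChartAt (𝓡 r) s s, ξ)) =
      LinearMap.trace ℝ (Eu r) ((C.gyroS s (extChartAt (𝓡 r) s s)).flip
        (C.cometric s (extChartAt (𝓡 r) s s) ξ)).toLinearMap := by
    intro s a ξ
    have hyt : extChartAt (𝓡 r) s s ∈ (extChartAt (𝓡 r) s).target :=
      (extChartAt (𝓡 r) s).map_source (mem_extChartAt_source s)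
    have hz : ((extChartAt (𝓡 r) s s, ξ) : Eu r × (Eu r →L[ℝ] ℝ)) ∈
        (extChartAt (cotModel r) (covector s a : CotangentBundle r S)).target := by
      rw [cot_extChartAt_target]
      exact ⟨hyt, mem_univ _⟩
    have hev : vectorFieldInChart X (covector s a) =ᶠ[𝓝 (extChartAt (𝓡 r) s s, ξ)]
        C.reducedField s := by
      filter_upwards [extChartAt_target_mem_nhds_of_mem hz] with z hz
      exact hX.vectorFieldInChart_eq (covector s a) hz
    rw [hev.fderiv_eq, hev.eq_of_nhds, cot_extChartAt_eq s a 0]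
    have ht := trace_fderiv_gyroField (ξ := ξ) (isOpen_extChartAt_target s) hyt
      (contDiffOn_cometric (C := C) s) (contDiffOn_potentialS (C := C) s) (contDiffOn_gyroS (C := C) s)
      (fun y hy ξ η => cometric_symm (C := C) hy ξ η) (fun w u => C.gyroC_antisymm _ _ w u)
    rw [show LinearMap.trace ℝ (Eu r × (Eu r →L[ℝ] ℝ))
      (fderiv ℝ (C.reducedField s) (extChartAt (𝓡 r) s s, ξ)).toLinearMap = _ from ht]
    exact add_neg_eq_zero
  rw [preservesForm_expVolume_iff (hρ.mdifferentiable (by simp))]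
  constructor
  · intro h s ξ
    refine (hkey s (ξ.comp (dChart (𝓡 r) s s)) ξ).1 ?_
    have h1 := h (covector s (ξ.comp (dChart (𝓡 r) s s)))
    rwa [cot_extChartAt_covector] at h1
  · rintro h ⟨s, a⟩
    have hz : extChartAt (cotModel r) (⟨s, a⟩ : CotangentBundle r S) ⟨s, a⟩ =
        (extChartAt (𝓡 r) s s, (extChartAt (cotModel r) (⟨s, a⟩ : CotangentBundle r S) ⟨s, a⟩).2) := by
      have h1 := cot_extChartAt_apply (⟨s, a⟩ : CotangentBundle r S) ⟨s, a⟩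
        (mem_extChartAt_source s)
      refine Prod.ext ?_ rfl
      rw [h1]
    rw [hz]
    exact (hkey s a _).2 (h s _)

/-- A basic density does not vary along the fibres, so the forces play no role and only the base
velocity M ξ enters dρ(X). -/
theorem IsReducedDynamics.preservesForm_basicVolume_iff_trace (hX : C.IsReducedDynamics X)
    {σ : S → ℝ} (hσ : ContMDiff (𝓡 r) 𝓘(ℝ, ℝ) ∞ σ) :
    PreservesForm X (basicVolume σ) ↔ ∀ (s : S) (ξ : Eu r →L[ℝ] ℝ),
      fderiv ℝ (fun y => σ ((extChartAt (𝓡 r) s).symm y)) (extChartAt (𝓡 r) s s)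
        (C.cometric s (extChartAt (𝓡 r) s s) ξ) =
      LinearMap.trace ℝ (Eu r) ((C.gyroS s (extChartAt (𝓡 r) s s)).flip
        (C.cometric s (extChartAt (𝓡 r) s s) ξ)).toLinearMap := by
  refine (hX.preservesForm_iff (contMDiff_comp_cot_proj hσ)).trans
    (forall_congr' fun s => forall_congr' fun ξ => ?_)
  have hs := mem_extChartAt_source (I := 𝓡 r) s
  have hyt := (extChartAt (𝓡 r) s).map_source hs
  have hz : ((extChartAt (𝓡 r) s s, ξ) : Eu r × (Eu r →L[ℝ] ℝ)) ∈
      (extChartAt (cotModel r) (covector s 0 : CotangentBundle r S)).target := by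
    rw [cot_extChartAt_target]
    exact ⟨hyt, mem_univ _⟩
  have hev : (fun z => σ ((extChartAt (cotModel r) (covector s 0 : CotangentBundle r S)).symm z).1)
      =ᶠ[𝓝 (extChartAt (𝓡 r) s s, ξ)]
        (fun y => σ ((extChartAt (𝓡 r) s).symm y)) ∘ Prod.fst := by
    filter_upwards [extChartAt_target_mem_nhds_of_mem hz] with z hz
    exact congrArg σ (cot_proj_symm (covector s 0) hz)
  have hd : DifferentiableAt ℝ (fun y => σ ((extChartAt (𝓡 r) s).symm y)) (extChartAt (𝓡 r) s s) :=
    ((contMDiffAt_comp_extChartAt_symm_iff hs).1 hσ.contMDiffAt).differentiableAt (by simp)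
  have hfst : HasFDerivAt Prod.fst (ContinuousLinearMap.fst ℝ (Eu r) (Eu r →L[ℝ] ℝ))
      (extChartAt (𝓡 r) s s, ξ) := hasFDerivAt_fst
  have h2 := HasFDerivAt.comp (extChartAt (𝓡 r) s s, ξ)
    (g := fun y => σ ((extChartAt (𝓡 r) s).symm y)) hd.hasFDerivAt hfst
  rw [hev.fderiv_eq, h2.fderiv]
  rfl

/-- The reduced dynamics preserves a basic volume form if and only if `Θ = dσ`. -/
theorem IsReducedDynamics.preservesForm_basicVolume_iff (hX : C.IsReducedDynamics X)
    {σ : S → ℝ} (hσ : ContMDiff (𝓡 r) 𝓘(ℝ, ℝ) ∞ σ) :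
    PreservesForm X (basicVolume σ) ↔ C.ThetaEqDiff σ := by
  rw [hX.preservesForm_basicVolume_iff_trace hσ, C.thetaEqDiff_iff hσ]
  refine forall_congr' fun s => ⟨fun h v => ?_, fun h ξ => (h _).symm⟩
  -- The velocities M ξ fill the tangent space, so the two covectors agree on every v.
  obtain ⟨ξ, rfl⟩ := cometric_surjective (C := C)
    ((extChartAt (𝓡 r) s).map_source (mem_extChartAt_source (I := 𝓡 r) s)) v
  exact (h ξ).symm

/-- Without potential energy, the density of an invariant volume form may be replaced by its
restriction to the zero section. -/
theorem IsReducedDynamics.preservesForm_zeroSection (hX : C.IsReducedDynamics X)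
    (hU : ∀ q, C.U q = 0) {ρ : CotangentBundle r S → ℝ}
    (hρ : ContMDiff (cotModel r) 𝓘(ℝ, ℝ) ∞ ρ) (h : PreservesForm X (expVolume ρ)) :
    PreservesForm X (basicVolume fun s : S => ρ (covector s 0)) := by
  refine (hX.preservesForm_basicVolume_iff_trace (σ := fun s : S => ρ (covector s 0))
    (hρ.comp contMDiff_covector_zero)).2 fun s η => ?_
  have h0 := (hX.preservesForm_iff hρ).1 h s
  have hs := mem_extChartAt_source (I := 𝓡 r) s
  set y := extChartAt (𝓡 r) s s
  have hyt : y ∈ (extChartAt (𝓡 r) s).target := (extChartAt (𝓡 r) s).map_source hs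
  set e := extChartAt (cotModel r) (covector s 0 : CotangentBundle r S) with he
  set g : Eu r × (Eu r →L[ℝ] ℝ) → ℝ := fun z => ρ (e.symm z) with hg
  set v := C.cometric s y η with hv
  have hz : ((y, 0) : Eu r × (Eu r →L[ℝ] ℝ)) ∈ e.target := by
    rw [he, cot_extChartAt_target]
    exact ⟨hyt, mem_univ _⟩
  have hgs : ContDiffAt ℝ ∞ g (y, 0) :=
    ((hρ.comp_contMDiffOn (contMDiffOn_extChartAt_symm _)).contDiffOn).contDiffAt
      (extChartAt_target_mem_nhds_of_mem hz)
  have hU0 : C.potentialS s = 0 := funext fun y => hU _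
  set f : Eu r →L[ℝ] ℝ := (1 / 2 : ℝ) • η.comp ((fderiv ℝ (C.cometric s) y).flip η)
    + η.comp ((C.gyroS s y).flip v) with hf
  -- Without potential the velocity is linear and the force quadratic in the momentum. With U ≠ 0
  -- the force would have a term of order 0 in t, which could not be divided by t.
  have hfield : ∀ t : ℝ, C.reducedField s (y, t • η) = t • (v, -(t • f)) := by
    intro t
    refine Prod.ext (map_smul (C.cometric s y) t η) ?_
    change -((1 / 2 : ℝ) • (t • η).comp ((fderiv ℝ (C.cometric s) y).flip (t • η))
      + fderiv ℝ (C.potentialS s) y + (t • η).comp ((C.gyroS s y).flip (C.cometric s y (t • η))))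
      = t • -(t • f)
    rw [hU0]
    ext w
    simp [hf, hv]
    ring
  have hne : ∀ t : ℝ, t ≠ 0 → fderiv ℝ g (y, t • η) (v, -(t • f)) =
      LinearMap.trace ℝ (Eu r) ((C.gyroS s y).flip v).toLinearMap := by
    intro t ht
    have h1 := h0 (t • η)
    rw [hfield, map_smul, map_smul, map_smul] at h1
    have h2 : ((t • (C.gyroS s y).flip (C.cometric s y η) : Eu r →L[ℝ] Eu r)).toLinearMap =
      t • ((C.gyroS s y).flip v).toLinearMap := rfl
    rw [h2, map_smul] at h1
    exact smul_right_injective ℝ ht h1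
  have hcont : ContinuousAt (fun t : ℝ => fderiv ℝ g (y, t • η) (v, -(t • f))) 0 := by
    have h1 : ContinuousAt (fderiv ℝ g) (y, 0) :=
      (hgs.fderiv_right (m := ∞) (by simp)).continuousAt
    have h2 : ContinuousAt (fun t : ℝ => fderiv ℝ g (y, t • η)) 0 := by
      refine ContinuousAt.comp (g := fderiv ℝ g) (f := fun t : ℝ => (y, t • η)) ?_
        (by fun_prop)
      rwa [zero_smul]
    exact h2.clm_apply (by fun_prop)
  -- After division by t the right-hand side no longer depends on t. The left-hand side is
  -- continuous at t = 0, where the force component disappears and a derivative along the zero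
  -- section remains.
  have hlim : fderiv ℝ g (y, 0) (v, 0) =
      LinearMap.trace ℝ (Eu r) ((C.gyroS s y).flip v).toLinearMap := by
    have h1 : Tendsto (fun t : ℝ => fderiv ℝ g (y, t • η) (v, -(t • f))) (𝓝[≠] 0)
        (𝓝 (fderiv ℝ g (y, 0) (v, 0))) := by
      have h2 := hcont.tendsto.mono_left (nhdsWithin_le_nhds (s := {0}ᶜ))
      simpa using h2
    have h2 : Tendsto (fun t : ℝ => fderiv ℝ g (y, t • η) (v, -(t • f))) (𝓝[≠] 0)
        (𝓝 (LinearMap.trace ℝ (Eu r) ((C.gyroS s y).flip v).toLinearMap)) := by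
      refine tendsto_const_nhds.congr' ?_
      filter_upwards [self_mem_nhdsWithin] with t ht
      exact (hne t ht).symm
    exact tendsto_nhds_unique h1 h2
  have hzero : (fun y => ρ (covector ((extChartAt (𝓡 r) s).symm y) 0)) =ᶠ[𝓝 y]
      fun y => g (y, 0) := by
    filter_upwards [extChartAt_target_mem_nhds_of_mem hyt] with y' hy'
    refine congrArg ρ ?_
    refine Eq.trans ?_ (cot_extChartAt_symm_apply (covector s 0) 0 hy').symm
    rfl
  have hpair := (hgs.differentiableAt (by simp)).hasFDerivAt.comp y
    (hasFDerivAt_prodMk_left (𝕜 := ℝ) y (0 : Eu r →L[ℝ] ℝ))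
  rw [← hlim]
  refine (DFunLike.congr_fun hzero.fderiv_eq v).trans ?_
  exact DFunLike.congr_fun hpair.fderiv v

end InvariantVolume

end ChaplyginSystem

theorem theoremT {n r k : ℕ} (hr : 2 ≤ r) (hrn : r < n) {Q S G : Type*}
    [TopologicalSpace Q] [T2Space Q] [SecondCountableTopology Q]
    [ChartedSpace (Eu n) Q] [IsManifold (𝓡 n) ∞ Q]
    [TopologicalSpace S] [T2Space S] [SecondCountableTopology S]
    [ChartedSpace (Eu r) S] [IsManifold (𝓡 r) ∞ S]
    [TopologicalSpace G] [ChartedSpace (Eu k) G] [Group G] [LieGroup (𝓡 k) ∞ G]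
    [MulAction G Q] (C : ChaplyginSystem n r k Q S G) :
    -- the reduced vector field exists and is unique
    (∃! X : ∀ β : CotangentBundle r S, TangentSpace (cotModel r) β, C.IsReducedDynamics X) ∧
    ∀ X : ∀ β : CotangentBundle r S, TangentSpace (cotModel r) β, C.IsReducedDynamics X →
      -- (i) invariance of a basic volume form
      (∀ σ : S → ℝ, ContMDiff (𝓡 r) 𝓘(ℝ, ℝ) ∞ σ →
        (PreservesForm X (basicVolume σ) ↔ C.ThetaEqDiff σ)) ∧
      -- (ii) in the absence of potential energy
      ((∀ q, C.U q = 0) →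
        ((∃ μ : ∀ β : CotangentBundle r S, TangentSpace (cotModel r) β [⋀^Fin r × Fin 2]→ₗ[ℝ] ℝ,
            IsVolumeForm μ ∧ PreservesForm X μ) ↔
          ∃ σ : S → ℝ, ContMDiff (𝓡 r) 𝓘(ℝ, ℝ) ∞ σ ∧ PreservesForm X (basicVolume σ)) ∧
        ∀ ρ : CotangentBundle r S → ℝ, ContMDiff (cotModel r) 𝓘(ℝ, ℝ) ∞ ρ →
          PreservesForm X (expVolume ρ) →
          PreservesForm X (basicVolume fun s : S => ρ (covector s 0))) := by
  refine ⟨C.existsUnique_isReducedDynamics, fun X hX =>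
    ⟨fun σ hσ => hX.preservesForm_basicVolume_iff hσ, fun hU => ?_⟩⟩
  have hzero : ∀ ρ : CotangentBundle r S → ℝ, ContMDiff (cotModel r) 𝓘(ℝ, ℝ) ∞ ρ →
      PreservesForm X (expVolume ρ) →
      PreservesForm X (basicVolume fun s : S => ρ (covector s 0)) := fun ρ hρ h =>
    hX.preservesForm_zeroSection hU hρ h
  refine ⟨⟨fun ⟨μ, hμ, hXμ⟩ => ?_, fun ⟨σ, hσ, hXσ⟩ => ?_⟩, hzero⟩
  · obtain ⟨ρ, hρ, hXρ⟩ := hμ.exists_preservesForm_expVolume hXμ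
    exact ⟨_, hρ.comp contMDiff_covector_zero, hzero ρ hρ hXρ⟩
  · exact ⟨_, isVolumeForm_expVolume (contMDiff_comp_cot_proj hσ), hXσ⟩
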